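/- **Setting.** Write points of $\mathbf R^3$ as $(x,y)$, $x\in\mathbf R^2$, $y\in\mathbf R$, and let $\mathcal P(x,y)=x$, $\sigma(x,y)=(x,-y)$, $\alpha_+(x,y)=(\alpha x,y)$ for $\alpha\in\mathbf O(2)$. The element $(v,\delta)$ of the Euclidean group $\mathbf E(3)$ is the map $z\mapsto v+\delta z$. Let $\Gamma\le\mathbf E(3)$ be a crystallographic group with lattice $\mathcal L=\{v:(v,\mathrm{Id})\in\Gamma\}$, i.e. $\mathcal L$ is generated over $\mathbf Z$ by three linearly independent vectors, and let $\mathcal L_\sigma=\{w:(w,\sigma)\in\Gamma\}$ (empty if $\sigma$ is not in the point group of $\Gamma$). Let $X_\Gamma$ be the space of $\Gamma$-invariant $C^1$ functions $f:\mathbf R^3\to\mathbf R$, let $\Pi_{y_0}(f)(x)=\int_0^{y_0}f(x,y)\,dy$ for a width $y_0>0$, and let $\widetilde{\mathcal L}_{y_0}\le\mathbf R^2$ be the group of common periods of all functions in $\Pi_{y_0}(X_\Gamma)$. Put $\mathcal R_0(\mathcal L)=\{x:(x,0)\in\mathcal L\}$. Subscript $\mathbf Z$ means "generated over $\mathbf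 Z$". A planar lattice is *hexagonal* if it is $\{a,b\}_{\mathbf Z}$ with $a\neq0$, $|a|=|b|$ and angle $\pi/3$ between $a$ and $b$. Let $h_1=(1,0)$, $h_2=(\frac12,\frac{\sqrt3}2)$, $$\mathcal H=\{h_1,h_2\}_{\mathbf Z},\quad \mathrm{rec\,I}=\{(\tfrac12,0),(0,\tfrac{\sqrt3}2)\}_{\mathbf Z},\quad \mathrm{rec\,II}=\{(0,\tfrac{\sqrt3}2),(1,0)\}_{\mathbf Z},\quad \mathrm{rec\,III}=\{(\tfrac14,\tfrac{\sqrt3}4),(\tfrac32,-\tfrac{\sqrt3}2)\}_{\mathbf Z},$$ $$\mathcal R^{+}=\{(\tfrac14,\tfrac{\sqrt3}4),(-\tfrac34,\tfrac{\sqrt3}4)\}_{\mathbf Z},\qquad \mathcal R^{-}=\{(\tfrac14,-\tfrac{\sqrt3}4),(\tfrac34,\tfrac{\sqrt3}4)\}_{\mathbf Z}$$ ($\mathcal R^\pm$ is rec I rotated by $\pm\pi/3$), and $rM=\{rm:m\in M\}$. For $c>0$ and $y_1\in[0,c)$ let $A,B,C$ be the sets of all $y_0>0$ in $c\mathbf Z$,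 $y_1+c\mathbf Z$, $y_1+\frac c2+c\mathbf Z$ respectively, and let $\mathcal O$ be the set of $y_0>0$ outside $A\cup B\cup C$. **The cases.** * *Case 1.* $\mathcal L=\{(h_1,0),(h_2,0),(c_0,c)\}_{\mathbf Z}$ with $c\ne0$ and $nc_0\notin\mathcal H$ for all integers $n\neq0$. * *Case 2.1.* $\mathcal L=\{(h_1,a_3),(h_2,b_3),(0,c)\}_{\mathbf Z}$, $c>0$, $a_3,b_3\in[0,c)$, $\sigma\mathcal L\not\subset\mathcal L$. * *Case 2.2.* $\mathcal L=\{(\hat a,a_3),(\hat b,b_3),(0,c)\}_{\mathbf Z}$, $c>0$, $a_3,b_3\in[0,c)$, $\sigma\mathcal L\not\subset\mathcal L$, where $D=\{(m,n)\in\mathbf Z^2:ma_3+nb_3\in c\mathbf Z\}$ is generated by two linearly independent elements $(m_1,m_2),(n_1,n_2)$ with $m_1\hat a+m_2\hat b=h_1$, $n_1\hat a+n_2\hat b=h_2$. * *Cases 3, 4, 5.* $\mathcal L=\{(\hat a,tc),(\hat b,0),(0,c)\}_{\mathbf Z}$ with $c>0$ and, in case 3, $\mathcal L_\sigma=\emptyset$;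 in cases 4 and 5, $(v_1,y_1)\in\mathcal L_\sigma$ with $y_1\in[0,c)$. The possible data, followed by the value of $\widetilde{\mathcal L}_{y_0}$ for $y_0\in A$, for $y_0\in B\setminus A$, for $y_0\in C\setminus A$, and for $y_0\in\mathcal O$, are: | case | $\hat a$ | $t$ | $\hat b$ | $v_1$ | $A$ | $B\setminus A$ | $C\setminus A$ | $\mathcal O$ | |---|---|---|---|---|---|---|---|---| | 3.1 | $h_1$ | $0$ | $h_2$ | – | $\mathcal H$ | $\mathcal H$ | $\mathcal H$ | $\mathcal H$ | | 3.2 | $h_1$ | $\frac12$ | $h_2$ | – | $\mathcal H$ | $2\mathcal R^+$ | $2\mathcal R^+$ | $2\mathcal R^+$ | | 3.3 | $\frac12h_1$ | $\frac12$ | $h_2$ | – | rec I | $\mathcal H$ | $\mathcal H$ | $\mathcal H$ | | 4.1 | $h_1$ | $0$ | $h_2$ | $0$ | $\mathcal H$ | $\mathcal H$ | $\mathcal H$ | $\mathcal H$ | | 4.1 | $h_1$ | $0$ | $h_2$ | $\frac12h_1$ | rec I | rec I | $\mathcal H$ | $\mathcal H$ | | 4.1 | $h_1$ | $0$ | $h_2$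 | $\frac12h_2$ | $\mathcal R^+$ | $\mathcal R^+$ | $\mathcal H$ | $\mathcal H$ | | 4.1 | $h_1$ | $0$ | $h_2$ | $\frac12(h_1+h_2)$ | $\mathcal R^-$ | $\mathcal R^-$ | $\mathcal H$ | $\mathcal H$ | | 4.2 | $2h_1$ | $0$ | $h_2$ | $h_1$ | $\mathcal H$ | $\mathcal H$ | $2\mathcal R^+$ | $2\mathcal R^+$ | | 4.3 | $h_1$ | $0$ | $2h_2$ | $h_2$ | $\mathcal H$ | $\mathcal H$ | $2$ rec I | $2$ rec I | | 5.1 | $h_1$ | $\frac12$ | $h_2$ | $0$ | $\mathcal H$ | $2\mathcal R^+$ | $\mathcal H$ | $2\mathcal R^+$ | | 5.1 | $h_1$ | $\frac12$ | $h_2$ | $h_1$ | $\mathcal H$ | $\mathcal H$ | $2\mathcal R^+$ | $2\mathcal R^+$ | | 5.2 | $h_1$ | $\frac12$ | $2h_2$ | $h_2$ | $\mathcal H$ | $2\mathcal R^+$ | $2\mathcal R^-$ | $2\mathcal H$ | | 5.2 | $h_1$ | $\frac12$ | $2h_2$ | $h_1+h_2$ | $\mathcal H$ | $2\mathcal R^-$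 | $2\mathcal R^+$ | $2\mathcal H$ | | 5.3 | $h_1-\frac12h_2$ | $\frac12$ | $h_2$ | $\frac12h_2$ | $\mathcal R^+$ | rec III | $\mathcal H$ | $2\mathcal R^+$ | | 5.3 | $h_1-\frac12h_2$ | $\frac12$ | $h_2$ | $h_1$ | $\mathcal R^+$ | $\mathcal H$ | rec III | $2\mathcal R^+$ | | 5.4 | $\frac12h_1$ | $\frac12$ | $2h_2$ | $h_2$ | rec I | $\mathcal H$ | rec II | $2$ rec I | | 5.4 | $\frac12h_1$ | $\frac12$ | $2h_2$ | $\frac12h_1+h_2$ | rec I | rec II | $\mathcal H$ | $2$ rec I | | 5.5 | $\frac12h_1$ | $\frac12$ | $h_2$ | $0$ | rec I | $\mathcal H$ | rec I | $\mathcal H$ | | 5.5 | $\frac12h_1$ | $\frac12$ | $h_2$ | $\frac12h_1$ | rec I | rec I | $\mathcal H$ | $\mathcal H$ | | 5.5 | $\frac12h_1$ | $\frac12$ | $h_2$ | $\frac12h_2$ | $\frac12\mathcal H$ | $\mathcal R^+$ | $\mathcal R^-$ | $\mathcal H$ | | 5.5 | $\frac12h_1$ | $\frac12$ | $h_2$ |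 $\frac12(h_1+h_2)$ | $\frac12\mathcal H$ | $\mathcal R^-$ | $\mathcal R^+$ | $\mathcal H$ | **Theorem.** 1. *(Completeness.)* If $\widetilde{\mathcal L}_{y_0}=\mathcal H$ for some $y_0>0$, then $\mathcal L$ is in case 1, 2.1 or 2.2, or there is $\alpha\in\mathbf O(2)$ with $\alpha\mathcal H=\mathcal H$ such that $\alpha_+\Gamma\alpha_+^{-1}$ is in one of the rows of the table for some $c>0$, $y_1\in[0,c)$. 2. *(Each case occurs.)* Every lattice as in case 1, 2.1 or 2.2 is the lattice of some crystallographic group, and for every row of the table and all $c>0$, $y_1\in[0,c)$ there is a crystallographic group in that row with these parameters. 3. *(Periods.)* In case 1, $\widetilde{\mathcal L}_{y_0}=\mathcal H$ for all $y_0>0$. Whenever $\sigma\mathcal L\not\subset\mathcal L$ and $(0,c)$, $c>0$, generates $\mathcal L\cap(\{0\}\times\mathbf R)$, we have $\widetilde{\mathcal L}_{y_0}=\mathcal P(\mathcal L)$ for $y_0\in A$ and $\widetilde{\mathcal L}_{y_0}=\mathcal R_0(\mathcal L)$ for all other $y_0>0$. In case 2.1, $a_3\ne0$ or $b_3\neq0$,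 and $\widetilde{\mathcal L}_{y_0}=\mathcal H$ for $y_0\in A$, while for all other $y_0>0$ it is the proper submodule $\mathcal R_0(\mathcal L)=\{mh_1+nh_2: ma_3+nb_3\in c\mathbf Z\}\subsetneq\mathcal H$. In case 2.2, $\widetilde{\mathcal L}_{y_0}=\{\hat a,\hat b\}_{\mathbf Z}\supsetneq\mathcal H$, with $\hat a,\hat b$ linearly independent, for $y_0\in A$, and $\widetilde{\mathcal L}_{y_0}=\mathcal H$ for all other $y_0>0$. In cases 3, 4 and 5, $\widetilde{\mathcal L}_{y_0}$ is as given in the table. 4. *(All widths.)* Suppose $\widetilde{\mathcal L}_{y_0}=\mathcal H$ for some $y_0>0$. Then $\widetilde{\mathcal L}_{y_0}=\mathcal H$ for all $y_0>0$ if and only if $\Gamma$ is in case 1, in case 3.1, or in case 4.1 with $v_1=0$. Moreover $\widetilde{\mathcal L}_{y_0}$ is a hexagonal lattice for every $y_0>0$ if and only if $\Gamma$ is in one of these three cases, or in case 2.1 or 2.2 with both $\mathcal P(\mathcal L)$ and $\mathcal R_0(\mathcal L)$ hexagonal. 5. *(Special lattices in case 2.)* Each of the following $\mathcal L$ satisfies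 $\sigma\mathcal L\not\subset\mathcal L$, and for every crystallographic group with lattice $\mathcal L$ we have $\widetilde{\mathcal L}_{y_0}=\mathcal P(\mathcal L)$ for positive $y_0\in c\mathbf Z$ and $\widetilde{\mathcal L}_{y_0}=\mathcal R_0(\mathcal L)$ for all other $y_0>0$, both hexagonal. Here $\mathcal G=\{(\frac12,\frac{\sqrt3}6),(\frac12,-\frac{\sqrt3}6)\}_{\mathbf Z}$, $\mathcal K=\{(\frac32,\frac{\sqrt3}2),(\frac32,-\frac{\sqrt3}2)\}_{\mathbf Z}$, and $D$ is as in case 2.2, formed with the heights of the first two generators and with $c$, the height of the third: * rhombohedral: $(1,0,1)$, $(-\frac12,-\frac{\sqrt3}2,1)$, $(0,0,3)$; $\mathcal P(\mathcal L)=\mathcal H$, $\mathcal R_0(\mathcal L)=\mathcal K$, $D=\{(2,1),(1,2)\}_{\mathbf Z}$; * primitive cubic: $(1,0,0)$, $(\frac12,\frac{\sqrt3}6,-\frac{\sqrt6}6)$, $(0,0,\frac{\sqrt6}2)$; body-centred cubic: $(1,0,0)$, $(\frac12,\frac{\sqrt3}6,-\frac{\sqrt6}{12})$, $(0,0,\frac{\sqrt6}4)$;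 face-centred cubic: $(1,0,0)$, $(\frac12,\frac{\sqrt3}6,\frac{\sqrt6}3)$, $(0,0,\sqrt6)$; in all three $\mathcal P(\mathcal L)=\mathcal G$, $\mathcal R_0(\mathcal L)=\mathcal H$, $D=\{(0,3),(1,3)\}_{\mathbf Z}$. These lattices are respectively rhombohedral (generated by three linearly independent vectors forming an orbit under a rotation of order three), primitive, body-centred and face-centred cubic. 6. *(Three-fold symmetry.)* The statement in 5 also holds, for every real $c\neq0$, for the rhombohedral lattices $\mathcal A_c=\{(1,0,\frac c3),(-\frac12,-\frac{\sqrt3}2,\frac c3),(0,0,c)\}_{\mathbf Z}$, with $\mathcal P=\mathcal H$, $\mathcal R_0=\mathcal K$, and $\mathcal B_c=\{(1,0,0),(\frac12,\frac{\sqrt3}6,-\frac c3),(0,0,c)\}_{\mathbf Z}$, with $\mathcal P=\mathcal G$, $\mathcal R_0=\mathcal H$. If $\widetilde{\mathcal L}_{y_0}=\mathcal H$ for some $y_0>0$ and if for every $y_0>0$ there are $v\in\mathbf R^2$ and a rotation $\rho$ of order three such that $x\mapsto v+\rho x$ is a symmetry of all functions in $\Pi_{y_0}(X_\Gamma)$,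 then for some $c\ne0$ the lattice $\mathcal L$ is the hexagonal lattice $\{(h_1,0),(h_2,0),(0,c)\}_{\mathbf Z}$, or $\mathcal A_c$, or $\mathcal B_c$. -/

import Mathlib

open scoped Pointwise

noncomputable section

namespace ProjPer

/-! ### Euclidean plane, Euclidean space, projection and reflection -/

/-- The plane `ℝ²` with its Euclidean norm. -/
abbrev Plane : Type := EuclideanSpace ℝ (Fin 2)

/-- Space `ℝ³ = ℝ² × ℝ` with its Euclidean norm; points are pairs `(x, y)`. -/
abbrev Space : Type := WithLp 2 (Plane × ℝ)

/-- The point `(x, y)` of space. -/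
def pt (x : Plane) (y : ℝ) : Space := WithLp.toLp 2 (x, y)

/-- The Euclidean group `E(3)` of space. -/
abbrev Euc : Type := Space ≃ᵃⁱ[ℝ] Space

/-- The element `(v, δ)` of the Euclidean group: `z ↦ v + δ z`. -/
def euc (v : Space) (δ : Space ≃ₗᵢ[ℝ] Space) : Euc :=
  AffineIsometryEquiv.constVAdd ℝ Space v * δ.toAffineIsometryEquiv

/-- The reflection `σ (x, y) = (x, -y)`. -/
def sigma : Space ≃ₗᵢ[ℝ] Space :=
  LinearIsometryEquiv.withLpProdCongr 2 (LinearIsometryEquiv.refl ℝ Plane)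
    (LinearIsometryEquiv.neg ℝ)

/-- `α₊ (x, y) = (α x, y)`. -/
def plus (α : Plane ≃ₗᵢ[ℝ] Plane) : Space ≃ₗᵢ[ℝ] Space :=
  LinearIsometryEquiv.withLpProdCongr 2 α (LinearIsometryEquiv.refl ℝ ℝ)

/-- The vertical projection `(x, y) ↦ x`. -/
def projHom : Space →+ Plane where
  toFun z := z.fst
  map_zero' := rfl
  map_add' _ _ := rfl

/-- The inclusion `x ↦ (x, 0)`. -/
def inclHom : Plane →+ Space where
  toFun x := pt x 0
  map_zero' := rfl
  map_add' x x' := by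
    simp [pt, ← WithLp.toLp_add]

/-! ### Lattices -/

/-- The `ℤ`-module generated by two vectors of the plane. -/
def gen2 (a b : Plane) : AddSubgroup Plane := AddSubgroup.closure {a, b}

/-- The `ℤ`-module generated by three vectors of space. -/
def gen3 (a b c : Space) : AddSubgroup Space := AddSubgroup.closure {a, b, c}

/-- A lattice in space: generated over `ℤ` by three linearly independent vectors. -/
def IsLattice (L : AddSubgroup Space) : Prop :=
  ∃ a b c : Space, LinearIndependent ℝ ![a, b, c] ∧ L = gen3 a b c

/-- `𝒫(L)`, the projection of the whole lattice. -/
def projL (L : AddSubgroup Space) : AddSubgroup Plane := L.map projHom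

/-- `ℛ₀(L) = {x : (x, 0) ∈ L}`. -/
def restr0 (L : AddSubgroup Space) : AddSubgroup Plane := L.comap inclHom

/-- `σ L ⊆ L`. -/
def SigmaInv (L : AddSubgroup Space) : Prop := ∀ z ∈ L, sigma z ∈ L

/-- `D = {(m, n) ∈ ℤ² : m a₃ + n b₃ ≡ 0 (mod c)}`. -/
def modD (a3 b3 c : ℝ) : AddSubgroup (ℤ × ℤ) where
  carrier := {p | ∃ k : ℤ, (p.1 : ℝ) * a3 + (p.2 : ℝ) * b3 = k * c}
  zero_mem' := ⟨0, by simp⟩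
  add_mem' := by
    rintro p q ⟨k, hk⟩ ⟨l, hl⟩
    refine ⟨k + l, ?_⟩
    push_cast [Prod.fst_add, Prod.snd_add]
    linear_combination hk + hl
  neg_mem' := by
    rintro p ⟨k, hk⟩
    refine ⟨-k, ?_⟩
    push_cast [Prod.fst_neg, Prod.snd_neg]
    linear_combination -hk

/-! ### Crystallographic groups -/

/-- The translation module `{v : (v, Id) ∈ Γ}`. -/
def trans (Γ : Subgroup Euc) : AddSubgroup Space where
  carrier := {v | AffineIsometryEquiv.constVAdd ℝ Space v ∈ Γ}
  zero_mem' := by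
    change AffineIsometryEquiv.constVAdd ℝ Space (0 : Space) ∈ Γ
    rw [AffineIsometryEquiv.constVAdd_zero]
    exact Γ.one_mem
  add_mem' := by
    intro v w hv hw
    have h := Γ.mul_mem hv hw
    have e : AffineIsometryEquiv.constVAdd ℝ Space v * AffineIsometryEquiv.constVAdd ℝ Space w
        = AffineIsometryEquiv.constVAdd ℝ Space (v + w) := by
      ext1 z
      exact (add_vadd v w z).symm
    rwa [e] at h
  neg_mem' := by
    intro v hv
    have h := Γ.inv_mem hv
    have e : (AffineIsometryEquiv.constVAdd ℝ Space v)⁻¹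
        = AffineIsometryEquiv.constVAdd ℝ Space (-v) := by
      rw [inv_eq_iff_mul_eq_one]
      ext1 z
      exact vadd_neg_vadd v z
    rwa [e] at h

/-- `Γ` is a crystallographic group: its translations form a lattice. -/
def IsCryst (Γ : Subgroup Euc) : Prop := IsLattice (trans Γ)

/-- `L_σ`: the set of all `w` with `(w, σ) ∈ Γ`. It is `v_σ + L` if `(v_σ, σ) ∈ Γ`, and it is empty
if `σ` is not in the point group of `Γ`. -/
def transSigma (Γ : Subgroup Euc) : Set Space := {w | euc w sigma ∈ Γ}

/-- The group `α₊ Γ α₊⁻¹`. -/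
def conjPlus (α : Plane ≃ₗᵢ[ℝ] Plane) (Γ : Subgroup Euc) : Subgroup Euc :=
  Γ.map (MulAut.conj (plus α).toAffineIsometryEquiv).toMonoidHom

/-! ### Projected functions and their common periods -/

/-- `X_Γ`: the `Γ`-invariant functions of class `C¹`. -/
def invFun (Γ : Subgroup Euc) : Set (Space → ℝ) :=
  {f | ContDiff ℝ 1 f ∧ ∀ γ ∈ Γ, ∀ z, f (γ z) = f z}

/-- The projected function `Π_{y₀} f (x) = ∫₀^{y₀} f (x, y) dy`. -/
def projFun (y0 : ℝ) (f : Space → ℝ) (x : Plane) : ℝ := ∫ y in (0 : ℝ)..y0, f (pt x y)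

/-- The group of common periods of all functions in `Π_{y₀} (X_Γ)`. -/
def periods (Γ : Subgroup Euc) (y0 : ℝ) : AddSubgroup Plane where
  carrier := {p | ∀ f ∈ invFun Γ, ∀ x, projFun y0 f (x + p) = projFun y0 f x}
  zero_mem' := by intro f _ x; rw [add_zero]
  add_mem' := by
    intro p q hp hq f hf x
    rw [← add_assoc, hq f hf, hp f hf]
  neg_mem' := by
    intro p hp f hf x
    rw [← hp f hf (x + -p), neg_add_cancel_right]

/-- `(v, ρ) ∈ E(2)` is a symmetry of all functions in `Π_{y₀} (X_Γ)`. -/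
def IsProjSymm (Γ : Subgroup Euc) (y0 : ℝ) (v : Plane) (ρ : Plane ≃ₗᵢ[ℝ] Plane) : Prop :=
  ∀ f ∈ invFun Γ, ∀ x, projFun y0 f (v + ρ x) = projFun y0 f x

/-! ### The planar lattices that occur as groups of periods -/

/-- `h₁ = (1, 0)`. -/
def h1 : Plane := !₂[1, 0]

/-- `h₂ = (1/2, √3/2)`. -/
def h2 : Plane := !₂[1 / 2, √3 / 2]

/-- The standard hexagonal lattice. -/
def hexL : AddSubgroup Plane := gen2 h1 h2

/-- Rectangular I. -/
def recI : AddSubgroup Plane := gen2 !₂[1 / 2, 0] !₂[0, √3 / 2]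

/-- Rectangular II. -/
def recII : AddSubgroup Plane := gen2 !₂[0, √3 / 2] !₂[1, 0]

/-- Rectangular III. -/
def recIII : AddSubgroup Plane := gen2 !₂[1 / 4, √3 / 4] !₂[3 / 2, -(√3 / 2)]

/-- Rectangular I rotated by `π/3`. -/
def rotRecI : AddSubgroup Plane := gen2 !₂[1 / 4, √3 / 4] !₂[-(3 / 4), √3 / 4]

/-- Rectangular I rotated by `-π/3`. -/
def rotNegRecI : AddSubgroup Plane := gen2 !₂[1 / 4, -(√3 / 4)] !₂[3 / 4, √3 / 4]

/-- `α` belongs to the holohedry of the standard hexagonal lattice. -/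
def HolHex (α : Plane ≃ₗᵢ[ℝ] Plane) : Prop := ∀ x, α x ∈ hexL ↔ x ∈ hexL

/-- A (not necessarily standard) hexagonal lattice in the plane: it has two generators of the same
length at an angle `π/3`. -/
def IsHexagonal (M : AddSubgroup Plane) : Prop :=
  ∃ a b : Plane, a ≠ 0 ∧ ‖b‖ = ‖a‖ ∧ inner ℝ a b = ‖a‖ ^ 2 / 2 ∧ M = gen2 a b

/-! ### Sets of widths -/

/-- The widths `y₀ > 0` with `y₀ = s + n c` for an integer `n`. -/
def widths (s c : ℝ) : Set ℝ := {y0 | 0 < y0 ∧ ∃ n : ℤ, y0 = s + n * c}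

/-- For every width `y₀ > 0`, the group of common periods is `MA` for `y₀` in `A = cℤ`, it is `MB`
for `y₀ ∉ A` in `B = y₁ + cℤ`, it is `MC` for `y₀ ∉ A` in `C = y₁ + c/2 + cℤ`, and it is `MO`
for all other `y₀`. -/
def PeriodTable (Γ : Subgroup Euc) (c y1 : ℝ) (MA MB MC MO : AddSubgroup Plane) : Prop :=
  ∀ y0 : ℝ, 0 < y0 →
    (y0 ∈ widths 0 c → periods Γ y0 = MA) ∧
    (y0 ∈ widths y1 c \ widths 0 c → periods Γ y0 = MB) ∧
    (y0 ∈ widths (y1 + c / 2) c \ widths 0 c → periods Γ y0 = MC) ∧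
    (y0 ∉ widths 0 c ∪ widths y1 c ∪ widths (y1 + c / 2) c → periods Γ y0 = MO)

/-! ### Cases 1 and 2 -/

/-- Case 1: `{(h₁, 0), (h₂, 0), (c₀, c)}_ℤ` with no nonzero integer multiple of `c₀` in the
hexagonal lattice. -/
def Case1 (L : AddSubgroup Space) : Prop :=
  ∃ (c0 : Plane) (c : ℝ), c ≠ 0 ∧ (∀ n : ℤ, n ≠ 0 → n • c0 ∉ hexL) ∧
    L = gen3 (pt h1 0) (pt h2 0) (pt c0 c)

/-- Case 2.1: `σ L ⊄ L` and `L` projects onto the standard hexagonal lattice. -/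
def Case21 (L : AddSubgroup Space) (a3 b3 c : ℝ) : Prop :=
  0 < c ∧ a3 ∈ Set.Ico 0 c ∧ b3 ∈ Set.Ico 0 c ∧
    L = gen3 (pt h1 a3) (pt h2 b3) (pt 0 c) ∧ ¬ SigmaInv L

/-- Case 2.2: `σ L ⊄ L` and the elements of `L` at height `0` form the standard hexagonal lattice,
written through two generators of `D`. -/
def Case22 (L : AddSubgroup Space) (a b : Plane) (a3 b3 c : ℝ) : Prop :=
  0 < c ∧ a3 ∈ Set.Ico 0 c ∧ b3 ∈ Set.Ico 0 c ∧
    L = gen3 (pt a a3) (pt b b3) (pt 0 c) ∧ ¬ SigmaInv L ∧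
    ∃ m1 m2 n1 n2 : ℤ, m1 * n2 - m2 * n1 ≠ 0 ∧
      modD a3 b3 c = AddSubgroup.closure {(m1, m2), (n1, n2)} ∧
      m1 • a + m2 • b = h1 ∧ n1 • a + n2 • b = h2

/-! ### Cases 3, 4 and 5: the columns of the tables -/

/-- A column: the lattice is `{(a, t c), (b, 0), (0, c)}_ℤ`; `v = none` if `σ` is not in the point
group, and `v = some v₁` if `((v₁, y₁), σ) ∈ Γ`; the last four entries are the resulting groups of
periods, with the convention of `PeriodTable`. -/
structure Column where
  a : Plane
  t : ℝ
  b : Plane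
  v : Option Plane
  onA : AddSubgroup Plane
  onB : AddSubgroup Plane
  onC : AddSubgroup Plane
  onO : AddSubgroup Plane

/-- The lattice of a column with parameter `c`. -/
def Column.lattice (k : Column) (c : ℝ) : AddSubgroup Space :=
  gen3 (pt k.a (k.t * c)) (pt k.b 0) (pt 0 c)

/-- The condition of a column on the elements of `Γ` with orthogonal component `σ`. -/
def Column.Glide (k : Column) (Γ : Subgroup Euc) (y1 : ℝ) : Prop :=
  match k.v with
  | none => transSigma Γ = ∅
  | some v1 => pt v1 y1 ∈ transSigma Γ

/-- `Γ` belongs to the column `k`, with parameters `c > 0` and `y₁ ∈ [0, c)`. -/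
def Column.Has (k : Column) (Γ : Subgroup Euc) (c y1 : ℝ) : Prop :=
  0 < c ∧ y1 ∈ Set.Ico 0 c ∧ trans Γ = k.lattice c ∧ k.Glide Γ y1

/-- Case 3.1. -/
def col31 : Column := ⟨h1, 0, h2, none, hexL, hexL, hexL, hexL⟩

/-- Case 3.2. -/
def col32 : Column :=
  ⟨h1, 1 / 2, h2, none, hexL, (2 : ℝ) • rotRecI, (2 : ℝ) • rotRecI, (2 : ℝ) • rotRecI⟩

/-- Case 3.3. -/
def col33 : Column := ⟨!₂[1 / 2, 0], 1 / 2, h2, none, recI, hexL, hexL, hexL⟩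

/-- Case 4.1 with `v₁ = 0`. -/
def col41a : Column := ⟨h1, 0, h2, some 0, hexL, hexL, hexL, hexL⟩

/-- Case 4.1 with `v₁ = h₁/2`. -/
def col41b : Column := ⟨h1, 0, h2, some !₂[1 / 2, 0], recI, recI, hexL, hexL⟩

/-- Case 4.1 with `v₁ = h₂/2`. -/
def col41c : Column := ⟨h1, 0, h2, some !₂[1 / 4, √3 / 4], rotRecI, rotRecI, hexL, hexL⟩

/-- Case 4.1 with `v₁ = (h₁ + h₂)/2`. -/
def col41d : Column := ⟨h1, 0, h2, some !₂[3 / 4, √3 / 4], rotNegRecI, rotNegRecI, hexL, hexL⟩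

/-- Case 4.2. -/
def col42 : Column :=
  ⟨!₂[2, 0], 0, h2, some h1, hexL, hexL, (2 : ℝ) • rotRecI, (2 : ℝ) • rotRecI⟩

/-- Case 4.3. -/
def col43 : Column :=
  ⟨h1, 0, !₂[1, √3], some h2, hexL, hexL, (2 : ℝ) • recI, (2 : ℝ) • recI⟩

/-- Case 5.1 with `v₁ = 0`. -/
def col51a : Column :=
  ⟨h1, 1 / 2, h2, some 0, hexL, (2 : ℝ) • rotRecI, hexL, (2 : ℝ) • rotRecI⟩

/-- Case 5.1 with `v₁ = h₁`. -/
def col51b : Column :=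
  ⟨h1, 1 / 2, h2, some h1, hexL, hexL, (2 : ℝ) • rotRecI, (2 : ℝ) • rotRecI⟩

/-- Case 5.2 with `v₁ = h₂`. -/
def col52a : Column :=
  ⟨h1, 1 / 2, !₂[1, √3], some h2,
    hexL, (2 : ℝ) • rotRecI, (2 : ℝ) • rotNegRecI, (2 : ℝ) • hexL⟩

/-- Case 5.2 with `v₁ = h₁ + h₂`. -/
def col52b : Column :=
  ⟨h1, 1 / 2, !₂[1, √3], some !₂[3 / 2, √3 / 2],
    hexL, (2 : ℝ) • rotNegRecI, (2 : ℝ) • rotRecI, (2 : ℝ) • hexL⟩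

/-- Case 5.3 with `v₁ = h₂/2`. -/
def col53a : Column :=
  ⟨!₂[3 / 4, -(√3 / 4)], 1 / 2, h2, some !₂[1 / 4, √3 / 4],
    rotRecI, recIII, hexL, (2 : ℝ) • rotRecI⟩

/-- Case 5.3 with `v₁ = h₁`. -/
def col53b : Column :=
  ⟨!₂[3 / 4, -(√3 / 4)], 1 / 2, h2, some h1, rotRecI, hexL, recIII, (2 : ℝ) • rotRecI⟩

/-- Case 5.4 with `v₁ = h₂`. -/
def col54a : Column :=
  ⟨!₂[1 / 2, 0], 1 / 2, !₂[1, √3], some h2, recI, hexL, recII, (2 : ℝ) • recI⟩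

/-- Case 5.4 with `v₁ = h₁/2 + h₂`. -/
def col54b : Column :=
  ⟨!₂[1 / 2, 0], 1 / 2, !₂[1, √3], some !₂[1, √3 / 2], recI, recII, hexL, (2 : ℝ) • recI⟩

/-- Case 5.5 with `v₁ = 0`. -/
def col55a : Column := ⟨!₂[1 / 2, 0], 1 / 2, h2, some 0, recI, hexL, recI, hexL⟩

/-- Case 5.5 with `v₁ = h₁/2`. -/
def col55b : Column := ⟨!₂[1 / 2, 0], 1 / 2, h2, some !₂[1 / 2, 0], recI, recI, hexL, hexL⟩

/-- Case 5.5 with `v₁ = h₂/2`. -/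
def col55c : Column :=
  ⟨!₂[1 / 2, 0], 1 / 2, h2, some !₂[1 / 4, √3 / 4],
    (1 / 2 : ℝ) • hexL, rotRecI, rotNegRecI, hexL⟩

/-- Case 5.5 with `v₁ = (h₁ + h₂)/2`. -/
def col55d : Column :=
  ⟨!₂[1 / 2, 0], 1 / 2, h2, some !₂[3 / 4, √3 / 4],
    (1 / 2 : ℝ) • hexL, rotNegRecI, rotRecI, hexL⟩

/-- All columns of cases 3, 4 and 5. -/
def columns : List Column :=
  [col31, col32, col33, col41a, col41b, col41c, col41d, col42, col43, col51a, col51b, col52a,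
    col52b, col53a, col53b, col54a, col54b, col55a, col55b, col55c, col55d]

/-! ### Rhombohedral and cubic lattices -/

/-- Rhombohedral lattice: generated by the orbit of one vector under a rotation of order three. -/
def IsRhombohedral (L : AddSubgroup Space) : Prop :=
  ∃ (R : Space ≃ₗᵢ[ℝ] Space) (w : Space), R ^ 3 = 1 ∧
    LinearIndependent ℝ ![w, R w, R (R w)] ∧ L = gen3 w (R w) (R (R w))

/-- Primitive cubic lattice with cube side `s`. -/
def IsPrimitiveCubic (L : AddSubgroup Space) : Prop :=
  ∃ (e : OrthonormalBasis (Fin 3) ℝ Space) (s : ℝ), 0 < s ∧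
    L = gen3 (s • e 0) (s • e 1) (s • e 2)

/-- Body-centred cubic lattice with cube side `s`. -/
def IsBodyCentredCubic (L : AddSubgroup Space) : Prop :=
  ∃ (e : OrthonormalBasis (Fin 3) ℝ Space) (s : ℝ), 0 < s ∧
    L = gen3 ((s / 2) • (-e 0 + e 1 + e 2)) ((s / 2) • (e 0 - e 1 + e 2))
      ((s / 2) • (e 0 + e 1 - e 2))

/-- Face-centred cubic lattice with cube side `s`. -/
def IsFaceCentredCubic (L : AddSubgroup Space) : Prop :=
  ∃ (e : OrthonormalBasis (Fin 3) ℝ Space) (s : ℝ), 0 < s ∧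
    L = gen3 ((s / 2) • (e 1 + e 2)) ((s / 2) • (e 0 + e 2)) ((s / 2) • (e 0 + e 1))

/-- The family of lattices with generators `(1, 0, c/3)`, `(-1/2, -√3/2, c/3)`, `(0, 0, c)`. -/
def rhombA (c : ℝ) : AddSubgroup Space :=
  gen3 (pt !₂[1, 0] (c / 3)) (pt !₂[-(1 / 2), -(√3 / 2)] (c / 3)) (pt 0 c)

/-- The family of lattices with generators `(1, 0, 0)`, `(1/2, √3/6, -c/3)`, `(0, 0, c)`. -/
def rhombB (c : ℝ) : AddSubgroup Space :=
  gen3 (pt !₂[1, 0] 0) (pt !₂[1 / 2, √3 / 6] (-(c / 3))) (pt 0 c)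

/-- The rhombohedral lattice with the following generators. -/
def rhombohedralL : AddSubgroup Space :=
  gen3 (pt !₂[1, 0] 1) (pt !₂[-(1 / 2), -(√3 / 2)] 1) (pt 0 3)

/-- The primitive cubic lattice with the following generators. -/
def primitiveL : AddSubgroup Space :=
  gen3 (pt !₂[1, 0] 0) (pt !₂[1 / 2, √3 / 6] (-(√6 / 6))) (pt 0 (√6 / 2))

/-- The body-centred cubic lattice with the following generators. -/
def bodyL : AddSubgroup Space :=
  gen3 (pt !₂[1, 0] 0) (pt !₂[1 / 2, √3 / 6] (-(√6 / 12))) (pt 0 (√6 / 4))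

/-- The face-centred cubic lattice with the following generators. -/
def faceL : AddSubgroup Space :=
  gen3 (pt !₂[1, 0] 0) (pt !₂[1 / 2, √3 / 6] (√6 / 3)) (pt 0 √6)

/-- The larger hexagonal lattice `𝒫(L)` of the cubic lattices. -/
def bigHex : AddSubgroup Plane := gen2 !₂[1 / 2, √3 / 6] !₂[1 / 2, -(√3 / 6)]

/-- The smaller hexagonal lattice `ℛ₀(L)` of the rhombohedral lattice. -/
def smallHex : AddSubgroup Plane := gen2 !₂[3 / 2, √3 / 2] !₂[3 / 2, -(√3 / 2)]

/-- `L` satisfies `σ L ⊄ L`, and for every crystallographic group with lattice `L` the group of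
common periods is `P = 𝒫(L)` for the widths in `cℤ` and `R = ℛ₀(L)` for all other widths. -/
def ProjectsTo (L : AddSubgroup Space) (c : ℝ) (P R : AddSubgroup Plane) : Prop :=
  ¬ SigmaInv L ∧ projL L = P ∧ restr0 L = R ∧
    ∀ Γ : Subgroup Euc, IsCryst Γ → trans Γ = L → ∀ y0 : ℝ, 0 < y0 →
      (y0 ∈ widths 0 c → periods Γ y0 = P) ∧ (y0 ∉ widths 0 c → periods Γ y0 = R)

end ProjPer

end

open scoped Pointwise

namespace ProjPer

section

/-! ### Coordinates in space -/

/-! The whole classification rests on one description of the periods, `mem_periods`. A vector `p` is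
a period for the width `y0` exactly when the group contains a reason for it: the translation `(p,
0)`; an element with orthogonal part `σ` and vector `(p, y0)`, which turns the layer `[0, y0]`
upside down; or, if `(0, y0)` is itself a translation, any translation or `σ`-element over `p`,
because an integral over a full vertical period does not depend on where it starts.

That nothing else produces a period is shown, for an arbitrary planar isometry, in `symm_cases`. The
test functions are sums over `Γ` of translates of the vertical derivative of a bump at `(x, u)`. For
almost every `x`, the only elements that bring `(x, u)` onto the line over `v + α x` preserve the
vertical direction up to sign, and by the fundamental theorem of calculus the integral counts, with
signs, those that bring it to an end of the segment (`projFun_orbSum_dBump`). A symmetry must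
preserve this count (`jump_eq`); the heights `u = 0` and `u = y0` and the group law suffice for the
conclusion.

From then on the argument is about lattices. The set `L_σ` is empty or one coset of `L`, and it can
be nonempty only if `σ L ⊆ L`. In that case lattice heights are multiples of `c/2`, with `c` the
vertical period. Every vector in the table lies in half the hexagonal lattice, so membership becomes
a divisibility condition by Cramer's rule (`mem_lat`), and the table becomes a finite list of
congruences (`codes_table`, `Code.periodTable`).

For completeness, suppose the periods form the hexagonal lattice. It is then the union of a subgroup
(`ℛ₀(L)`, or `𝒫(L)` when `y0` is a vertical period) and at most one further coset, so the subgroup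
is everything or has index two. The holohedry permutes the index-two subgroups transitively
(`IndexTwo.exists_holHex`), which leaves a few normal forms to be matched with columns. Without
`σ`-invariance there is no coset, and generators come from counting ranks over `ℤ`
(`exists_basis_map`).

For the statements on all widths, every column other than the two constant ones has a width whose
periods form a rectangular lattice with sides of ratio `√3` (`codes_rect`, `Code.exists_isRect`);
such a lattice is neither hexagonal nor invariant under a rotation of order three. If `σ L ⊄ L`, a
three-fold symmetry at a width that is not a vertical period acts on `L`, and `1 + ρ + ρ² = 0`
forces the heights of suitable generators to be thirds of the vertical period (`case21_threefold`,
`rhombB_threefold`). -/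

@[simp] theorem pt_fst (x : Plane) (y : ℝ) : (pt x y).fst = x := rfl

@[simp] theorem pt_snd (x : Plane) (y : ℝ) : (pt x y).snd = y := rfl

theorem pt_eta (z : Space) : pt z.fst z.snd = z := rfl

theorem pt_ext {z w : Space} (h : z.fst = w.fst) (h' : z.snd = w.snd) : z = w := by
  rw [← pt_eta z, ← pt_eta w, h, h']

theorem pt_inj {x x' : Plane} {y y' : ℝ} : pt x y = pt x' y' ↔ x = x' ∧ y = y' :=
  ⟨fun h => ⟨congrArg (fun z : Space => z.fst) h, congrArg (fun z : Space => z.snd) h⟩,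
    fun h => by rw [h.1, h.2]⟩

theorem pt_add (x x' : Plane) (y y' : ℝ) : pt x y + pt x' y' = pt (x + x') (y + y') := rfl
theorem pt_sub (x x' : Plane) (y y' : ℝ) : pt x y - pt x' y' = pt (x - x') (y - y') := rfl
theorem pt_neg (x : Plane) (y : ℝ) : -pt x y = pt (-x) (-y) := rfl
theorem pt_smul (r : ℝ) (x : Plane) (y : ℝ) : r • pt x y = pt (r • x) (r * y) := rfl
theorem pt_zero : pt 0 0 = 0 := rfl

theorem pt_zsmul (n : ℤ) (x : Plane) (y : ℝ) : n • pt x y = pt (n • x) (n * y) := by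
  rw [← Int.cast_smul_eq_zsmul ℝ, pt_smul, Int.cast_smul_eq_zsmul]

@[simp] theorem sigma_pt (x : Plane) (y : ℝ) : sigma (pt x y) = pt x (-y) := rfl
@[simp] theorem plus_pt (α : Plane ≃ₗᵢ[ℝ] Plane) (x : Plane) (y : ℝ) :
    plus α (pt x y) = pt (α x) y := rfl

theorem pt_norm_sq (z : Space) : ‖z‖ ^ 2 = ‖z.fst‖ ^ 2 + z.snd ^ 2 := by
  rw [WithLp.prod_norm_sq_eq_of_L2]; simp

/-! ### Generated lattices -/

theorem mem_gen2 {a b x : Plane} : x ∈ gen2 a b ↔ ∃ m n : ℤ, x = m • a + n • b := by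
  unfold gen2
  rw [AddSubgroup.mem_closure_pair]
  simp only [eq_comm]

theorem mem_gen3 {a b c z : Space} :
    z ∈ gen3 a b c ↔ ∃ m n l : ℤ, z = m • a + n • b + l • c := by
  unfold gen3
  rw [Set.insert_eq, AddSubgroup.closure_union, AddSubgroup.mem_sup]
  constructor
  · rintro ⟨y, hy, w, hw, rfl⟩
    obtain ⟨m, rfl⟩ := AddSubgroup.mem_closure_singleton.1 hy
    obtain ⟨n, l, rfl⟩ := AddSubgroup.mem_closure_pair.1 hw
    exact ⟨m, n, l, (add_assoc _ _ _).symm⟩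
  · rintro ⟨m, n, l, rfl⟩
    exact ⟨_, AddSubgroup.mem_closure_singleton.2 ⟨m, rfl⟩, _,
      AddSubgroup.mem_closure_pair.2 ⟨n, l, rfl⟩, (add_assoc _ _ _).symm⟩

theorem gen2_le {a b : Plane} {M : AddSubgroup Plane} : gen2 a b ≤ M ↔ a ∈ M ∧ b ∈ M := by
  unfold gen2
  rw [AddSubgroup.closure_le, Set.insert_subset_iff, Set.singleton_subset_iff]
  rfl

theorem gen3_le {a b c : Space} {M : AddSubgroup Space} :
    gen3 a b c ≤ M ↔ a ∈ M ∧ b ∈ M ∧ c ∈ M := by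
  unfold gen3
  rw [AddSubgroup.closure_le, Set.insert_subset_iff, Set.insert_subset_iff,
    Set.singleton_subset_iff]
  rfl

theorem left_mem_gen2 (a b : Plane) : a ∈ gen2 a b := (gen2_le.1 le_rfl).1
theorem right_mem_gen2 (a b : Plane) : b ∈ gen2 a b := (gen2_le.1 le_rfl).2

theorem pt_mem_gen3 {a b c x : Plane} {a3 b3 c3 y : ℝ} :
    pt x y ∈ gen3 (pt a a3) (pt b b3) (pt c c3) ↔
      ∃ m n l : ℤ, x = m • a + n • b + l • c ∧ y = m * a3 + n * b3 + l * c3 := by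
  rw [mem_gen3]
  simp only [pt_zsmul, pt_add, pt_inj]

theorem mem_projL {L : AddSubgroup Space} {x : Plane} : x ∈ projL L ↔ ∃ y, pt x y ∈ L := by
  constructor
  · rintro ⟨z, hz, rfl⟩
    exact ⟨z.snd, hz⟩
  · rintro ⟨y, hy⟩
    exact ⟨pt x y, hy, rfl⟩

theorem mem_restr0 {L : AddSubgroup Space} {x : Plane} : x ∈ restr0 L ↔ pt x 0 ∈ L := Iff.rfl

/-! ### Elements of the Euclidean group that preserve the vertical direction -/

/-- `(x, y) ↦ (v + α x, z + y)`. -/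
noncomputable def upEl (v : Plane) (α : Plane ≃ₗᵢ[ℝ] Plane) (z : ℝ) : Euc := euc (pt v z) (plus α)

/-- `(x, y) ↦ (v + α x, z - y)`. -/
noncomputable def downEl (v : Plane) (α : Plane ≃ₗᵢ[ℝ] Plane) (z : ℝ) : Euc :=
  euc (pt v z) (plus α * sigma)

@[simp] theorem upEl_apply (v : Plane) (α : Plane ≃ₗᵢ[ℝ] Plane) (z : ℝ) (x : Plane) (y : ℝ) :
    upEl v α z (pt x y) = pt (v + α x) (z + y) := rfl

@[simp] theorem downEl_apply (v : Plane) (α : Plane ≃ₗᵢ[ℝ] Plane) (z : ℝ) (x : Plane) (y : ℝ) :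
    downEl v α z (pt x y) = pt (v + α x) (z - y) := by
  rw [sub_eq_add_neg]; rfl

theorem euc_ext {g h : Euc} (H : ∀ x y, g (pt x y) = h (pt x y)) : g = h := by
  ext1 z
  rw [← pt_eta z]; exact H _ _

theorem mem_trans {Γ : Subgroup Euc} {v : Space} :
    v ∈ trans Γ ↔ AffineIsometryEquiv.constVAdd ℝ Space v ∈ Γ := Iff.rfl

theorem mem_transSigma {Γ : Subgroup Euc} {v : Space} : v ∈ transSigma Γ ↔ euc v sigma ∈ Γ :=
  Iff.rfl

theorem constVAdd_eq_upEl (p : Plane) (z : ℝ) :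
    AffineIsometryEquiv.constVAdd ℝ Space (pt p z) = upEl p 1 z := by
  apply euc_ext
  intro x y
  rfl

theorem mem_trans_iff {Γ : Subgroup Euc} {p : Plane} {z : ℝ} :
    pt p z ∈ trans Γ ↔ upEl p 1 z ∈ Γ := by
  rw [mem_trans, constVAdd_eq_upEl]

theorem mem_transSigma_iff {Γ : Subgroup Euc} {p : Plane} {z : ℝ} :
    pt p z ∈ transSigma Γ ↔ downEl p 1 z ∈ Γ := by
  have : euc (pt p z) sigma = downEl p 1 z := by
    apply euc_ext
    intro x y
    rfl
  rw [mem_transSigma, this]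

theorem mul_apply' (g h : Euc) (z : Space) : (g * h) z = g (h z) := rfl

theorem inv_apply_eq {g : Euc} {z w : Space} : g⁻¹ z = w ↔ z = g w := by
  constructor
  · rintro rfl
    exact (g.apply_symm_apply z).symm
  · rintro rfl
    exact g.symm_apply_apply w

/-! ### Group laws for vertical translations and for elements with orthogonal part `σ`. -/

section GroupRelations

variable {Γ : Subgroup Euc} {v : Plane} {α : Plane ≃ₗᵢ[ℝ] Plane}

theorem upEl_shift {t z : ℝ} (h : upEl v α z ∈ Γ) (ht : pt 0 t ∈ trans Γ) :
    upEl v α (z + t) ∈ Γ := by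
  have := Γ.mul_mem (mem_trans_iff.1 ht) h
  convert this using 1
  apply euc_ext
  intro x y
  rw [mul_apply']
  simp only [upEl_apply, pt_inj]
  exact ⟨by simp, by ring⟩

theorem upEl_diff {z z' : ℝ} (h : upEl v α z ∈ Γ) (h' : upEl v α z' ∈ Γ) :
    pt 0 (z - z') ∈ trans Γ := by
  rw [mem_trans_iff]
  have : upEl 0 1 (z - z') = upEl v α z * (upEl v α z')⁻¹ := by
    rw [eq_mul_inv_iff_mul_eq]
    apply euc_ext
    intro x y
    rw [mul_apply']
    simp only [upEl_apply, pt_inj]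
    exact ⟨by simp, by ring⟩
  rw [this]
  exact Γ.mul_mem h (Γ.inv_mem h')

/-- If `Γ` contains a horizontal mirror at height `0`, the two kinds of elements agree. -/
theorem downEl_mem_iff (h0 : pt 0 0 ∈ transSigma Γ) {z : ℝ} :
    downEl v α z ∈ Γ ↔ upEl v α z ∈ Γ := by
  have e : downEl v α z = upEl v α z * downEl 0 1 0 := by
    apply euc_ext
    intro x y
    rw [mul_apply']
    simp only [upEl_apply, downEl_apply, pt_inj]
    exact ⟨by simp, by ring⟩
  rw [e]
  exact Γ.mul_mem_cancel_right (mem_transSigma_iff.1 h0)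

/-- Conjugation by the mirror at height `0` reverses the vertical shift. -/
theorem upEl_neg (h0 : pt 0 0 ∈ transSigma Γ) {z : ℝ} (h : upEl v α z ∈ Γ) :
    upEl v α (-z) ∈ Γ := by
  have h0' := mem_transSigma_iff.1 h0
  have e : upEl v α (-z) = downEl 0 1 0 * upEl v α z * downEl 0 1 0 := by
    apply euc_ext
    intro x y
    rw [mul_apply', mul_apply']
    simp only [upEl_apply, downEl_apply, pt_inj]
    exact ⟨by simp, by ring⟩
  rw [e]
  exact Γ.mul_mem (Γ.mul_mem h0' h) h0'

/-- The orthogonal parts cancel in the quotient of two `σ`-elements. Together with `transSigma_add`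
this makes `L_σ` a single coset of the lattice as soon as it is nonempty. -/
theorem transSigma_sub {w w' : Space} (h : w ∈ transSigma Γ) (h' : w' ∈ transSigma Γ) :
    w - w' ∈ trans Γ := by
  have e : AffineIsometryEquiv.constVAdd ℝ Space (w - w') = euc w sigma * (euc w' sigma)⁻¹ := by
    rw [eq_mul_inv_iff_mul_eq]
    ext1 z
    change (w - w') + (w' + sigma z) = w + sigma z
    abel
  rw [mem_trans, e]
  exact Γ.mul_mem h (Γ.inv_mem h')

theorem transSigma_add {w z : Space} (h : w ∈ transSigma Γ) (hz : z ∈ trans Γ) :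
    w + z ∈ transSigma Γ := by
  have e : euc (w + z) sigma = AffineIsometryEquiv.constVAdd ℝ Space z * euc w sigma := by
    ext1 x
    change w + z + sigma x = z + (w + sigma x)
    abel
  rw [mem_transSigma, e]
  exact Γ.mul_mem hz h

theorem mem_transSigma_iff_sub {w z : Space} (h : w ∈ transSigma Γ) :
    z ∈ transSigma Γ ↔ z - w ∈ trans Γ :=
  ⟨fun hz => transSigma_sub hz h, fun hz => by
    have := transSigma_add h hz
    rwa [add_sub_cancel] at this⟩

/-- Conjugating a translation by a `σ`-element reflects its vector. The contrapositive removes all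
glides when `σ L ⊄ L`. -/
theorem sigmaInv_of_transSigma {w : Space} (h : w ∈ transSigma Γ) : SigmaInv (trans Γ) := by
  intro z hz
  have e : AffineIsometryEquiv.constVAdd ℝ Space (sigma z) =
      euc w sigma * AffineIsometryEquiv.constVAdd ℝ Space z * (euc w sigma)⁻¹ := by
    rw [eq_mul_inv_iff_mul_eq]
    ext1 x
    change sigma z + (w + sigma x) = w + sigma (z + x)
    rw [map_add]
    abel
  rw [mem_trans, e]
  exact Γ.mul_mem (Γ.mul_mem h hz) (Γ.inv_mem h)

theorem transSigma_add_sigma {w : Space} (h : w ∈ transSigma Γ) : w + sigma w ∈ trans Γ := by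
  have e : AffineIsometryEquiv.constVAdd ℝ Space (w + sigma w) = euc w sigma * euc w sigma := by
    ext1 x
    change w + sigma w + x = w + sigma (w + sigma x)
    have : sigma (sigma x) = x := by rw [← pt_eta x]; simp
    rw [map_add, this]
    abel
  rw [mem_trans, e]
  exact Γ.mul_mem h h

/-- The square of a `σ`-element is a translation in which the vertical parts cancel. Glide vectors
are therefore halves of horizontal lattice vectors, which leaves finitely many classes. -/
theorem two_smul_mem_of_transSigma {p : Plane} {y : ℝ} (h : pt p y ∈ transSigma Γ) :
    pt ((2 : ℤ) • p) 0 ∈ trans Γ := by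
  have := transSigma_add_sigma h
  rw [sigma_pt, pt_add] at this
  convert this using 2
  · rw [two_smul]
  · ring

end GroupRelations

end

/-! ### Discreteness of lattices and of crystallographic groups -/

theorem finrank_space : Module.finrank ℝ Space = 3 := by
  rw [(WithLp.linearEquiv 2 ℝ (Plane × ℝ)).finrank_eq, Module.finrank_prod]
  simp

theorem IsLattice.finite_norm_le {L : AddSubgroup Space} (hL : IsLattice L) (R : ℝ) :
    {v | v ∈ L ∧ ‖v‖ ≤ R}.Finite := by
  obtain ⟨a, b, c, hli, rfl⟩ := hL
  let e := basisOfLinearIndependentOfCardEqFinrank hli (by simp [finrank_space])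
  have he : Set.range e = {a, b, c} := by
    rw [coe_basisOfLinearIndependentOfCardEqFinrank]
    ext v
    simp only [Set.mem_range, Fin.exists_fin_succ, Set.mem_insert_iff, Set.mem_singleton_iff]
    simp [eq_comm (a := v)]
  refine (ZSpan.setFinite_inter e (Metric.isBounded_closedBall (x := (0 : Space)) (r := R))).subset ?_
  rintro v ⟨hv, hR⟩
  refine ⟨by simpa using hR, ?_⟩
  rw [he]
  have : gen3 a b c = (Submodule.span ℤ {a, b, c}).toAddSubgroup :=
    (Submodule.span_int_eq_addSubgroupClosure _).symm
  rw [this] at hv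
  exact hv

theorem apply_eq_add (g : Euc) (z : Space) : g z = g.linearIsometryEquiv z + g 0 := by
  have := g.map_vadd 0 z
  simpa using this

theorem norm_linear (g : Euc) (z : Space) : ‖g.linearIsometryEquiv z‖ = ‖z‖ :=
  g.linearIsometryEquiv.norm_map z

/-- Conjugation by `g` turns translations into translations: the point group acts on the lattice. -/
theorem linear_mem_trans {Γ : Subgroup Euc} {g : Euc} (hg : g ∈ Γ) {v : Space}
    (hv : v ∈ trans Γ) : g.linearIsometryEquiv v ∈ trans Γ := by
  have e : AffineIsometryEquiv.constVAdd ℝ Space (g.linearIsometryEquiv v) =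
      g * AffineIsometryEquiv.constVAdd ℝ Space v * g⁻¹ := by
    rw [eq_mul_inv_iff_mul_eq]
    ext1 x
    exact (g.map_vadd x v).symm
  rw [mem_trans, e]
  exact Γ.mul_mem (Γ.mul_mem hg hv) (Γ.inv_mem hg)

/-- A linear part is determined by the images of a lattice basis, and these are lattice vectors of
prescribed length, so there are finitely many linear parts. Two elements with the same linear part
differ by a lattice translation, and only finitely many of those are short enough. -/
theorem IsCryst.finite_apply_zero {Γ : Subgroup Euc} (hΓ : IsCryst Γ) (R : ℝ) :
    {g : Γ | ‖(g : Euc) 0‖ ≤ R}.Finite := by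
  obtain ⟨a, b, c, hli, hgen⟩ := id hΓ
  have hmem := gen3_le.1 hgen.ge
  let F : Γ → Space × Space × Space := fun g =>
    ((g : Euc).linearIsometryEquiv a, (g : Euc).linearIsometryEquiv b,
      (g : Euc).linearIsometryEquiv c)
  refine Set.Finite.of_finite_fibers F ?_ ?_
  · refine (((IsLattice.finite_norm_le hΓ ‖a‖).prod ((IsLattice.finite_norm_le hΓ ‖b‖).prod
      (IsLattice.finite_norm_le hΓ ‖c‖)))).subset ?_
    rintro _ ⟨g, -, rfl⟩
    exact ⟨⟨linear_mem_trans g.2 hmem.1, (norm_linear _ _).le⟩,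
      ⟨linear_mem_trans g.2 hmem.2.1, (norm_linear _ _).le⟩,
      ⟨linear_mem_trans g.2 hmem.2.2, (norm_linear _ _).le⟩⟩
  -- The elements of a fibre are compared with `g₀`: the differences of the images of the origin are
  -- lattice vectors of norm at most `2R`.
  · rintro _ ⟨g₀, hg₀, rfl⟩
    refine Set.Finite.of_finite_image (f := fun g : Γ => (g : Euc) 0 - (g₀ : Euc) 0) ?_ ?_
    · refine (IsLattice.finite_norm_le hΓ (R + R)).subset ?_
      rintro _ ⟨g, ⟨hg, hF⟩, rfl⟩
      refine ⟨?_, (norm_sub_le _ _).trans (add_le_add hg hg₀)⟩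
      have hlin : ∀ x, (g : Euc).linearIsometryEquiv x = (g₀ : Euc).linearIsometryEquiv x := by
        have hF' : F g = F g₀ := hF
        simp only [F, Prod.mk.injEq] at hF'
        let e := basisOfLinearIndependentOfCardEqFinrank hli (by simp [finrank_space])
        have : (g : Euc).linearIsometryEquiv.toLinearEquiv.toLinearMap =
            (g₀ : Euc).linearIsometryEquiv.toLinearEquiv.toLinearMap := by
          refine e.ext fun i => ?_
          rw [coe_basisOfLinearIndependentOfCardEqFinrank]
          fin_cases i
          exacts [hF'.1, hF'.2.1, hF'.2.2]
        exact fun x => LinearMap.congr_fun this x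
      have e : AffineIsometryEquiv.constVAdd ℝ Space ((g : Euc) 0 - (g₀ : Euc) 0) =
          (g : Euc) * (g₀ : Euc)⁻¹ := by
        rw [eq_mul_inv_iff_mul_eq]
        ext1 x
        change ((g : Euc) 0 - (g₀ : Euc) 0) + (g₀ : Euc) x = (g : Euc) x
        rw [apply_eq_add _ x, apply_eq_add (g : Euc) x, hlin]
        abel
      rw [mem_trans, e]
      exact Γ.mul_mem g.2 (Γ.inv_mem g₀.2)
    · rintro g ⟨-, hF⟩ g' ⟨-, hF'⟩ h
      have h0 : (g : Euc) 0 = (g' : Euc) 0 := sub_left_injective h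
      have hFF : F g = F g' := hF.trans hF'.symm
      simp only [F, Prod.mk.injEq] at hFF
      let e := basisOfLinearIndependentOfCardEqFinrank hli (by simp [finrank_space])
      have : (g : Euc).linearIsometryEquiv.toLinearEquiv.toLinearMap =
          (g' : Euc).linearIsometryEquiv.toLinearEquiv.toLinearMap := by
        refine e.ext fun i => ?_
        rw [coe_basisOfLinearIndependentOfCardEqFinrank]
        fin_cases i
        exacts [hFF.1, hFF.2.1, hFF.2.2]
      ext1
      ext1 x
      rw [apply_eq_add _ x, apply_eq_add (g' : Euc) x, h0]
      exact congrArg (· + _) (LinearMap.congr_fun this x)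

/-- Countability is what allows exceptional null sets, one for each group element, to be discarded
together in `ae_generic`. -/
theorem IsCryst.countable {Γ : Subgroup Euc} (hΓ : IsCryst Γ) : Countable Γ := by
  rw [← Set.countable_univ_iff]
  have : (Set.univ : Set Γ) = ⋃ n : ℕ, {g : Γ | ‖(g : Euc) 0‖ ≤ n} := by
    symm
    rw [Set.eq_univ_iff_forall]
    intro g
    obtain ⟨n, hn⟩ := exists_nat_ge ‖(g : Euc) 0‖
    exact Set.mem_iUnion.2 ⟨n, hn⟩
  rw [this]
  exact Set.countable_iUnion fun n => (hΓ.finite_apply_zero n).countable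

/-! ### Sums over orbits -/

/-- The sum of the translates of `ψ` by the elements of `Γ`. -/
noncomputable def orbSum (Γ : Subgroup Euc) (ψ : Space → ℝ) (z : Space) : ℝ :=
  ∑ᶠ g : Γ, ψ ((g : Euc)⁻¹ z)

/-- The elements of `Γ` that move the origin by at most `R`. -/
noncomputable def near {Γ : Subgroup Euc} (hΓ : IsCryst Γ) (R : ℝ) : Finset Γ :=
  (hΓ.finite_apply_zero R).toFinset

theorem mem_near {Γ : Subgroup Euc} (hΓ : IsCryst Γ) {R : ℝ} {g : Γ} :
    g ∈ near hΓ R ↔ ‖(g : Euc) 0‖ ≤ R := by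
  simp [near]

/-- Bounds the elements that can bring a point of a bounded support to a bounded point; this makes
orbit sums locally finite. -/
theorem norm_apply_zero_le (g : Euc) (z : Space) : ‖g 0‖ ≤ ‖g⁻¹ z‖ + ‖z‖ := by
  have h1 : dist (g 0) z = dist 0 (g⁻¹ z) := by
    have : z = g (g⁻¹ z) := inv_apply_eq.1 rfl
    conv_lhs => rw [this]
    exact g.dist_map _ _
  have h2 := dist_triangle (g 0) z 0
  rw [dist_zero_right, h1, dist_zero_left, dist_zero_right] at h2
  exact h2

/-- One finite index set serves all points of a ball, so the orbit sum may be differentiated and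
integrated term by term. -/
theorem orbSum_eq {Γ : Subgroup Euc} (hΓ : IsCryst Γ) {ψ : Space → ℝ} {R M : ℝ}
    (hψ : ∀ z, ψ z ≠ 0 → ‖z‖ ≤ R) {z : Space} (hz : ‖z‖ ≤ M) :
    orbSum Γ ψ z = ∑ g ∈ near hΓ (R + M), ψ ((g : Euc)⁻¹ z) := by
  refine finsum_eq_sum_of_support_subset _ fun g hg => ?_
  rw [Finset.mem_coe, mem_near]
  exact (norm_apply_zero_le _ z).trans (add_le_add (hψ _ hg) hz)

/-- Smoothness is local and holds because the sum is finite near each point; invariance is a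
reindexing of the sum by left multiplication. -/
theorem orbSum_mem_invFun {Γ : Subgroup Euc} (hΓ : IsCryst Γ) {ψ : Space → ℝ} {R : ℝ}
    (hψ : ∀ z, ψ z ≠ 0 → ‖z‖ ≤ R) (hc : ContDiff ℝ 1 ψ) : orbSum Γ ψ ∈ invFun Γ := by
  constructor
  · rw [contDiff_iff_contDiffAt]
    intro z
    have hS : ContDiffAt ℝ 1
        (fun w => ∑ g ∈ near hΓ (R + (‖z‖ + 1)), ψ ((g : Euc)⁻¹ w)) z := by
      refine ContDiffAt.sum fun g _ => ?_
      exact (hc.comp ((g : Euc)⁻¹).toAffineIsometry.toContinuousAffineMap.contDiff).contDiffAt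
    refine hS.congr_of_eventuallyEq ?_
    filter_upwards [Metric.ball_mem_nhds z one_pos] with w hw
    refine orbSum_eq hΓ hψ ?_
    have := norm_le_norm_add_norm_sub' w z
    rw [Metric.mem_ball, dist_eq_norm] at hw
    linarith
  · intro γ hγ z
    have := finsum_comp_equiv (Equiv.mulLeft (⟨γ, hγ⟩ : Γ)⁻¹) (f := fun g : Γ => ψ ((g : Euc)⁻¹ z))
    unfold orbSum
    rw [← this]
    refine finsum_congr fun g => ?_
    simp only [Equiv.coe_mulLeft, Subgroup.coe_mul, Subgroup.coe_inv, mul_inv_rev, inv_inv]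
    rfl

/-! ### Generic points -/

/-- The horizontal component of the image of a horizontal plane already has full length, so
horizontal vectors stay horizontal; by orthogonality the vertical direction stays vertical and can
only change sign. -/
theorem exists_upEl_or_downEl {g : Euc} {u : ℝ} {v : Plane} {α : Plane ≃ₗᵢ[ℝ] Plane}
    (h : ∀ x, (g (pt x u)).fst = v + α x) : ∃ z, g = upEl v α z ∨ g = downEl v α z := by
  set δ := g.linearIsometryEquiv with hδ
  set w := g 0 with hw
  have hg : ∀ x y, g (pt x y) = δ (pt x 0) + y • δ (pt 0 1) + w := by
    intro x y
    rw [apply_eq_add, ← map_smul, ← map_add, pt_smul, pt_add]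
    simp [δ, w]
  have hfst : ∀ x, (δ (pt x 0)).fst + u • (δ (pt 0 1)).fst + w.fst = v + α x := by
    intro x
    rw [← h, hg]
    rfl
  have h0 : u • (δ (pt 0 1)).fst + w.fst = v := by
    have := hfst 0
    rw [pt_zero, map_zero, map_zero, add_zero] at this
    rw [← this]
    change _ = (0 : Plane) + _ + _
    rw [zero_add]
  have hα : ∀ x, (δ (pt x 0)).fst = α x := by
    intro x
    have := hfst x
    rw [add_assoc, h0, add_comm] at this
    exact add_left_cancel this
  -- The projection of `δ (x, 0)` is as long as the vector itself, so no length is left for a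
  -- vertical component.
  have hδ0 : ∀ x, δ (pt x 0) = pt (α x) 0 := by
    intro x
    have h1 := pt_norm_sq (δ (pt x 0))
    rw [δ.norm_map, pt_norm_sq, hα, α.norm_map] at h1
    simp only [pt_fst, pt_snd] at h1
    exact pt_ext (hα x) (by simpa using h1)
  have he : (δ (pt 0 1)).fst = 0 := by
    have h1 : ∀ x, inner ℝ (α x) (δ (pt 0 1)).fst = 0 := by
      intro x
      have h2 := δ.inner_map_map (pt x 0) (pt 0 1)
      rw [hδ0, WithLp.prod_inner_apply, WithLp.prod_inner_apply] at h2
      simpa [pt] using h2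
    have := h1 (α.symm (δ (pt 0 1)).fst)
    rwa [α.apply_symm_apply, inner_self_eq_zero] at this
  have hs : (δ (pt 0 1)).snd = 1 ∨ (δ (pt 0 1)).snd = -1 := by
    have h1 := pt_norm_sq (δ (pt 0 1))
    rw [δ.norm_map, pt_norm_sq, he] at h1
    rw [← sq_eq_one_iff]
    simpa using h1.symm
  have hw : w.fst = v := by rw [← h0, he, smul_zero, zero_add]
  refine ⟨w.snd, hs.imp (fun hs => ?_) (fun hs => ?_)⟩ <;>
  · apply euc_ext
    intro x y
    rw [hg, hδ0, ← pt_eta (δ (pt 0 1)), he, hs, ← pt_eta w, hw, pt_smul, pt_add, pt_add]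
    simp only [upEl_apply, downEl_apply, pt_inj, pt_snd]
    exact ⟨by simp [add_comm], by ring⟩

/-- For a fixed `g` the points `x` with this coincidence form an affine subspace. Either it is the
whole plane, and then `g` preserves the vertical direction, or it is a null set. -/
theorem ae_generic {Γ : Subgroup Euc} (hΓ : IsCryst Γ) (u : ℝ) (v : Plane)
    (α : Plane ≃ₗᵢ[ℝ] Plane) :
    ∀ᵐ x : Plane, ∀ g : Γ, ((g : Euc) (pt x u)).fst = v + α x →
      ∃ z, (g : Euc) = upEl v α z ∨ (g : Euc) = downEl v α z := by
  have := hΓ.countable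
  rw [MeasureTheory.ae_all_iff]
  intro g
  by_cases h : ∀ x, ((g : Euc) (pt x u)).fst = v + α x
  · exact Filter.Eventually.of_forall fun x _ => exists_upEl_or_downEl h
  · push Not at h
    obtain ⟨x₀, hx₀⟩ := h
    let P : Space →ₗ[ℝ] Plane := ⟨⟨fun z => z.fst, fun _ _ => rfl⟩, fun _ _ => rfl⟩
    let I : Plane →ᵃ[ℝ] Space := ⟨fun x => pt x u, ⟨⟨fun x => pt x 0, fun _ _ => by
      simp [pt_add]⟩, fun r x => by simp [pt_smul]⟩, fun x y => by simp [pt_add]⟩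
    let f : Plane →ᵃ[ℝ] Plane := P.toAffineMap.comp
      ((g : Euc).toAffineEquiv.toAffineMap.comp I) - (α.toLinearEquiv.toLinearMap.toAffineMap +
        AffineMap.const ℝ Plane v)
    have hf : ∀ x, f x = ((g : Euc) (pt x u)).fst - (α x + v) := fun x => rfl
    have h0 := MeasureTheory.Measure.addHaar_affineSubspace (MeasureTheory.volume : MeasureTheory.Measure Plane)
      ((AffineSubspace.mk' (0 : Plane) ⊥).comap f) (by
        intro htop
        have : x₀ ∈ (AffineSubspace.mk' (0 : Plane) ⊥).comap f := htop ▸ AffineSubspace.mem_top _ _ _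
        rw [AffineSubspace.mem_comap, AffineSubspace.mem_mk', Submodule.mem_bot, vsub_eq_sub,
          sub_zero, hf, sub_eq_zero, add_comm] at this
        exact hx₀ this)
    refine (MeasureTheory.measure_eq_zero_iff_ae_notMem.1 h0).mono fun x hx hx' => ?_
    refine absurd ?_ hx
    rw [SetLike.mem_coe, AffineSubspace.mem_comap, AffineSubspace.mem_mk', Submodule.mem_bot, vsub_eq_sub,
          sub_zero, hf, sub_eq_zero, hx', add_comm]

section

/-! ### Bumps centred on an orbit -/

open Filter Topology Metric

/-- Orbits are locally finite: only finitely many orbit points come within distance `1` of `K`, and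
each of these that lies outside `K` has positive distance from it. Hence one small radius serves the
whole orbit. -/
theorem eventually_lt_dist {Γ : Subgroup Euc} (hΓ : IsCryst Γ) (q : Space) {K : Set Space}
    (hK : IsCompact K) :
    ∀ᶠ r in 𝓝[>] (0 : ℝ), ∀ g : Γ, (g : Euc) q ∉ K → ∀ k ∈ K, r < dist ((g : Euc) q) k := by
  obtain ⟨M, hM⟩ := hK.isBounded.exists_norm_le
  have h1 : ∀ᶠ r in 𝓝[>] (0 : ℝ), ∀ g ∈ near hΓ (‖q‖ + (M + 1)), (g : Euc) q ∉ K →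
      ∀ k ∈ K, r < dist ((g : Euc) q) k := by
    rw [eventually_all_finset]
    intro g _
    by_cases hg : (g : Euc) q ∈ K
    · exact Eventually.of_forall fun r h => absurd hg h
    rcases K.eq_empty_or_nonempty with rfl | hne
    · simp
    have hpos := (hK.isClosed.notMem_iff_infDist_pos hne).1 hg
    filter_upwards [nhdsWithin_le_nhds (eventually_lt_nhds hpos)] with r hr _ k hk
    exact hr.trans_le (infDist_le_dist_of_mem hk)
  have h2 : ∀ᶠ r in 𝓝[>] (0 : ℝ), r < 1 := nhdsWithin_le_nhds (eventually_lt_nhds one_pos)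
  filter_upwards [h1, h2] with r hr hr1 g hg k hk
  by_cases hn : g ∈ near hΓ (‖q‖ + (M + 1))
  · exact hr g hn hg k hk
  · rw [mem_near, not_le] at hn
    have h3 := norm_apply_zero_le (g : Euc) ((g : Euc) q)
    rw [inv_apply_eq.2 rfl] at h3
    have h4 := norm_le_norm_add_norm_sub' ((g : Euc) q) k
    have h5 := hM k hk
    rw [dist_eq_norm]
    linarith

theorem continuous_pt (x : Plane) : Continuous (pt x) := by
  have : pt x = fun y => pt x 0 + y • pt 0 1 := by
    funext y
    rw [pt_smul, pt_add]
    simp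
  rw [this]
  fun_prop

instance : ContinuousSMul ℝ Space := IsBoundedSMul.continuousSMul

theorem hasDerivAt_add_smul {E : Type*} [NormedAddCommGroup E] [NormedSpace ℝ E] (a b : E) (y : ℝ) :
    HasDerivAt (fun y : ℝ => a + y • b) b y := by
  simpa using ((hasDerivAt_id y).smul_const b).const_add a

theorem hasDerivAt_pt (x : Plane) (y : ℝ) : HasDerivAt (pt x) (pt 0 1) y := by
  have : pt x = fun y => pt x 0 + y • pt 0 1 := by
    funext y
    rw [pt_smul, pt_add]
    simp
  rw [this]
  exact hasDerivAt_add_smul _ _ _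

/-- The vertical segment of height `y₀` over `x`. -/
def seg (x : Plane) (y0 : ℝ) : Set Space := pt x '' Set.Icc 0 y0

theorem isCompact_seg (x : Plane) (y0 : ℝ) : IsCompact (seg x y0) :=
  isCompact_Icc.image (continuous_pt x)

open Classical in
/-- `1` if `P` holds and `0` otherwise. -/
noncomputable def ind (P : Prop) : ℝ := if P then 1 else 0

theorem ind_of {P : Prop} (h : P) : ind P = 1 := if_pos h
theorem ind_of_not {P : Prop} (h : ¬P) : ind P = 0 := if_neg h

theorem ind_congr {P Q : Prop} (h : P ↔ Q) : ind P = ind Q := by rw [propext h]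

theorem ind_cases (P : Prop) : (P ∧ ind P = 1) ∨ (¬P ∧ ind P = 0) := by
  by_cases h : P
  · exact Or.inl ⟨h, ind_of h⟩
  · exact Or.inr ⟨h, ind_of_not h⟩

/-- The jumps at height `u` of the number of points of an orbit on a segment. -/
noncomputable def jump (Γ : Subgroup Euc) (v : Plane) (α : Plane ≃ₗᵢ[ℝ] Plane) (y0 u : ℝ) : ℝ :=
  ind (upEl v α (y0 - u) ∈ Γ) - ind (upEl v α (-u) ∈ Γ) - ind (downEl v α (y0 + u) ∈ Γ) +
    ind (downEl v α u ∈ Γ)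

theorem upEl_inj {v : Plane} {α : Plane ≃ₗᵢ[ℝ] Plane} {z z' : ℝ} :
    upEl v α z = upEl v α z' ↔ z = z' := by
  refine ⟨fun h => ?_, fun h => by rw [h]⟩
  have := DFunLike.congr_fun h (pt 0 0)
  simpa [pt_inj] using this

theorem downEl_inj {v : Plane} {α : Plane ≃ₗᵢ[ℝ] Plane} {z z' : ℝ} :
    downEl v α z = downEl v α z' ↔ z = z' := by
  refine ⟨fun h => ?_, fun h => by rw [h]⟩
  have := DFunLike.congr_fun h (pt 0 0)
  simpa [pt_inj] using this

theorem upEl_ne_downEl {v v' : Plane} {α α' : Plane ≃ₗᵢ[ℝ] Plane} {z z' : ℝ} :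
    upEl v α z ≠ downEl v' α' z' := by
  intro h
  have h0 := DFunLike.congr_fun h (pt 0 0)
  have h1 := DFunLike.congr_fun h (pt 0 1)
  simp only [upEl_apply, downEl_apply, pt_inj] at h0 h1
  linarith [h0.2, h1.2]

theorem sum_ind_eq {Γ : Subgroup Euc} (S : Finset Γ) (A : Euc)
    (hA : ∀ h : A ∈ Γ, (⟨A, h⟩ : Γ) ∈ S) : ∑ g ∈ S, ind ((g : Euc) = A) = ind (A ∈ Γ) := by
  by_cases h : A ∈ Γ
  · rw [ind_of h, Finset.sum_eq_single ⟨A, h⟩, ind_of rfl]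
    · intro g _ hg
      exact ind_of_not fun e => hg (Subtype.ext e)
    · intro h'
      exact absurd (hA h) h'
  · rw [ind_of_not h]
    refine Finset.sum_eq_zero fun g _ => ind_of_not ?_
    rintro rfl
    exact h g.2

/-- The vertical derivative of a bump. -/
noncomputable def dBump {q : Space} (G : ContDiffBump q) (z : Space) : ℝ := fderiv ℝ G z (pt 0 1)

/-- The bump is smooth, so its vertical derivative may itself serve as a `C¹` test function. -/
theorem dBump_contDiff {q : Space} (G : ContDiffBump q) : ContDiff ℝ 1 (dBump G) := by
  have : ContDiff ℝ 1 (fderiv ℝ G) := (G.contDiff (n := 2)).fderiv_right (by norm_num)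
  exact this.clm_apply contDiff_const

theorem dBump_ne_zero {q : Space} (G : ContDiffBump q) {z : Space} (h : dBump G z ≠ 0) :
    dist z q ≤ G.rOut := by
  have : z ∈ tsupport G := support_fderiv_subset ℝ fun h0 => h (by simp [dBump, h0])
  rwa [G.tsupport_eq, mem_closedBall] at this

theorem bump_eq_ind {q z : Space} (G : ContDiffBump q) (h : z ≠ q → G.rOut ≤ dist z q) :
    G z = ind (z = q) := by
  by_cases hz : z = q
  · rw [ind_of hz, hz]
    exact G.one_of_mem_closedBall (mem_closedBall_self G.rIn_pos.le)
  · rw [ind_of_not hz, G.zero_of_le_dist (h hz)]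

/-- This is why the derivative of a bump is used: by the fundamental theorem of calculus only the
end points of the segment contribute. -/
theorem integral_dBump_up {q : Space} (G : ContDiffBump q) (x : Plane) (z a b : ℝ) :
    ∫ y in a..b, dBump G (pt x (y - z)) = G (pt x (b - z)) - G (pt x (a - z)) := by
  refine intervalIntegral.integral_eq_sub_of_hasDerivAt (f := fun y => G (pt x (y - z))) ?_ ?_
  · intro y _
    have h1 := (hasDerivAt_pt x (y - z)).comp_sub_const y z
    exact (((G.contDiff (n := 1)).differentiable (by norm_num)) _).hasFDerivAt.comp_hasDerivAt y h1
  · exact ((dBump_contDiff G).continuous.comp ((continuous_pt x).comp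
      (continuous_id.sub continuous_const))).intervalIntegrable _ _

theorem integral_dBump_down {q : Space} (G : ContDiffBump q) (x : Plane) (z a b : ℝ) :
    ∫ y in a..b, dBump G (pt x (z - y)) = G (pt x (z - a)) - G (pt x (z - b)) := by
  rw [intervalIntegral.integral_comp_sub_left (fun y => dBump G (pt x y)) z]
  have := integral_dBump_up G x 0 (z - b) (z - a)
  simpa using this

/-- The radius is so small that each end point, moved back by `g`, is either the centre of the bump
or outside its ball. The boundary values are therefore `0` or `1`, and they tell which of the four
possible elements `g` is. -/
theorem integral_dBump_orbit {Γ : Subgroup Euc} {x v : Plane} {u y0 : ℝ} (hy0 : 0 ≤ y0)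
    {α : Plane ≃ₗᵢ[ℝ] Plane}
    (hx : ∀ g : Γ, ((g : Euc) (pt x u)).fst = v + α x →
      ∃ z, (g : Euc) = upEl v α z ∨ (g : Euc) = downEl v α z)
    (G : ContDiffBump (pt x u))
    (h : ∀ g : Γ, (g : Euc) (pt x u) ∉ seg (v + α x) y0 → ∀ k ∈ seg (v + α x) y0,
      G.rOut < dist ((g : Euc) (pt x u)) k)
    (h0 : ∀ g : Γ, (g : Euc) (pt x u) ∉ ({pt (v + α x) 0} : Set Space) →
      ∀ k ∈ ({pt (v + α x) 0} : Set Space), G.rOut < dist ((g : Euc) (pt x u)) k)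
    (h1 : ∀ g : Γ, (g : Euc) (pt x u) ∉ ({pt (v + α x) y0} : Set Space) →
      ∀ k ∈ ({pt (v + α x) y0} : Set Space), G.rOut < dist ((g : Euc) (pt x u)) k) (g : Γ) :
    ∫ y in (0 : ℝ)..y0, dBump G ((g : Euc)⁻¹ (pt (v + α x) y)) =
      ind ((g : Euc) = upEl v α (y0 - u)) - ind ((g : Euc) = upEl v α (-u)) -
        ind ((g : Euc) = downEl v α (y0 + u)) + ind ((g : Euc) = downEl v α u) := by
  have hdist : ∀ z, dist ((g : Euc)⁻¹ z) (pt x u) = dist ((g : Euc) (pt x u)) z := by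
    intro z
    rw [dist_comm, ← (g : Euc).dist_map, ← inv_apply_eq.1 rfl]
  have hG : ∀ y, y = 0 ∨ y = y0 → G ((g : Euc)⁻¹ (pt (v + α x) y)) =
      ind ((g : Euc)⁻¹ (pt (v + α x) y) = pt x u) := by
    intro y hy
    refine bump_eq_ind G fun hne => ?_
    rw [hdist]
    rw [Ne, inv_apply_eq, eq_comm] at hne
    rcases hy with rfl | rfl
    · exact (h0 g hne _ rfl).le
    · exact (h1 g hne _ rfl).le
  by_cases hg : (g : Euc) (pt x u) ∈ seg (v + α x) y0
  · obtain ⟨y, -, hy⟩ := hg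
    obtain ⟨z, hz⟩ := hx g (by rw [← hy, pt_fst])
    rcases hz with hz | hz
    · have hinv : ∀ y, (g : Euc)⁻¹ (pt (v + α x) y) = pt x (y - z) := by
        intro y
        rw [inv_apply_eq, hz, upEl_apply, add_sub_cancel]
      simp only [hinv] at hG ⊢
      rw [integral_dBump_up, hG _ (Or.inl rfl), hG _ (Or.inr rfl), hz,
        ind_of_not upEl_ne_downEl, ind_of_not upEl_ne_downEl, sub_zero, add_zero]
      congr 1 <;> refine ind_congr ?_ <;> rw [upEl_inj, pt_inj] <;>
        constructor
      · intro h; linarith [h.2]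
      · intro h; exact ⟨rfl, by linarith⟩
      · intro h; linarith [h.2]
      · intro h; exact ⟨rfl, by linarith⟩
    · have hinv : ∀ y, (g : Euc)⁻¹ (pt (v + α x) y) = pt x (z - y) := by
        intro y
        rw [inv_apply_eq, hz, downEl_apply, sub_sub_cancel]
      simp only [hinv] at hG ⊢
      rw [integral_dBump_down, hG _ (Or.inl rfl), hG _ (Or.inr rfl), hz,
        ind_of_not upEl_ne_downEl.symm, ind_of_not upEl_ne_downEl.symm, sub_self, zero_sub,
        neg_add_eq_sub]
      congr 1 <;> refine ind_congr ?_ <;> rw [downEl_inj, pt_inj] <;>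
        constructor
      · intro h; linarith [h.2]
      · intro h; exact ⟨rfl, by linarith⟩
      · intro h; linarith [h.2]
      · intro h; exact ⟨rfl, by linarith⟩
  -- If `g` moves the centre off the segment, the integrand vanishes identically; so do the four
  -- indicators, since each of those elements would put the centre at an end point.
  · have hz : ∀ A : Euc, A (pt x u) ∈ seg (v + α x) y0 → ind ((g : Euc) = A) = 0 :=
      fun A hA => ind_of_not fun e => hg (e ▸ hA)
    have m0 : pt (v + α x) 0 ∈ seg (v + α x) y0 := ⟨0, ⟨le_rfl, hy0⟩, rfl⟩
    have m1 : pt (v + α x) y0 ∈ seg (v + α x) y0 := ⟨y0, ⟨hy0, le_rfl⟩, rfl⟩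
    rw [hz (upEl v α (y0 - u)) (by simpa using m1), hz (upEl v α (-u)) (by simpa using m0),
      hz (downEl v α (y0 + u)) (by simpa using m1), hz (downEl v α u) (by simpa using m0)]
    rw [intervalIntegral.integral_congr (g := fun _ => 0)]
    · simp
    · intro y hy
      rw [Set.uIcc_of_le hy0] at hy
      by_contra hne
      have := dBump_ne_zero G hne
      rw [hdist] at this
      exact absurd (h g hg _ ⟨y, hy, rfl⟩) this.not_gt

theorem projFun_orbSum {Γ : Subgroup Euc} (hΓ : IsCryst Γ) {ψ : Space → ℝ} {R M y0 : ℝ}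
    (hy0 : 0 ≤ y0) (hψ : ∀ z, ψ z ≠ 0 → ‖z‖ ≤ R) (hc : Continuous ψ) {x : Plane}
    (hM : ∀ z ∈ seg x y0, ‖z‖ ≤ M) :
    projFun y0 (orbSum Γ ψ) x =
      ∑ g ∈ near hΓ (R + M), ∫ y in (0 : ℝ)..y0, ψ ((g : Euc)⁻¹ (pt x y)) := by
  unfold projFun
  rw [← intervalIntegral.integral_finsetSum]
  · refine intervalIntegral.integral_congr fun y hy => ?_
    rw [Set.uIcc_of_le hy0] at hy
    exact orbSum_eq hΓ hψ (hM _ ⟨y, hy, rfl⟩)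
  · intro g _
    exact (hc.comp (((g : Euc)⁻¹).continuous.comp (continuous_pt x))).intervalIntegrable _ _

/-- Stated for all small radii, so that one bump can be used simultaneously over `v + α x` and over
`x`. -/
theorem projFun_orbSum_dBump {Γ : Subgroup Euc} (hΓ : IsCryst Γ) {x v : Plane} {u y0 : ℝ}
    (hy0 : 0 ≤ y0) {α : Plane ≃ₗᵢ[ℝ] Plane}
    (hx : ∀ g : Γ, ((g : Euc) (pt x u)).fst = v + α x →
      ∃ z, (g : Euc) = upEl v α z ∨ (g : Euc) = downEl v α z) :
    ∀ᶠ r in 𝓝[>] (0 : ℝ), ∀ G : ContDiffBump (pt x u), G.rOut = r →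
      projFun y0 (orbSum Γ (dBump G)) (v + α x) = jump Γ v α y0 u := by
  filter_upwards [eventually_lt_dist hΓ (pt x u) (isCompact_seg (v + α x) y0),
    eventually_lt_dist hΓ (pt x u) (isCompact_singleton (x := pt (v + α x) 0)),
    eventually_lt_dist hΓ (pt x u) (isCompact_singleton (x := pt (v + α x) y0))]
    with r h h0 h1 G hG
  subst hG
  obtain ⟨M, hM⟩ := (isCompact_seg (v + α x) y0).isBounded.exists_norm_le
  have hψ : ∀ z, dBump G z ≠ 0 → ‖z‖ ≤ ‖pt x u‖ + G.rOut := by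
    intro z hz
    have h2 := dBump_ne_zero G hz
    rw [dist_eq_norm] at h2
    linarith [norm_le_norm_add_norm_sub' z (pt x u)]
  rw [projFun_orbSum hΓ hy0 hψ (dBump_contDiff G).continuous hM]
  rw [Finset.sum_congr rfl fun g _ => integral_dBump_orbit hy0 hx G h h0 h1 g]
  rw [Finset.sum_add_distrib, Finset.sum_sub_distrib, Finset.sum_sub_distrib]
  have key : ∀ A : Euc, A (pt x u) ∈ seg (v + α x) y0 → ∀ hA : A ∈ Γ,
      (⟨A, hA⟩ : Γ) ∈ near hΓ (‖pt x u‖ + G.rOut + M) := by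
    intro A hA hmem
    rw [mem_near]
    have h2 := norm_apply_zero_le A (A (pt x u))
    rw [inv_apply_eq.2 rfl] at h2
    have := hM _ hA
    have := G.rOut_pos
    change ‖A 0‖ ≤ _
    linarith
  have m0 : pt (v + α x) 0 ∈ seg (v + α x) y0 := ⟨0, ⟨le_rfl, hy0⟩, rfl⟩
  have m1 : pt (v + α x) y0 ∈ seg (v + α x) y0 := ⟨y0, ⟨hy0, le_rfl⟩, rfl⟩
  rw [sum_ind_eq _ _ (key _ (by simpa using m1)), sum_ind_eq _ _ (key _ (by simpa using m0)),
    sum_ind_eq _ _ (key _ (by simpa using m1)), sum_ind_eq _ _ (key _ (by simpa using m0))]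
  rfl

/-- The projection of the same test function is evaluated at `v + α x` and at `x`; a symmetry makes
the two signed counts agree. -/
theorem jump_eq {Γ : Subgroup Euc} (hΓ : IsCryst Γ) {v : Plane} {y0 : ℝ} (hy0 : 0 ≤ y0)
    {α : Plane ≃ₗᵢ[ℝ] Plane} (h : IsProjSymm Γ y0 v α) (u : ℝ) :
    jump Γ v α y0 u = jump Γ 0 1 y0 u := by
  -- The base point has to be generic for `(v, α)` and for the identity at once.
  obtain ⟨x, hx, hx'⟩ := ((ae_generic hΓ u v α).and (ae_generic hΓ u 0 1)).exists
  obtain ⟨r, ⟨h1, h2⟩, hr⟩ := (((projFun_orbSum_dBump hΓ hy0 hx).and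
    (projFun_orbSum_dBump hΓ hy0 hx')).and self_mem_nhdsWithin).exists
  have hr : 0 < r := hr
  let G : ContDiffBump (pt x u) := ⟨r / 2, r, by linarith, by linarith⟩
  rw [← h1 G rfl, ← h2 G rfl]
  have hψ : ∀ z, dBump G z ≠ 0 → ‖z‖ ≤ ‖pt x u‖ + G.rOut := by
    intro z hz
    have h2 := dBump_ne_zero G hz
    rw [dist_eq_norm] at h2
    linarith [norm_le_norm_add_norm_sub' z (pt x u)]
  rw [h _ (orbSum_mem_invFun hΓ hψ (dBump_contDiff G)) x]
  congr 1
  exact (zero_add x).symm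

end

section

/-! ### Symmetries of projected functions -/

open Filter Topology Metric

/-- If no element of `Γ` lies over `(v, α)`, then `(v, α)` is not a symmetry. -/
theorem exists_over_of_isProjSymm {Γ : Subgroup Euc} (hΓ : IsCryst Γ) {v : Plane} {y0 : ℝ}
    (hy0 : 0 < y0) {α : Plane ≃ₗᵢ[ℝ] Plane} (h : IsProjSymm Γ y0 v α) :
    ∃ z, upEl v α z ∈ Γ ∨ downEl v α z ∈ Γ := by
  by_contra hne
  push Not at hne
  -- Here the test function is a nonnegative bump at the middle of the segment over `x`. Its orbit
  -- avoids the segment over `v + α x`, so the projected function vanishes there but is positive at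
  -- `x`.
  obtain ⟨x, hx⟩ := (ae_generic hΓ (y0 / 2) v α).exists
  have hout : ∀ g : Γ, (g : Euc) (pt x (y0 / 2)) ∉ seg (v + α x) y0 := by
    rintro g ⟨y, -, hy⟩
    obtain ⟨z, hz | hz⟩ := hx g (by rw [← hy, pt_fst])
    · exact (hne z).1 (hz ▸ g.2)
    · exact (hne z).2 (hz ▸ g.2)
  obtain ⟨r, hr, hr0⟩ := ((eventually_lt_dist hΓ (pt x (y0 / 2))
    (isCompact_seg (v + α x) y0)).and self_mem_nhdsWithin).exists
  have hr0 : 0 < r := hr0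
  let G : ContDiffBump (pt x (y0 / 2)) := ⟨r / 2, r, by linarith, by linarith⟩
  have hG : ∀ z, G z ≠ 0 → dist z (pt x (y0 / 2)) < r := by
    intro z hz
    have : z ∈ Function.support G := hz
    rwa [G.support_eq] at this
  have hψ : ∀ z, G z ≠ 0 → ‖z‖ ≤ ‖pt x (y0 / 2)‖ + r := by
    intro z hz
    have h2 := hG z hz
    rw [dist_eq_norm] at h2
    linarith [norm_le_norm_add_norm_sub' z (pt x (y0 / 2))]
  have hc : ContDiff ℝ 1 G := G.contDiff
  have hinv := orbSum_mem_invFun hΓ hψ hc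
  have h0 : projFun y0 (orbSum Γ G) (v + α x) = 0 := by
    unfold projFun
    rw [intervalIntegral.integral_congr (g := fun _ => 0)]
    · simp
    · intro y hy
      rw [Set.uIcc_of_le hy0.le] at hy
      refine finsum_eq_zero_of_forall_eq_zero fun g => ?_
      by_contra hne
      have h1 := hG _ hne
      rw [dist_comm, ← (g : Euc).dist_map, ← inv_apply_eq.1 rfl] at h1
      exact absurd (hr g (hout g) _ ⟨y, hy, rfl⟩) h1.not_gt
  have h1 : 0 < projFun y0 (orbSum Γ G) x := by
    refine intervalIntegral.integral_pos hy0 ?_ ?_ ?_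
    · exact (hinv.1.continuous.comp (continuous_pt x)).continuousOn
    · intro y _
      exact finsum_nonneg fun g => G.nonneg
    · refine ⟨y0 / 2, ⟨by linarith, by linarith⟩, ?_⟩
      rw [orbSum_eq hΓ hψ le_rfl]
      have h1 : (1 : Γ) ∈ near hΓ (‖pt x (y0 / 2)‖ + r + ‖pt x (y0 / 2)‖) := by
        rw [mem_near]
        have : ((1 : Γ) : Euc) 0 = 0 := rfl
        rw [this, norm_zero]
        positivity
      refine lt_of_lt_of_le ?_ (Finset.single_le_sum
        (f := fun g : Γ => G ((g : Euc)⁻¹ (pt x (y0 / 2)))) (fun g _ => G.nonneg) h1)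
      exact G.pos_of_mem_ball (mem_ball_self hr0)
  rw [h _ hinv x] at h0
  exact h1.ne' h0

/-- The vertical translations of a crystallographic group form a cyclic group. -/
theorem exists_vertical {L : AddSubgroup Space} (hL : IsLattice L) :
    ∃ c, 0 ≤ c ∧ ∀ z, pt 0 z ∈ L ↔ ∃ n : ℤ, z = n * c := by
  let I : ℝ →+ Space := ⟨⟨fun z => pt 0 z, rfl⟩, fun x y => by rw [pt_add, add_zero]⟩
  -- Discreteness of the lattice keeps small vertical vectors away from `0`, so they form a cyclic
  -- group. The generator may be `0`.
  have hfin : {z : ℝ | pt 0 z ∈ L ∧ z ∈ Set.Ioo 0 1}.Finite := by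
    refine Set.Finite.of_finite_image (f := pt 0) ((hL.finite_norm_le 1).subset ?_) ?_
    · rintro _ ⟨z, ⟨hz, h0, h1⟩, rfl⟩
      refine ⟨hz, ?_⟩
      have := pt_norm_sq (pt 0 z)
      simp only [pt_fst, pt_snd, norm_zero] at this
      nlinarith [norm_nonneg (pt 0 z)]
    · intro z _ w _ h
      exact (pt_inj.1 h).2
  obtain ⟨ε, hε, hε1, hmin⟩ : ∃ ε : ℝ, 0 < ε ∧ ε ≤ 1 ∧
      ∀ z ∈ {z : ℝ | pt 0 z ∈ L ∧ z ∈ Set.Ioo 0 1}, ε ≤ z := by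
    rcases Set.eq_empty_or_nonempty {z : ℝ | pt 0 z ∈ L ∧ z ∈ Set.Ioo 0 1} with h | h
    · exact ⟨1, one_pos, le_rfl, by rw [h]; simp⟩
    · obtain ⟨ε, hε, hmin⟩ := hfin.exists_minimal h
      exact ⟨ε, hε.2.1, hε.2.2.le, fun z hz => (le_total ε z).elim id fun h => hmin hz h⟩
  obtain ⟨b, hb⟩ := AddSubgroup.cyclic_of_isolated_zero (H := L.comap I) hε (by
    rw [Set.disjoint_left]
    rintro z hz ⟨h0, h1⟩
    exact absurd (hmin z ⟨hz, h0, h1.trans_le hε1⟩) h1.not_ge)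
  have key : ∀ z, pt 0 z ∈ L ↔ ∃ n : ℤ, z = n * b := by
    intro z
    have : pt 0 z ∈ L ↔ z ∈ L.comap I := Iff.rfl
    rw [this, hb, AddSubgroup.mem_closure_singleton]
    simp [eq_comm]
  rcases le_total 0 b with h | h
  · exact ⟨b, h, key⟩
  · refine ⟨-b, by linarith, fun z => (key z).trans ⟨?_, ?_⟩⟩ <;>
    · rintro ⟨n, rfl⟩
      exact ⟨-n, by push_cast; ring⟩

/-- The elements of `Γ` responsible for a symmetry of all projected functions. -/
theorem symm_cases {Γ : Subgroup Euc} (hΓ : IsCryst Γ) {v : Plane} {y0 : ℝ}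
    (hy0 : 0 < y0) {α : Plane ≃ₗᵢ[ℝ] Plane} (h : IsProjSymm Γ y0 v α) :
    upEl v α 0 ∈ Γ ∨ downEl v α y0 ∈ Γ ∨
      (pt 0 y0 ∈ trans Γ ∧ ∃ z, upEl v α z ∈ Γ ∨ downEl v α z ∈ Γ) := by
  by_contra hcon
  push Not at hcon
  obtain ⟨h1, h2, h3⟩ := hcon
  have hex := exists_over_of_isProjSymm hΓ hy0 h
  have hT : pt 0 y0 ∉ trans Γ := by
    intro hT
    obtain ⟨z, hz⟩ := hex
    obtain ⟨h4, h5⟩ := h3 hT z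
    exact hz.elim h4 h5
  -- At these two heights the end points of the segment coincide with the point under study, so the
  -- counts involve exactly the elements excluded by assumption.
  have j0 := jump_eq hΓ hy0.le h 0
  have j1 := jump_eq hΓ hy0.le h y0
  have hone : upEl 0 1 0 ∈ Γ := mem_trans_iff.1 (zero_mem (trans Γ))
  have hT' : pt 0 (-y0) ∉ trans Γ := by
    intro h
    have := neg_mem h
    rw [pt_neg, neg_zero, neg_neg] at this
    exact hT this
  rw [mem_trans_iff] at hT hT'
  unfold jump at j0 j1
  simp only [sub_zero, neg_zero, add_zero, sub_self] at j0 j1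
  rw [ind_of_not h1, ind_of_not h2, ind_of_not hT, ind_of hone] at j0
  -- At `u = 0` the side of `(v, α)` is nonnegative, while the identity contributes `-1` on the
  -- other side. Only a mirror at height `0` can compensate.
  have hm : downEl 0 1 0 ∈ Γ := by
    by_contra hm
    rw [ind_of_not hm] at j0
    rcases ind_cases (upEl v α y0 ∈ Γ) with ⟨-, e1⟩ | ⟨-, e1⟩ <;>
    rcases ind_cases (downEl v α 0 ∈ Γ) with ⟨-, e2⟩ | ⟨-, e2⟩ <;>
    rcases ind_cases (downEl 0 1 y0 ∈ Γ) with ⟨-, e3⟩ | ⟨-, e3⟩ <;>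
    rw [e1, e2, e3] at j0 <;> norm_num at j0
  have hm' := mem_transSigma_iff.2 hm
  have hv : ∀ z, downEl v α z ∈ Γ ↔ upEl v α z ∈ Γ := fun z => downEl_mem_iff hm'
  have ho : ∀ z, downEl 0 1 z ∈ Γ ↔ upEl 0 1 z ∈ Γ := fun z => downEl_mem_iff hm'
  have h2' : upEl v α y0 ∉ Γ := fun h => h2 ((hv _).2 h)
  have h2'' : upEl v α (-y0) ∉ Γ := fun h => h2' (by simpa using upEl_neg hm' h)
  rw [ind_of_not h1, ind_of_not h2, ind_of_not h2'', ind_of_not hT', ind_of hone,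
    ind_congr (ho _), ind_congr (ho _), ind_of_not hT] at j1
  -- At `u = y0` the identity contributes `+1` against a side that is at most `0`, so `2 y0` must be
  -- a vertical period.
  have h2y : pt 0 (y0 + y0) ∈ trans Γ := by
    rw [mem_trans_iff]
    by_contra h2y
    rw [ind_of_not h2y] at j1
    rcases ind_cases (downEl v α (y0 + y0) ∈ Γ) with ⟨-, e1⟩ | ⟨-, e1⟩ <;>
    rw [e1] at j1 <;> norm_num at j1
  obtain ⟨t, ht⟩ := hex
  rw [hv, or_self] at ht
  -- The mirror turns the shift `t` into `-t`, so `2t` is a vertical period too.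
  have h2t := upEl_diff ht (upEl_neg hm' ht)
  obtain ⟨c, -, hc⟩ := exists_vertical hΓ
  obtain ⟨m, hm2⟩ := (hc _).1 h2y
  obtain ⟨n, hn2⟩ := (hc _).1 h2t
  have e1 : y0 = m / 2 * c := by linarith
  have e2 : t = n / 2 * c := by linarith
  -- Both `y0` and `t` are multiples of `c/2`. As `y0` is no period it is an odd multiple; then `t`
  -- is congruent modulo `c` to `0` or to `y0`, and each possibility yields an excluded element.
  rcases Int.even_or_odd m with ⟨k, hk⟩ | ⟨k, hk⟩
  · refine hT (mem_trans_iff.1 ((hc _).2 ⟨k, ?_⟩))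
    rw [e1, hk]
    push_cast
    ring
  rcases Int.even_or_odd n with ⟨l, hl⟩ | ⟨l, hl⟩
  · refine h1 ?_
    have := upEl_shift ht ((hc (-t)).2 ⟨-l, by rw [e2, hl]; push_cast; ring⟩)
    simpa using this
  · refine h2' ?_
    have := upEl_shift ht ((hc (y0 - t)).2 ⟨k - l, by rw [e1, e2, hk, hl]; push_cast; ring⟩)
    simpa using this

end

/-! ### The group of periods -/

/-- All later computations of periods go through this criterion. One direction is `symm_cases` with
trivial linear part; the other substitutes in the integral. -/
theorem mem_periods {Γ : Subgroup Euc} (hΓ : IsCryst Γ) {y0 : ℝ} (hy0 : 0 < y0) {p : Plane} :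
    p ∈ periods Γ y0 ↔ pt p 0 ∈ trans Γ ∨ pt p y0 ∈ transSigma Γ ∨
      (pt 0 y0 ∈ trans Γ ∧ ∃ z, pt p z ∈ trans Γ ∨ pt p z ∈ transSigma Γ) := by
  constructor
  · intro h
    have hs : IsProjSymm Γ y0 p 1 := by
      intro f hf x
      rw [add_comm]
      exact h f hf x
    simpa only [mem_trans_iff, mem_transSigma_iff] using symm_cases hΓ hy0 hs
  · intro h f hf x
    have hup : ∀ {z}, pt p z ∈ trans Γ → ∀ y, f (pt (x + p) y) = f (pt x (y - z)) := by
      intro z hz y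
      rw [← hf.2 _ (mem_trans_iff.1 hz) (pt x _), upEl_apply]
      simp [add_comm]
    have hdown : ∀ {z}, pt p z ∈ transSigma Γ → ∀ y, f (pt (x + p) y) = f (pt x (z - y)) := by
      intro z hz y
      rw [← hf.2 _ (mem_transSigma_iff.1 hz) (pt x _), downEl_apply]
      simp [add_comm]
    unfold projFun
    rcases h with h | h | ⟨h0, z, h | h⟩
    · simp_rw [hup h, sub_zero]
    · simp_rw [hdown h]
      rw [intervalIntegral.integral_comp_sub_left (fun y => f (pt x y)) y0]
      simp
    all_goals
      -- Over a full period the shift or reflection by `z` no longer matters, so its height is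
      -- unrestricted.
      have hper : Function.Periodic (fun y => f (pt x y)) y0 := by
        intro y
        have := hf.2 _ (mem_trans_iff.1 h0) (pt x y)
        rw [upEl_apply] at this
        simpa [add_comm] using this
    · simp_rw [hup h]
      rw [intervalIntegral.integral_comp_sub_right (fun y => f (pt x y)) z]
      have := hper.intervalIntegral_add_eq (0 - z) 0
      rwa [zero_add, show (0 - z) + y0 = y0 - z by ring] at this
    · simp_rw [hdown h]
      rw [intervalIntegral.integral_comp_sub_left (fun y => f (pt x y)) z]
      have := hper.intervalIntegral_add_eq (z - y0) 0
      rwa [zero_add, show (z - y0) + y0 = z - 0 by ring] at this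

/-- Without horizontal mirrors or glides the periods come from the lattice alone. -/
theorem periods_of_transSigma_eq_empty {Γ : Subgroup Euc} (hΓ : IsCryst Γ)
    (hσ : transSigma Γ = ∅) {y0 : ℝ} (hy0 : 0 < y0) :
    (pt 0 y0 ∈ trans Γ → periods Γ y0 = projL (trans Γ)) ∧
      (pt 0 y0 ∉ trans Γ → periods Γ y0 = restr0 (trans Γ)) := by
  constructor <;> intro h <;> ext p <;> rw [mem_periods hΓ hy0, hσ]
  · simp only [Set.mem_empty_iff_false, or_false, false_or, h, true_and]
    rw [mem_projL]
    exact ⟨fun h => h.elim (fun h => ⟨_, h⟩) id, Or.inr⟩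
  · simp [h, mem_restr0]

theorem transSigma_eq_empty {Γ : Subgroup Euc} (h : ¬SigmaInv (trans Γ)) : transSigma Γ = ∅ := by
  by_contra hne
  obtain ⟨w, hw⟩ := Set.nonempty_iff_ne_empty.2 hne
  exact h (sigmaInv_of_transSigma hw)

/-- The groups of periods when `σ L ⊄ L` and `(0, c)` generates the vertical vectors of `L`. -/
theorem periods_of_not_sigmaInv {Γ : Subgroup Euc} (hΓ : IsCryst Γ) {c : ℝ}
    (hc : ∀ z : ℝ, pt 0 z ∈ trans Γ ↔ ∃ n : ℤ, z = n * c) (hσ : ¬SigmaInv (trans Γ))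
    {y0 : ℝ} (hy0 : 0 < y0) :
    (y0 ∈ widths 0 c → periods Γ y0 = projL (trans Γ)) ∧
      (y0 ∉ widths 0 c → periods Γ y0 = restr0 (trans Γ)) := by
  have := periods_of_transSigma_eq_empty hΓ (transSigma_eq_empty hσ) hy0
  have hw : y0 ∈ widths 0 c ↔ pt 0 y0 ∈ trans Γ := by
    rw [hc]
    simp [widths, hy0]
  rwa [hw]

/-! ### Conjugation by isometries of the plane -/

theorem mem_conjPlus {Γ : Subgroup Euc} {α : Plane ≃ₗᵢ[ℝ] Plane} {g : Euc} :
    g ∈ conjPlus α Γ ↔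
      (plus α).toAffineIsometryEquiv⁻¹ * g * (plus α).toAffineIsometryEquiv ∈ Γ := by
  unfold conjPlus
  constructor
  · rintro ⟨h, hh, rfl⟩
    convert hh using 1
    simp [mul_assoc]
  · intro h
    exact ⟨_, h, by simp [mul_assoc]⟩

theorem upEl_mem_conjPlus {Γ : Subgroup Euc} {α : Plane ≃ₗᵢ[ℝ] Plane} {p : Plane} {z : ℝ} :
    upEl (α p) 1 z ∈ conjPlus α Γ ↔ upEl p 1 z ∈ Γ := by
  rw [mem_conjPlus]
  have : (plus α).toAffineIsometryEquiv⁻¹ * upEl (α p) 1 z * (plus α).toAffineIsometryEquiv =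
      upEl p 1 z := by
    rw [mul_assoc, inv_mul_eq_iff_eq_mul]
    apply euc_ext
    intro x y
    rw [mul_apply', mul_apply']
    change upEl (α p) 1 z (pt (α x) y) = plus α (upEl p 1 z (pt x y))
    simp
  rw [this]

theorem downEl_mem_conjPlus {Γ : Subgroup Euc} {α : Plane ≃ₗᵢ[ℝ] Plane} {p : Plane} {z : ℝ} :
    downEl (α p) 1 z ∈ conjPlus α Γ ↔ downEl p 1 z ∈ Γ := by
  rw [mem_conjPlus]
  have : (plus α).toAffineIsometryEquiv⁻¹ * downEl (α p) 1 z * (plus α).toAffineIsometryEquiv =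
      downEl p 1 z := by
    rw [mul_assoc, inv_mul_eq_iff_eq_mul]
    apply euc_ext
    intro x y
    rw [mul_apply', mul_apply']
    change downEl (α p) 1 z (pt (α x) y) = plus α (downEl p 1 z (pt x y))
    simp
  rw [this]

theorem mem_trans_conjPlus {Γ : Subgroup Euc} {α : Plane ≃ₗᵢ[ℝ] Plane} {p : Plane} {z : ℝ} :
    pt (α p) z ∈ trans (conjPlus α Γ) ↔ pt p z ∈ trans Γ := by
  rw [mem_trans_iff, mem_trans_iff, upEl_mem_conjPlus]

theorem mem_transSigma_conjPlus {Γ : Subgroup Euc} {α : Plane ≃ₗᵢ[ℝ] Plane} {p : Plane} {z : ℝ} :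
    pt (α p) z ∈ transSigma (conjPlus α Γ) ↔ pt p z ∈ transSigma Γ := by
  rw [mem_transSigma_iff, mem_transSigma_iff, downEl_mem_conjPlus]

theorem trans_conjPlus (Γ : Subgroup Euc) (α : Plane ≃ₗᵢ[ℝ] Plane) :
    trans (conjPlus α Γ) = (trans Γ).map (plus α).toLinearEquiv.toLinearMap.toAddMonoidHom := by
  ext z
  rw [← pt_eta z, ← α.apply_symm_apply z.fst, mem_trans_conjPlus]
  constructor
  · intro h
    exact ⟨_, h, rfl⟩
  · rintro ⟨w, hw, h⟩
    rw [← pt_eta w] at hw h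
    have h' : pt (α w.fst) w.snd = pt (α (α.symm z.fst)) z.snd := h
    rw [pt_inj] at h'
    rwa [← α.injective h'.1, ← h'.2]

theorem map_gen3 (f : Space →+ Space) (a b c : Space) :
    (gen3 a b c).map f = gen3 (f a) (f b) (f c) := by
  unfold gen3
  rw [AddMonoidHom.map_closure, Set.image_insert_eq, Set.image_pair]

theorem IsCryst.conjPlus {Γ : Subgroup Euc} (hΓ : IsCryst Γ) (α : Plane ≃ₗᵢ[ℝ] Plane) :
    IsCryst (conjPlus α Γ) := by
  obtain ⟨a, b, c, hli, hL⟩ := hΓ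
  refine ⟨plus α a, plus α b, plus α c, ?_, ?_⟩
  · have := hli.map' (plus α).toLinearEquiv.toLinearMap (plus α).toLinearEquiv.ker
    have e : ![plus α a, plus α b, plus α c] =
        (plus α).toLinearEquiv.toLinearMap ∘ ![a, b, c] := by
      funext i
      fin_cases i <;> rfl
    rw [e]
    exact this
  · rw [trans_conjPlus, hL, map_gen3]
    rfl

/-- The isometry `α₊` leaves heights alone, so each alternative of `mem_periods` transports
separately. -/
theorem mem_periods_conjPlus {Γ : Subgroup Euc} (hΓ : IsCryst Γ) (α : Plane ≃ₗᵢ[ℝ] Plane) {y0 : ℝ}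
    (hy0 : 0 < y0) {p : Plane} : α p ∈ periods (conjPlus α Γ) y0 ↔ p ∈ periods Γ y0 := by
  rw [mem_periods hΓ hy0, mem_periods (hΓ.conjPlus α) hy0]
  have h0 := mem_trans_conjPlus (Γ := Γ) (α := α) (p := 0) (z := y0)
  rw [map_zero] at h0
  simp only [mem_trans_conjPlus, mem_transSigma_conjPlus, h0]

theorem conjPlus_conjPlus (Γ : Subgroup Euc) (α β : Plane ≃ₗᵢ[ℝ] Plane) :
    conjPlus β (conjPlus α Γ) = conjPlus (α.trans β) Γ := by
  ext g
  rw [mem_conjPlus, mem_conjPlus, mem_conjPlus]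
  rfl

theorem conjPlus_refl (Γ : Subgroup Euc) : conjPlus (LinearIsometryEquiv.refl ℝ Plane) Γ = Γ := by
  ext g
  rw [mem_conjPlus]
  rfl

/-! ### Coordinates in half the hexagonal lattice -/

/-- The point `(m h₁ + n h₂) / 2`. -/
noncomputable def hh (m n : ℤ) : Plane := !₂[m / 2 + n / 4, n * √3 / 4]

theorem plane_ext {x y : Plane} (h0 : x 0 = y 0) (h1 : x 1 = y 1) : x = y := by
  ext i
  fin_cases i
  exacts [h0, h1]

theorem hh_add (m n m' n' : ℤ) : hh m n + hh m' n' = hh (m + m') (n + n') := by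
  apply plane_ext <;> simp [hh] <;> ring

theorem hh_sub (m n m' n' : ℤ) : hh m n - hh m' n' = hh (m - m') (n - n') := by
  apply plane_ext <;> simp [hh] <;> ring

theorem hh_zsmul (k m n : ℤ) : k • hh m n = hh (k * m) (k * n) := by
  rw [← Int.cast_smul_eq_zsmul ℝ]
  apply plane_ext <;> simp [hh] <;> ring

theorem sqrt3_pos : (0 : ℝ) < √3 := Real.sqrt_pos.2 (by norm_num)

theorem sqrt3_sq : √3 * √3 = 3 := Real.mul_self_sqrt (by norm_num)

theorem hh_inj {m n m' n' : ℤ} : hh m n = hh m' n' ↔ m = m' ∧ n = n' := by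
  constructor
  · intro h
    have h0 : (hh m n) 0 = (hh m' n') 0 := by rw [h]
    have h1 : (hh m n) 1 = (hh m' n') 1 := by rw [h]
    simp only [hh, PiLp.toLp_apply, Matrix.cons_val_zero, Matrix.cons_val_one] at h0 h1
    have e : (n : ℝ) = n' := by
      have h3 := sqrt3_pos
      field_simp at h1
      exact h1
    rw [e] at h0
    exact ⟨by exact_mod_cast (by linarith : (m : ℝ) = m'), by exact_mod_cast e⟩
  · rintro ⟨rfl, rfl⟩; rfl

theorem hh_zero : hh 0 0 = 0 := by
  apply plane_ext <;> simp [hh]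

/-- Integral combinations `k (a, b) + l (a', b')`, by divisibility. -/
def InLat (u : ℤ × ℤ × ℤ × ℤ) (x y : ℤ) : Prop :=
  (u.1 * u.2.2.2 - u.2.1 * u.2.2.1) ∣ (x * u.2.2.2 - y * u.2.2.1) ∧
    (u.1 * u.2.2.2 - u.2.1 * u.2.2.1) ∣ (u.1 * y - u.2.1 * x)

/-- The planar lattice with two generators in half the hexagonal lattice. -/
noncomputable def lat (u : ℤ × ℤ × ℤ × ℤ) : AddSubgroup Plane :=
  gen2 (hh u.1 u.2.1) (hh u.2.2.1 u.2.2.2)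

/-- The generators are linearly independent. -/
def Indep (u : ℤ × ℤ × ℤ × ℤ) : Prop := u.1 * u.2.2.2 - u.2.1 * u.2.2.1 ≠ 0

theorem mem_lat' {u : ℤ × ℤ × ℤ × ℤ} {p : Plane} : p ∈ lat u ↔
    ∃ k l : ℤ, p = hh (k * u.1 + l * u.2.2.1) (k * u.2.1 + l * u.2.2.2) := by
  unfold lat
  simp only [mem_gen2, hh_zsmul, hh_add]

/-- Cramer's rule: the coefficients are quotients by the determinant, so membership is a pair of
divisibilities. With numerical generators these are congruences. -/
theorem mem_lat {u : ℤ × ℤ × ℤ × ℤ} (hu : Indep u) {p : Plane} :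
    p ∈ lat u ↔ ∃ x y : ℤ, p = hh x y ∧ InLat u x y := by
  obtain ⟨a, b, a', b'⟩ := u
  rw [mem_lat']
  simp only [InLat, Indep] at *
  constructor
  · rintro ⟨k, l, h⟩
    exact ⟨_, _, h, ⟨k, by ring⟩, ⟨l, by ring⟩⟩
  · rintro ⟨x, y, rfl, ⟨k, hk⟩, ⟨l, hl⟩⟩
    refine ⟨k, l, hh_inj.2 ⟨?_, ?_⟩⟩ <;> refine mul_left_cancel₀ hu ?_
    · linear_combination a * hk + a' * hl
    · linear_combination b * hk + b' * hl

theorem hh_mem_lat {u : ℤ × ℤ × ℤ × ℤ} (hu : Indep u) {x y : ℤ} :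
    hh x y ∈ lat u ↔ InLat u x y := by
  rw [mem_lat hu]
  constructor
  · rintro ⟨x', y', h, h'⟩
    obtain ⟨rfl, rfl⟩ := hh_inj.1 h
    exact h'
  · exact fun h => ⟨x, y, rfl, h⟩

theorem h1_eq : h1 = hh 2 0 := by apply plane_ext <;> simp [hh, h1]
theorem h2_eq : h2 = hh 0 2 := by apply plane_ext <;> simp [hh, h2] <;> ring
theorem v20_eq : !₂[(2 : ℝ), 0] = hh 4 0 := by apply plane_ext <;> simp [hh]; ring
theorem v12_eq : !₂[(1 / 2 : ℝ), 0] = hh 1 0 := by apply plane_ext <;> simp [hh]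
theorem v1r_eq : !₂[(1 : ℝ), √3] = hh 0 4 := by apply plane_ext <;> simp [hh]
theorem v14_eq : !₂[(1 / 4 : ℝ), √3 / 4] = hh 0 1 := by apply plane_ext <;> simp [hh]
theorem v34_eq : !₂[(3 / 4 : ℝ), √3 / 4] = hh 1 1 := by apply plane_ext <;> simp [hh] ; ring
theorem v32_eq : !₂[(3 / 2 : ℝ), √3 / 2] = hh 2 2 := by apply plane_ext <;> simp [hh] <;> ring
theorem v34n_eq : !₂[(3 / 4 : ℝ), -(√3 / 4)] = hh 2 (-1) := by
  apply plane_ext <;> simp [hh] <;> ring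
theorem v11_eq : !₂[(1 : ℝ), √3 / 2] = hh 1 2 := by apply plane_ext <;> simp [hh] <;> ring

theorem hexL_eq : hexL = lat (2, 0, 0, 2) := by rw [hexL, h1_eq, h2_eq]; rfl
theorem recI_eq : recI = lat (1, 0, -1, 2) := by
  have : !₂[(0 : ℝ), √3 / 2] = hh (-1) 2 := by apply plane_ext <;> simp [hh] <;> ring
  rw [recI, v12_eq, this]; rfl
theorem recII_eq : recII = lat (-1, 2, 2, 0) := by
  have : !₂[(0 : ℝ), √3 / 2] = hh (-1) 2 := by apply plane_ext <;> simp [hh] <;> ring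
  have h : !₂[(1 : ℝ), 0] = hh 2 0 := h1_eq
  rw [recII, this, h]; rfl
theorem recIII_eq : recIII = lat (0, 1, 4, -2) := by
  have : !₂[(3 / 2 : ℝ), -(√3 / 2)] = hh 4 (-2) := by apply plane_ext <;> simp [hh] <;> ring
  rw [recIII, v14_eq, this]; rfl
theorem rotRecI_eq : rotRecI = lat (0, 1, -2, 1) := by
  have : !₂[-(3 / 4 : ℝ), √3 / 4] = hh (-2) 1 := by apply plane_ext <;> simp [hh] ; ring
  rw [rotRecI, v14_eq, this]; rfl
theorem rotNegRecI_eq : rotNegRecI = lat (1, -1, 1, 1) := by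
  have : !₂[(1 / 4 : ℝ), -(√3 / 4)] = hh 1 (-1) := by apply plane_ext <;> simp [hh] <;> ring
  rw [rotNegRecI, v34_eq, this]; rfl

theorem smul_gen2 (r : ℝ) (a b : Plane) : r • gen2 a b = gen2 (r • a) (r • b) := by
  unfold gen2
  refine (AddMonoidHom.map_closure (DistribSMul.toAddMonoidHom Plane r) _).trans ?_
  rw [Set.image_pair]
  rfl

theorem two_smul_hh (m n : ℤ) : (2 : ℝ) • hh m n = hh (2 * m) (2 * n) := by
  apply plane_ext <;> simp [hh] <;> ring

theorem half_smul_hh (m n : ℤ) : (1 / 2 : ℝ) • hh (2 * m) (2 * n) = hh m n := by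
  apply plane_ext <;> simp [hh] <;> ring

theorem two_smul_lat (a b a' b' : ℤ) :
    (2 : ℝ) • lat (a, b, a', b') = lat (2 * a, 2 * b, 2 * a', 2 * b') := by
  unfold lat
  rw [smul_gen2, two_smul_hh, two_smul_hh]

theorem half_smul_lat (a b a' b' : ℤ) :
    (1 / 2 : ℝ) • lat (2 * a, 2 * b, 2 * a', 2 * b') = lat (a, b, a', b') := by
  unfold lat
  rw [smul_gen2, half_smul_hh, half_smul_hh]

theorem half_smul_hexL : (1 / 2 : ℝ) • lat (2, 0, 0, 2) = lat (1, 0, 0, 1) := half_smul_lat 1 0 0 1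

/-! ### The columns in these coordinates -/

/-- A column all of whose entries are given by integers. -/
structure Code where
  a1 : ℤ
  a2 : ℤ
  s : ℤ
  b1 : ℤ
  b2 : ℤ
  v : Option (ℤ × ℤ)
  A : ℤ × ℤ × ℤ × ℤ
  B : ℤ × ℤ × ℤ × ℤ
  C : ℤ × ℤ × ℤ × ℤ
  O : ℤ × ℤ × ℤ × ℤ

namespace Code

/-- The column described by a code. -/
noncomputable def col (k : Code) : Column :=
  ⟨hh k.a1 k.a2, k.s / 2, hh k.b1 k.b2, k.v.map fun v => hh v.1 v.2,
    lat k.A, lat k.B, lat k.C, lat k.O⟩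

/-- Generators of the projection of the lattice. -/
def P (k : Code) : ℤ × ℤ × ℤ × ℤ := (k.a1, k.a2, k.b1, k.b2)

/-- Generators of the elements at height `0` of the lattice. -/
def R (k : Code) : ℤ × ℤ × ℤ × ℤ := ((1 + k.s) * k.a1, (1 + k.s) * k.a2, k.b1, k.b2)

/-- The first generator has height `0` or half the vertical period, the two horizontal generators
are independent, and twice the glide vector is a lattice vector. -/
def Valid (k : Code) : Prop :=
  (k.s = 0 ∨ k.s = 1) ∧ Indep k.P ∧ ∀ v ∈ k.v, InLat k.R (2 * v.1) (2 * v.2)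

/-- The entries of the column agree with the formula for the periods. -/
def Table (k : Code) : Prop :=
  (Indep k.A ∧ ∀ x y, InLat k.A x y ↔
    InLat k.P x y ∨ ∃ v ∈ k.v, InLat k.P (x - v.1) (y - v.2)) ∧
  (Indep k.B ∧ ∀ x y, InLat k.B x y ↔
    InLat k.R x y ∨ ∃ v ∈ k.v, InLat k.R (x - v.1) (y - v.2)) ∧
  (Indep k.C ∧ ∀ x y, InLat k.C x y ↔
    InLat k.R x y ∨ ∃ v ∈ k.v, k.s = 1 ∧ InLat k.R (x - v.1 - k.a1) (y - v.2 - k.a2)) ∧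
  (Indep k.O ∧ ∀ x y, InLat k.O x y ↔ InLat k.R x y)

end Code

/-- The codes of all columns. -/
def codes : List Code :=
  [⟨2, 0, 0, 0, 2, none, (2, 0, 0, 2), (2, 0, 0, 2), (2, 0, 0, 2), (2, 0, 0, 2)⟩,
   ⟨2, 0, 1, 0, 2, none, (2, 0, 0, 2), (0, 2, -4, 2), (0, 2, -4, 2), (0, 2, -4, 2)⟩,
   ⟨1, 0, 1, 0, 2, none, (1, 0, -1, 2), (2, 0, 0, 2), (2, 0, 0, 2), (2, 0, 0, 2)⟩,
   ⟨2, 0, 0, 0, 2, some (0, 0), (2, 0, 0, 2), (2, 0, 0, 2), (2, 0, 0, 2), (2, 0, 0, 2)⟩,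
   ⟨2, 0, 0, 0, 2, some (1, 0), (1, 0, -1, 2), (1, 0, -1, 2), (2, 0, 0, 2), (2, 0, 0, 2)⟩,
   ⟨2, 0, 0, 0, 2, some (0, 1), (0, 1, -2, 1), (0, 1, -2, 1), (2, 0, 0, 2), (2, 0, 0, 2)⟩,
   ⟨2, 0, 0, 0, 2, some (1, 1), (1, -1, 1, 1), (1, -1, 1, 1), (2, 0, 0, 2), (2, 0, 0, 2)⟩,
   ⟨4, 0, 0, 0, 2, some (2, 0), (2, 0, 0, 2), (2, 0, 0, 2), (0, 2, -4, 2), (0, 2, -4, 2)⟩,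
   ⟨2, 0, 0, 0, 4, some (0, 2), (2, 0, 0, 2), (2, 0, 0, 2), (2, 0, -2, 4), (2, 0, -2, 4)⟩,
   ⟨2, 0, 1, 0, 2, some (0, 0), (2, 0, 0, 2), (0, 2, -4, 2), (2, 0, 0, 2), (0, 2, -4, 2)⟩,
   ⟨2, 0, 1, 0, 2, some (2, 0), (2, 0, 0, 2), (2, 0, 0, 2), (0, 2, -4, 2), (0, 2, -4, 2)⟩,
   ⟨2, 0, 1, 0, 4, some (0, 2), (2, 0, 0, 2), (0, 2, -4, 2), (2, -2, 2, 2), (4, 0, 0, 4)⟩,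
   ⟨2, 0, 1, 0, 4, some (2, 2), (2, 0, 0, 2), (2, -2, 2, 2), (0, 2, -4, 2), (4, 0, 0, 4)⟩,
   ⟨2, -1, 1, 0, 2, some (0, 1), (0, 1, -2, 1), (0, 1, 4, -2), (2, 0, 0, 2), (0, 2, -4, 2)⟩,
   ⟨2, -1, 1, 0, 2, some (2, 0), (0, 1, -2, 1), (2, 0, 0, 2), (0, 1, 4, -2), (0, 2, -4, 2)⟩,
   ⟨1, 0, 1, 0, 4, some (0, 2), (1, 0, -1, 2), (2, 0, 0, 2), (-1, 2, 2, 0), (2, 0, -2, 4)⟩,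
   ⟨1, 0, 1, 0, 4, some (1, 2), (1, 0, -1, 2), (-1, 2, 2, 0), (2, 0, 0, 2), (2, 0, -2, 4)⟩,
   ⟨1, 0, 1, 0, 2, some (0, 0), (1, 0, -1, 2), (2, 0, 0, 2), (1, 0, -1, 2), (2, 0, 0, 2)⟩,
   ⟨1, 0, 1, 0, 2, some (1, 0), (1, 0, -1, 2), (1, 0, -1, 2), (2, 0, 0, 2), (2, 0, 0, 2)⟩,
   ⟨1, 0, 1, 0, 2, some (0, 1), (1, 0, 0, 1), (0, 1, -2, 1), (1, -1, 1, 1), (2, 0, 0, 2)⟩,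
   ⟨1, 0, 1, 0, 2, some (1, 1), (1, 0, 0, 1), (1, -1, 1, 1), (0, 1, -2, 1), (2, 0, 0, 2)⟩]

/-- Every vector of the table lies in half the hexagonal lattice, so the real data can be replaced
by integers throughout. -/
theorem columns_eq : columns = codes.map Code.col := by
  simp only [columns, codes, List.map_cons, List.map_nil, Code.col, col31, col32, col33, col41a,
    col41b, col41c, col41d, col42, col43, col51a, col51b, col52a, col52b, col53a, col53b, col54a,
    col54b, col55a, col55b, col55c, col55d, h1_eq, h2_eq, v20_eq, v12_eq, v1r_eq, v14_eq, v34_eq,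
    v32_eq, v34n_eq, v11_eq, hexL_eq, recI_eq, recII_eq, recIII_eq, rotRecI_eq, rotNegRecI_eq,
    two_smul_lat, half_smul_hexL, Option.map_some, Option.map_none, hh_zero]
  norm_num

theorem forall_mem_codes {Q : Code → Prop} (h : codes.Forall Q) : ∀ k ∈ codes, Q k :=
  List.forall_iff_forall_mem.1 h

theorem codes_valid : ∀ k ∈ codes, k.Valid := by
  refine forall_mem_codes ?_
  simp only [codes, List.Forall]
  refine ⟨?_, ?_, ?_, ?_, ?_, ?_, ?_, ?_, ?_, ?_, ?_, ?_, ?_, ?_, ?_, ?_, ?_, ?_, ?_, ?_, ?_⟩ <;>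
    simp [Code.Valid, Indep, Code.P, Code.R, InLat]

/-- With the numbers inserted, each entry is an equivalence of congruences in `x` and `y` with
explicit moduli, which is linear integer arithmetic. -/
theorem codes_table : ∀ k ∈ codes, k.Table := by
  refine forall_mem_codes ?_
  simp only [codes, List.Forall]
  refine ⟨?_, ?_, ?_, ?_, ?_, ?_, ?_, ?_, ?_, ?_, ?_, ?_, ?_, ?_, ?_, ?_, ?_, ?_, ?_, ?_, ?_⟩ <;>
    refine ⟨⟨?_, fun x y => ?_⟩, ⟨?_, fun x y => ?_⟩, ⟨?_, fun x y => ?_⟩, ⟨?_, fun x y => ?_⟩⟩ <;>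
    simp only [Indep, Code.P, Code.R, InLat, Option.mem_def, reduceCtorEq, false_and, exists_false,
      or_false, Option.some.injEq, exists_eq_left', Int.reduceMul, Int.reduceAdd, Int.reduceSub,
      Int.reduceNeg, mul_zero, zero_mul, sub_zero, add_zero, one_mul, ne_eq, true_and,
      neg_dvd, not_false_eq_true, Int.reduceEq] <;>
    omega

section

/-! ### The lattice of a column -/

theorem Code.lattice_def (k : Code) (c : ℝ) :
    k.col.lattice c = gen3 (pt (hh k.a1 k.a2) (k.s / 2 * c)) (pt (hh k.b1 k.b2) 0) (pt 0 c) := rfl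

theorem Code.mem_lattice (k : Code) {c : ℝ} {p : Plane} {z : ℝ} :
    pt p z ∈ k.col.lattice c ↔ ∃ m n l : ℤ,
      p = hh (m * k.a1 + n * k.b1) (m * k.a2 + n * k.b2) ∧ z = (m * k.s / 2 + l) * c := by
  rw [k.lattice_def, pt_mem_gen3]
  refine exists_congr fun m => exists_congr fun n => exists_congr fun l => and_congr ?_ ?_
  · rw [hh_zsmul, hh_zsmul, hh_add, smul_zero, add_zero]
  · refine Eq.congr_right ?_
    ring

variable {k : Code} {c : ℝ}

/-- The determinant is multiplied by `1 + s`, which is `1` or `2`. -/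
theorem Code.Valid.indep_R (hk : k.Valid) : Indep k.R := by
  obtain ⟨hs, h, -⟩ := hk
  unfold Indep P R at *
  simp only at *
  have : (1 + k.s) * k.a1 * k.b2 - (1 + k.s) * k.a2 * k.b1 =
      (1 + k.s) * (k.a1 * k.b2 - k.a2 * k.b1) := by ring
  rw [this]
  exact mul_ne_zero (by omega) h

/-- Points of the lattice at integral heights. -/
theorem Code.Valid.mem_lattice_int (hk : k.Valid) (hc : 0 < c) {p : Plane} (j : ℤ) :
    pt p (j * c) ∈ k.col.lattice c ↔ p ∈ lat k.R := by
  rw [Code.mem_lattice, mem_lat']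
  unfold Code.R
  simp only
  constructor
  · rintro ⟨m, n, l, rfl, h⟩
    have h := mul_right_cancel₀ hc.ne' h
    rcases hk.1 with hs | hs <;> rw [hs] at h ⊢
    · exact ⟨m, n, by ring_nf⟩
    · have : 2 * j = m + 2 * l := by
        have : 2 * (j : ℝ) = m + 2 * l := by rw [h]; push_cast; ring
        exact_mod_cast this
      -- The first generator rises by half a period, so an integral height needs an even number of
      -- copies; this is the factor `1 + s` in `Code.R`.
      obtain ⟨r, rfl⟩ : ∃ r, m = 2 * r := ⟨j - l, by omega⟩
      exact ⟨r, n, by ring_nf⟩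
  · rintro ⟨m, n, rfl⟩
    rcases hk.1 with hs | hs <;> rw [hs]
    · exact ⟨m, n, j, by ring_nf, by push_cast; ring⟩
    -- The `2m` copies of the first generator rise by `m c`, which the vertical generator corrects
    -- to `j c`.
    · exact ⟨2 * m, n, j - m, by ring_nf, by push_cast; ring⟩

/-- Points of the lattice at half-integral heights. -/
theorem Code.Valid.mem_lattice_half (hk : k.Valid) (hc : 0 < c) {p : Plane} (j : ℤ) :
    pt p (j * c + c / 2) ∈ k.col.lattice c ↔ k.s = 1 ∧ p - hh k.a1 k.a2 ∈ lat k.R := by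
  rcases hk.1 with hs | hs
  · rw [Code.mem_lattice]
    constructor
    · rintro ⟨m, n, l, -, h⟩
      exfalso
      have h' : (j + 1 / 2) * c = (m * k.s / 2 + l) * c := by rw [← h]; ring
      have h' := mul_right_cancel₀ hc.ne' h'
      rw [hs] at h'
      have : 2 * (j : ℝ) + 1 = 2 * l := by
        push_cast at h'; linarith
      have : 2 * j + 1 = 2 * l := by exact_mod_cast this
      omega
    · intro h
      omega
  · have ha : pt (hh k.a1 k.a2) (c / 2) ∈ k.col.lattice c := by
      rw [Code.mem_lattice]
      exact ⟨1, 0, 0, by ring_nf, by rw [hs]; push_cast; ring⟩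
    rw [← hk.mem_lattice_int hc j]
    simp only [hs, true_and]
    rw [← add_mem_cancel_right ha (y := pt (p - hh k.a1 k.a2) (j * c)), pt_add, sub_add_cancel]

theorem Code.Valid.height_cases (hk : k.Valid) {p : Plane} {z : ℝ}
    (h : pt p z ∈ k.col.lattice c) : ∃ j : ℤ, z = j * c ∨ z = j * c + c / 2 := by
  obtain ⟨m, n, l, -, rfl⟩ := (Code.mem_lattice k).1 h
  rcases hk.1 with hs | hs <;> rw [hs]
  · exact ⟨l, Or.inl (by push_cast; ring)⟩
  · rcases Int.even_or_odd m with ⟨r, rfl⟩ | ⟨r, rfl⟩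
    · exact ⟨r + l, Or.inl (by push_cast; ring)⟩
    · exact ⟨r + l, Or.inr (by push_cast; ring)⟩

theorem Code.exists_mem_lattice {p : Plane} :
    (∃ z, pt p z ∈ k.col.lattice c) ↔ p ∈ lat k.P := by
  rw [mem_lat']
  simp only [Code.mem_lattice]
  constructor
  · rintro ⟨z, m, n, l, h, -⟩
    exact ⟨m, n, h⟩
  · rintro ⟨m, n, h⟩
    exact ⟨_, m, n, 0, h, rfl⟩

theorem Code.Valid.vertical_mem (hk : k.Valid) (hc : 0 < c) {z : ℝ} :
    pt 0 z ∈ k.col.lattice c ↔ ∃ n : ℤ, z = n * c := by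
  constructor
  · intro h
    obtain ⟨j, rfl | rfl⟩ := hk.height_cases h
    · exact ⟨j, rfl⟩
    · rw [hk.mem_lattice_half hc] at h
      obtain ⟨hs, h⟩ := h
      rw [← hh_zero, hh_sub, hh_mem_lat hk.indep_R] at h
      obtain ⟨⟨r, hr⟩, -⟩ := h
      have h2 := hk.2.1
      unfold R Indep P at *
      simp only [hs] at *
      exfalso
      -- The determinant of `Code.R` is twice that of `Code.P`, so the divisibility would make the
      -- nonzero determinant times an odd number vanish.
      have h3 : (k.a1 * k.b2 - k.a2 * k.b1) * (2 * r + 1) = 0 := by linear_combination -hr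
      rcases mul_eq_zero.1 h3 with h3 | h3
      · exact h2 h3
      · omega
  · rintro ⟨n, rfl⟩
    rw [hk.mem_lattice_int hc]
    exact zero_mem _

theorem Code.col_has_iff {Γ : Subgroup Euc} {y1 : ℝ} : k.col.Has Γ c y1 ↔
    0 < c ∧ y1 ∈ Set.Ico 0 c ∧ trans Γ = k.col.lattice c ∧
      ((k.v = none ∧ transSigma Γ = ∅) ∨ ∃ v ∈ k.v, pt (hh v.1 v.2) y1 ∈ transSigma Γ) := by
  obtain ⟨a1, a2, s, b1, b2, v, A, B, C, O⟩ := k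
  unfold Column.Has Column.Glide
  rcases v with _ | v <;> simp [Code.col]

/-! ### The tables -/

/-- Membership in the set of glides of a group in a column. -/
theorem Code.mem_transSigma {Γ : Subgroup Euc} {y1 : ℝ} (h : k.col.Has Γ c y1) {p : Plane} {z : ℝ} :
    pt p z ∈ transSigma Γ ↔
      ∃ v ∈ k.v, pt (p - hh v.1 v.2) (z - y1) ∈ k.col.lattice c := by
  obtain ⟨-, -, hL, h | ⟨v, hv, h⟩⟩ := Code.col_has_iff.1 h
  · simp [h.1, h.2]
  · rw [mem_transSigma_iff_sub h, pt_sub, hL]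
    rw [Option.mem_def] at hv
    simp [hv]

theorem eq_lat {M : AddSubgroup Plane} {u : ℤ × ℤ × ℤ × ℤ} (hu : Indep u) {Q : ℤ → ℤ → Prop}
    (hQ : ∀ x y, InLat u x y ↔ Q x y) (hM : ∀ p, p ∈ M → ∃ x y, p = hh x y)
    (h : ∀ x y, hh x y ∈ M ↔ Q x y) : M = lat u := by
  ext p
  rw [mem_lat hu]
  constructor
  · intro hp
    obtain ⟨x, y, rfl⟩ := hM p hp
    exact ⟨x, y, rfl, (hQ x y).2 ((h x y).1 hp)⟩
  · rintro ⟨x, y, rfl, hxy⟩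
    exact (h x y).2 ((hQ x y).1 hxy)

theorem exists_hh_of_sub {p : Plane} {a b : ℤ} {u : ℤ × ℤ × ℤ × ℤ} (h : p - hh a b ∈ lat u) :
    ∃ x y, p = hh x y := by
  obtain ⟨k, l, h⟩ := mem_lat'.1 h
  rw [sub_eq_iff_eq_add, hh_add] at h
  exact ⟨_, _, h⟩

theorem exists_hh {p : Plane} {u : ℤ × ℤ × ℤ × ℤ} (h : p ∈ lat u) : ∃ x y, p = hh x y := by
  obtain ⟨k, l, h⟩ := mem_lat'.1 h
  exact ⟨_, _, h⟩

/-- Since `L_σ` is the coset of `(v₁, y1)`, only the residue of `y0 - y1` modulo `c` matters: `0`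
and `c/2` are the only heights at which glides can occur. For `y0` a vertical period, all heights
are allowed and `𝒫(L)` replaces `ℛ₀(L)`. -/
theorem Code.periodTable {Γ : Subgroup Euc} (hΓ : IsCryst Γ) (hk : k.Valid) (ht : k.Table) {y1 : ℝ}
    (h : k.col.Has Γ c y1) :
    PeriodTable Γ c y1 k.col.onA k.col.onB k.col.onC k.col.onO := by
  have hσ := fun p z => Code.mem_transSigma h (p := p) (z := z)
  obtain ⟨hc, hy1, hL, -⟩ := h
  intro y0 hy0
  have hA : y0 ∈ widths 0 c ↔ pt 0 y0 ∈ trans Γ := by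
    rw [hL, hk.vertical_mem hc]
    simp [widths, hy0]
  have hper : ∀ p, p ∈ periods Γ y0 ↔ p ∈ lat k.R ∨
      (∃ v ∈ k.v, pt (p - hh v.1 v.2) (y0 - y1) ∈ k.col.lattice c) ∨
      (y0 ∈ widths 0 c ∧ (p ∈ lat k.P ∨ ∃ v ∈ k.v, p - hh v.1 v.2 ∈ lat k.P)) := by
    intro p
    have e0 : pt p 0 ∈ k.col.lattice c ↔ p ∈ lat k.R := by
      simpa using hk.mem_lattice_int hc (p := p) 0
    rw [mem_periods hΓ hy0, hσ, ← hA, hL, e0, exists_or, Code.exists_mem_lattice]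
    have e1 : (∃ z, pt p z ∈ transSigma Γ) ↔ ∃ v ∈ k.v, p - hh v.1 v.2 ∈ lat k.P := by
      simp only [hσ, ← Code.exists_mem_lattice (c := c)]
      constructor
      · rintro ⟨z, v, hv, h⟩
        exact ⟨v, hv, _, h⟩
      · rintro ⟨v, hv, z, h⟩
        exact ⟨z + y1, v, hv, by rwa [add_sub_cancel_right]⟩
    rw [e1]
  have hRP : ∀ {p}, p ∈ lat k.R → p ∈ lat k.P := by
    intro p hp
    rw [← Code.exists_mem_lattice (c := c)]
    exact ⟨_, (hk.mem_lattice_int hc 0).2 hp⟩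
  have hR := hk.indep_R
  refine ⟨fun hy => ?_, fun hy => ?_, fun hy => ?_, fun hy => ?_⟩
  · have hper' : ∀ p, p ∈ periods Γ y0 ↔
        p ∈ lat k.P ∨ ∃ v ∈ k.v, p - hh v.1 v.2 ∈ lat k.P := by
      intro p
      rw [hper]
      constructor
      · rintro (h | ⟨v, hv, h⟩ | h)
        · exact Or.inl (hRP h)
        · exact Or.inr ⟨v, hv, Code.exists_mem_lattice.1 ⟨_, h⟩⟩
        · exact h.2
      · exact fun h => Or.inr (Or.inr ⟨hy, h⟩)
    refine eq_lat ht.1.1 ht.1.2 (fun p hp => ?_) (fun x y => ?_)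
    · rcases (hper' p).1 hp with h | ⟨v, -, h⟩
      exacts [exists_hh h, exists_hh_of_sub h]
    · rw [hper']
      simp only [hh_sub, hh_mem_lat hk.2.1]
  · obtain ⟨⟨-, n, hn⟩, hy⟩ := hy
    have e : y0 - y1 = n * c := by rw [hn]; ring
    simp only [hy, false_and, or_false, e, hk.mem_lattice_int hc] at hper
    refine eq_lat ht.2.1.1 ht.2.1.2 (fun p hp => ?_) (fun x y => ?_)
    · rcases (hper p).1 hp with h | ⟨v, -, h⟩
      exacts [exists_hh h, exists_hh_of_sub h]
    · rw [hper]
      simp only [hh_sub, hh_mem_lat hR]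
  · obtain ⟨⟨-, n, hn⟩, hy⟩ := hy
    have e : y0 - y1 = n * c + c / 2 := by rw [hn]; ring
    simp only [hy, false_and, or_false, e, hk.mem_lattice_half hc] at hper
    refine eq_lat ht.2.2.1.1 ht.2.2.1.2 (fun p hp => ?_) (fun x y => ?_)
    · rcases (hper p).1 hp with h | ⟨v, -, -, h⟩
      · exact exists_hh h
      · rw [sub_sub, hh_add] at h
        exact exists_hh_of_sub h
    · rw [hper]
      simp only [hh_sub, hh_mem_lat hR]
  -- Lattice heights are multiples of `c/2`, so outside the three families no glide has the required
  -- height.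
  · have e : ∀ p, pt p (y0 - y1) ∉ k.col.lattice c := by
      intro p hp
      obtain ⟨j, hj | hj⟩ := hk.height_cases hp
      · exact hy (Or.inl (Or.inr ⟨hy0, j, by linarith⟩))
      · exact hy (Or.inr ⟨hy0, j, by linarith⟩)
    have hy' : y0 ∉ widths 0 c := fun h => hy (Or.inl (Or.inl h))
    simp only [hy', false_and, or_false, e, and_false, exists_false] at hper
    refine eq_lat ht.2.2.2.1 ht.2.2.2.2 (fun p hp => ?_) (fun x y => ?_)
    · exact exists_hh ((hper p).1 hp)
    · rw [hper]
      simp only [hh_mem_lat hR]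

end

/-! ### Crystallographic groups with a given lattice -/

/-- The group of translations by the vectors of `L`. -/
def translGroup (L : AddSubgroup Space) : Subgroup Euc where
  carrier := {g | ∃ v ∈ L, g = AffineIsometryEquiv.constVAdd ℝ Space v}
  one_mem' := ⟨0, zero_mem _, (AffineIsometryEquiv.constVAdd_zero).symm⟩
  mul_mem' := by
    rintro _ _ ⟨v, hv, rfl⟩ ⟨w, hw, rfl⟩
    exact ⟨v + w, add_mem hv hw, by ext1 z; exact (add_vadd v w z).symm⟩
  inv_mem' := by
    rintro _ ⟨v, hv, rfl⟩
    refine ⟨-v, neg_mem hv, ?_⟩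
    rw [inv_eq_iff_mul_eq_one]
    ext1 z
    exact vadd_neg_vadd v z

theorem constVAdd_inj {v w : Space} : AffineIsometryEquiv.constVAdd ℝ Space v =
    AffineIsometryEquiv.constVAdd ℝ Space w ↔ v = w := by
  refine ⟨fun h => ?_, fun h => by rw [h]⟩
  have := DFunLike.congr_fun h 0
  simpa using this

theorem constVAdd_ne_euc_sigma (v w : Space) :
    AffineIsometryEquiv.constVAdd ℝ Space v ≠ euc w sigma := by
  intro h
  have h' : upEl v.fst 1 v.snd = downEl w.fst 1 w.snd := by
    rw [← constVAdd_eq_upEl]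
    refine h.trans (euc_ext fun x y => ?_)
    rfl
  exact upEl_ne_downEl h'

theorem trans_translGroup (L : AddSubgroup Space) : trans (translGroup L) = L := by
  ext v
  constructor
  · rintro ⟨w, hw, h⟩
    rwa [constVAdd_inj.1 h]
  · exact fun h => ⟨v, h, rfl⟩

theorem transSigma_translGroup (L : AddSubgroup Space) : transSigma (translGroup L) = ∅ := by
  rw [Set.eq_empty_iff_forall_notMem]
  rintro w ⟨v, -, h⟩
  exact constVAdd_ne_euc_sigma _ _ h.symm

theorem sigma_sigma (z : Space) : sigma (sigma z) = z := by
  rw [← pt_eta z]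
  simp

/-- The group generated by the translations by the vectors of `L` and by `(w, σ)`. -/
def glideGroup (L : AddSubgroup Space) (hL : SigmaInv L) (w : Space) (hw : w + sigma w ∈ L) :
    Subgroup Euc where
  carrier := {g | ∃ v ∈ L, g = AffineIsometryEquiv.constVAdd ℝ Space v ∨ g = euc (v + w) sigma}
  one_mem' := ⟨0, zero_mem _, Or.inl (AffineIsometryEquiv.constVAdd_zero).symm⟩
  mul_mem' := by
    rintro _ _ ⟨v, hv, rfl | rfl⟩ ⟨u, hu, rfl | rfl⟩
    · exact ⟨v + u, add_mem hv hu, Or.inl (by ext1 z; exact (add_vadd v u z).symm)⟩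
    · refine ⟨v + u, add_mem hv hu, Or.inr ?_⟩
      ext1 z
      change v + (u + w + sigma z) = v + u + w + sigma z
      abel
    · refine ⟨v + sigma u, add_mem hv (hL _ hu), Or.inr ?_⟩
      ext1 z
      change v + w + sigma (u + z) = v + sigma u + w + sigma z
      rw [map_add]
      abel
    · refine ⟨v + sigma u + (w + sigma w), add_mem (add_mem hv (hL _ hu)) hw, Or.inl ?_⟩
      ext1 z
      change v + w + sigma (u + w + sigma z) = v + sigma u + (w + sigma w) + z
      rw [map_add, map_add, sigma_sigma]
      abel
  inv_mem' := by
    rintro _ ⟨v, hv, rfl | rfl⟩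
    · refine ⟨-v, neg_mem hv, Or.inl ?_⟩
      rw [inv_eq_iff_mul_eq_one]
      ext1 z
      exact vadd_neg_vadd v z
    · refine ⟨-sigma v - (w + sigma w), sub_mem (neg_mem (hL _ hv)) hw, Or.inr ?_⟩
      rw [inv_eq_iff_mul_eq_one]
      ext1 z
      change v + w + sigma (-sigma v - (w + sigma w) + w + sigma z) = z
      simp only [map_add, map_sub, map_neg, sigma_sigma]
      abel

theorem trans_glideGroup {L : AddSubgroup Space} (hL : SigmaInv L) {w : Space}
    (hw : w + sigma w ∈ L) : trans (glideGroup L hL w hw) = L := by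
  ext v
  constructor
  · rintro ⟨u, hu, h | h⟩
    · rwa [constVAdd_inj.1 h]
    · exact absurd h (constVAdd_ne_euc_sigma _ _)
  · exact fun h => ⟨v, h, Or.inl rfl⟩

theorem mem_transSigma_glideGroup {L : AddSubgroup Space} (hL : SigmaInv L) {w : Space}
    (hw : w + sigma w ∈ L) : w ∈ transSigma (glideGroup L hL w hw) :=
  ⟨0, zero_mem _, Or.inr (by rw [zero_add])⟩

/-! ### Linear independence in the plane and in space -/

/-- The determinant of two vectors of the plane. -/
def cross (a b : Plane) : ℝ := a 0 * b 1 - a 1 * b 0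

theorem linearIndependent_pair_iff {a b : Plane} :
    LinearIndependent ℝ ![a, b] ↔ cross a b ≠ 0 := by
  rw [LinearIndependent.pair_iff]
  unfold cross
  constructor
  · intro h h0
    have h1 := h (b 1) (-a 1) (by apply plane_ext <;> simp <;> linarith)
    have h2 := h (b 0) (-a 0) (by apply plane_ext <;> simp <;> linarith)
    have h3 := h 1 0 (by
      apply plane_ext <;> simp
      · linarith [h2.2]
      · linarith [h1.2])
    exact one_ne_zero h3.1
  · intro h s t hst
    have h0 := congrArg (fun x : Plane => x 0) hst
    have h1 := congrArg (fun x : Plane => x 1) hst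
    simp at h0 h1
    constructor <;> refine (mul_eq_zero.1 ?_).resolve_right h
    · linear_combination b 1 * h0 - b 0 * h1
    · linear_combination a 0 * h1 - a 1 * h0

/-- The hypothesis removes the third coefficient; planar independence of the projections removes the
other two. -/
theorem linearIndependent_triple {a b v : Plane} {a3 b3 c : ℝ} (hab : cross a b ≠ 0)
    (h : ∀ s t r : ℝ, s • a + t • b + r • v = 0 → s * a3 + t * b3 + r * c = 0 → r = 0) :
    LinearIndependent ℝ ![pt a a3, pt b b3, pt v c] := by
  rw [Fintype.linearIndependent_iff]
  intro g hg
  rw [Fin.sum_univ_three] at hg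
  simp only [Matrix.cons_val_zero, Matrix.cons_val_one, Matrix.cons_val, pt_smul, pt_add] at hg
  rw [← pt_zero, pt_inj] at hg
  have h2 := h _ _ _ hg.1 hg.2
  have h3 := hg.1
  rw [h2, zero_smul, add_zero] at h3
  have h4 := LinearIndependent.pair_iff.1 (linearIndependent_pair_iff.2 hab) _ _ h3
  intro i
  fin_cases i
  exacts [h4.1, h4.2, h2]

theorem isLattice_gen3 {a b v : Plane} {a3 b3 c : ℝ} (hab : cross a b ≠ 0)
    (h : ∀ s t r : ℝ, s • a + t • b + r • v = 0 → s * a3 + t * b3 + r * c = 0 → r = 0) :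
    IsLattice (gen3 (pt a a3) (pt b b3) (pt v c)) :=
  ⟨_, _, _, linearIndependent_triple hab h, rfl⟩

theorem isLattice_gen3_vertical {a b : Plane} {a3 b3 c : ℝ} (hab : cross a b ≠ 0) (hc : c ≠ 0) :
    IsLattice (gen3 (pt a a3) (pt b b3) (pt 0 c)) := by
  refine isLattice_gen3 hab fun s t r h h' => ?_
  rw [smul_zero, add_zero] at h
  have h4 := LinearIndependent.pair_iff.1 (linearIndependent_pair_iff.2 hab) _ _ h
  rw [h4.1, h4.2] at h'
  refine (mul_eq_zero.1 ?_).resolve_right hc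
  linarith

theorem cross_hh (m n m' n' : ℤ) : cross (hh m n) (hh m' n') = (m * n' - n * m') * (√3 / 8) := by
  simp [cross, hh]
  ring

theorem cross_h1_h2 : cross h1 h2 ≠ 0 := by
  rw [h1_eq, h2_eq, cross_hh]
  have := sqrt3_pos
  norm_num

theorem cross_comb (a b : Plane) (m n m' n' : ℤ) :
    cross (m • a + n • b) (m' • a + n' • b) = (m * n' - n * m') * cross a b := by
  simp only [← Int.cast_smul_eq_zsmul ℝ]
  simp [cross]
  ring

theorem Code.Valid.isLattice {k : Code} (hk : k.Valid) {c : ℝ} (hc : 0 < c) :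
    IsLattice (k.col.lattice c) := by
  rw [k.lattice_def]
  refine isLattice_gen3_vertical ?_ hc.ne'
  rw [cross_hh]
  refine mul_ne_zero ?_ (by have := sqrt3_pos; positivity)
  have := hk.2.1
  unfold Indep P at this
  exact_mod_cast this

/-- Heights are multiples of `c/2`, and such a height differs from its negative by a multiple of
`c`. -/
theorem Code.Valid.sigmaInv {k : Code} (hk : k.Valid) {c : ℝ} : SigmaInv (k.col.lattice c) := by
  intro z hz
  rw [← pt_eta z, Code.mem_lattice] at hz
  obtain ⟨m, n, l, h, h'⟩ := hz
  rw [← pt_eta z, sigma_pt, Code.mem_lattice]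
  rcases hk.1 with hs | hs <;> rw [hs] at h' ⊢
  · exact ⟨m, n, -l, h, by rw [h']; push_cast; ring⟩
  -- The negative of `m/2 + l` is `m/2 + (-m - l)`.
  · exact ⟨m, n, -m - l, h, by rw [h']; push_cast; ring⟩

/-- Every column occurs. -/
theorem Code.Valid.exists_has {k : Code} (hk : k.Valid) {c y1 : ℝ} (hc : 0 < c)
    (hy1 : y1 ∈ Set.Ico 0 c) : ∃ Γ : Subgroup Euc, IsCryst Γ ∧ k.col.Has Γ c y1 := by
  have hL := hk.isLattice hc
  rcases hv : k.v with _ | v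
  · refine ⟨translGroup (k.col.lattice c), ?_, Code.col_has_iff.2 ⟨hc, hy1, trans_translGroup _,
      Or.inl ⟨hv, transSigma_translGroup _⟩⟩⟩
    rwa [IsCryst, trans_translGroup]
  · have hw : pt (hh v.1 v.2) y1 + sigma (pt (hh v.1 v.2) y1) ∈ k.col.lattice c := by
      have := (hk.mem_lattice_int hc 0).2 ((hh_mem_lat hk.indep_R).2 (hk.2.2 v hv))
      rw [sigma_pt, pt_add, hh_add, ← two_mul, ← two_mul]
      convert this using 2
      simp
    refine ⟨glideGroup _ hk.sigmaInv _ hw, ?_, Code.col_has_iff.2 ⟨hc, hy1, trans_glideGroup _ _,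
      Or.inr ⟨v, hv, mem_transSigma_glideGroup _ hw⟩⟩⟩
    rwa [IsCryst, trans_glideGroup]

/-! ### Cases 1 and 2 -/

theorem zsmul_comb_inj {a b : Plane} (hab : cross a b ≠ 0) {m n m' n' : ℤ}
    (h : m • a + n • b = m' • a + n' • b) : m = m' ∧ n = n' := by
  have h1 : ((m - m' : ℤ) : ℝ) • a + ((n - n' : ℤ) : ℝ) • b = 0 := by
    rw [Int.cast_smul_eq_zsmul, Int.cast_smul_eq_zsmul, sub_smul, sub_smul]
    rw [← sub_eq_zero] at h
    rw [← h]
    abel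
  have h4 := LinearIndependent.pair_iff.1 (linearIndependent_pair_iff.2 hab) _ _ h1
  constructor
  · have := h4.1
    norm_cast at this
    omega
  · have := h4.2
    norm_cast at this
    omega

theorem Case1.isLattice {L : AddSubgroup Space} (h : Case1 L) : IsLattice L := by
  obtain ⟨c0, c, hc, -, rfl⟩ := h
  refine isLattice_gen3 cross_h1_h2 fun s t r _ h => ?_
  refine (mul_eq_zero.1 ?_).resolve_right hc
  linarith

theorem Case21.isLattice {L : AddSubgroup Space} {a3 b3 c : ℝ} (h : Case21 L a3 b3 c) :
    IsLattice L := by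
  obtain ⟨hc, -, -, rfl, -⟩ := h
  exact isLattice_gen3_vertical cross_h1_h2 hc.ne'

/-- The independent vectors `h1` and `h2` are integral combinations of `a` and `b`, and determinants
multiply. -/
theorem Case22.cross_ne_zero {L : AddSubgroup Space} {a b : Plane} {a3 b3 c : ℝ}
    (h : Case22 L a b a3 b3 c) : cross a b ≠ 0 := by
  obtain ⟨-, -, -, -, -, m1, m2, n1, n2, -, -, e1, e2⟩ := h
  have := cross_comb a b m1 m2 n1 n2
  rw [e1, e2] at this
  intro h0
  rw [h0, mul_zero] at this
  exact cross_h1_h2 this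

theorem Case22.isLattice {L : AddSubgroup Space} {a b : Plane} {a3 b3 c : ℝ}
    (h : Case22 L a b a3 b3 c) : IsLattice L := by
  have hab := h.cross_ne_zero
  obtain ⟨hc, -, -, rfl, -⟩ := h
  exact isLattice_gen3_vertical hab hc.ne'

theorem exists_cryst_of_isLattice {L : AddSubgroup Space} (hL : IsLattice L) :
    ∃ Γ : Subgroup Euc, IsCryst Γ ∧ trans Γ = L :=
  ⟨translGroup L, by rwa [IsCryst, trans_translGroup], trans_translGroup L⟩

theorem mem_gen3_vertical {a b x : Plane} {a3 b3 c y : ℝ} :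
    pt x y ∈ gen3 (pt a a3) (pt b b3) (pt 0 c) ↔
      ∃ m n l : ℤ, x = m • a + n • b ∧ y = m * a3 + n * b3 + l * c := by
  simp only [pt_mem_gen3, smul_zero, add_zero]

theorem vertical_mem_gen3 {a b : Plane} (hab : cross a b ≠ 0) {a3 b3 c z : ℝ} :
    pt 0 z ∈ gen3 (pt a a3) (pt b b3) (pt 0 c) ↔ ∃ n : ℤ, z = n * c := by
  rw [mem_gen3_vertical]
  constructor
  · rintro ⟨m, n, l, h, rfl⟩
    have h' : (0 : ℤ) • a + (0 : ℤ) • b = m • a + n • b := by rw [← h]; simp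
    obtain ⟨rfl, rfl⟩ := zsmul_comb_inj hab h'
    exact ⟨l, by simp⟩
  · rintro ⟨n, rfl⟩
    exact ⟨0, 0, n, by simp, by simp⟩

theorem projL_gen3 (a b : Plane) (a3 b3 c : ℝ) :
    projL (gen3 (pt a a3) (pt b b3) (pt 0 c)) = gen2 a b := by
  ext x
  rw [mem_projL, mem_gen2]
  simp only [mem_gen3_vertical]
  constructor
  · rintro ⟨y, m, n, l, h, -⟩
    exact ⟨m, n, h⟩
  · rintro ⟨m, n, h⟩
    exact ⟨_, m, n, 0, h, rfl⟩

theorem mem_restr0_gen3 {a b x : Plane} {a3 b3 c : ℝ} :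
    x ∈ restr0 (gen3 (pt a a3) (pt b b3) (pt 0 c)) ↔
      ∃ p ∈ modD a3 b3 c, x = p.1 • a + p.2 • b := by
  rw [mem_restr0, mem_gen3_vertical]
  constructor
  · rintro ⟨m, n, l, h, h'⟩
    exact ⟨(m, n), ⟨-l, by push_cast; linarith⟩, h⟩
  · rintro ⟨⟨m, n⟩, ⟨l, h'⟩, h⟩
    exact ⟨m, n, -l, h, by push_cast; linarith⟩

theorem eq_zero_of_mem_Ico {a c : ℝ} (ha : a ∈ Set.Ico 0 c) {k : ℤ} (h : a = k * c) : a = 0 := by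
  have hc : 0 < c := ha.1.trans_lt ha.2
  have h0 : (0 : ℝ) ≤ k := by
    by_contra hk
    push Not at hk
    nlinarith [ha.1]
  have h1 : (k : ℝ) < 1 := by
    by_contra hk
    push Not at hk
    nlinarith [ha.2]
  have h0' : 0 ≤ k := by exact_mod_cast h0
  have h1' : k < 1 := by exact_mod_cast h1
  have : k = 0 := by omega
  rw [h, this]
  simp

theorem modD_ne_top {a3 b3 c : ℝ} (ha : a3 ∈ Set.Ico 0 c) (hb : b3 ∈ Set.Ico 0 c)
    (hne : a3 ≠ 0 ∨ b3 ≠ 0) : ¬∀ m n : ℤ, (m, n) ∈ modD a3 b3 c := by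
  intro hD
  obtain ⟨k, hk⟩ := hD 1 0
  obtain ⟨l, hl⟩ := hD 0 1
  simp only [Int.cast_one, Int.cast_zero, one_mul, zero_mul, add_zero, zero_add] at hk hl
  exact hne.elim (fun h => h (eq_zero_of_mem_Ico ha hk)) (fun h => h (eq_zero_of_mem_Ico hb hl))

theorem sigmaInv_gen3 (a b : Plane) (c : ℝ) : SigmaInv (gen3 (pt a 0) (pt b 0) (pt 0 c)) := by
  intro z hz
  rw [← pt_eta z, mem_gen3_vertical] at hz
  obtain ⟨m, n, l, h, h'⟩ := hz
  rw [← pt_eta z, sigma_pt, mem_gen3_vertical]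
  exact ⟨m, n, -l, h, by rw [h']; push_cast; ring⟩

/-- In case 1 the group of periods is the hexagonal lattice for all widths. -/
theorem Case1.periods_eq {Γ : Subgroup Euc} (hΓ : IsCryst Γ) (h : Case1 (trans Γ)) {y0 : ℝ}
    (hy0 : 0 < y0) : periods Γ y0 = hexL := by
  obtain ⟨c0, c, hc, hn, hL⟩ := h
  have hmem : ∀ x y, pt x y ∈ trans Γ ↔ ∃ w ∈ hexL, ∃ l : ℤ, x = w + l • c0 ∧ y = l * c := by
    intro x y
    rw [hL, pt_mem_gen3]
    constructor
    · rintro ⟨m, n, l, h, h'⟩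
      exact ⟨_, mem_gen2.2 ⟨m, n, rfl⟩, l, h, by linarith⟩
    · rintro ⟨w, hw, l, rfl, rfl⟩
      obtain ⟨m, n, rfl⟩ := mem_gen2.1 hw
      exact ⟨m, n, l, rfl, by ring⟩
  -- Adding `(c0, c)` to its reflection would give `(2 c0, 0)`, contrary to the condition for the
  -- multiple `2`.
  have hσ : ¬SigmaInv (trans Γ) := by
    intro hs
    have h1 : pt c0 c ∈ trans Γ := (hmem _ _).2 ⟨0, zero_mem _, 1, by simp, by simp⟩
    have h2 := add_mem h1 (hs _ h1)
    rw [sigma_pt, pt_add] at h2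
    obtain ⟨w, hw, l, e, e'⟩ := (hmem _ _).1 h2
    have hl : l = 0 := by
      have : (l : ℝ) * c = 0 := by rw [← e']; ring
      exact_mod_cast (mul_eq_zero.1 this).resolve_right hc
    subst hl
    refine hn 2 two_ne_zero ?_
    rw [two_smul, e]
    simpa using hw
  -- A vertical lattice vector with coefficient `l` of the third generator puts `l c0` into the
  -- hexagonal lattice, so `l = 0` and its height is `0`.
  have hv : pt 0 y0 ∉ trans Γ := by
    intro h0
    obtain ⟨w, hw, l, e, e'⟩ := (hmem _ _).1 h0
    refine hn l ?_ ?_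
    · rintro rfl
      simp at e'
      exact hy0.ne' e'
    · rw [← neg_eq_of_add_eq_zero_right e.symm]
      exact neg_mem hw
  rw [(periods_of_transSigma_eq_empty hΓ (transSigma_eq_empty hσ) hy0).2 hv]
  ext x
  rw [mem_restr0, hmem]
  constructor
  · rintro ⟨w, hw, l, rfl, e'⟩
    have hl : l = 0 := by exact_mod_cast (mul_eq_zero.1 e'.symm).resolve_right hc
    subst hl
    simpa using hw
  · intro hx
    exact ⟨x, hx, 0, by simp, by simp⟩

/-- With both heights zero the lattice would be a product of a planar and a vertical one, hence
`σ`-invariant. If `ℛ₀(L)` were the whole hexagonal lattice, both heights would be multiples of `c`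
in `[0, c)`, hence zero. -/
theorem Case21.properties {L : AddSubgroup Space} {a3 b3 c : ℝ} (h : Case21 L a3 b3 c) :
    (a3 ≠ 0 ∨ b3 ≠ 0) ∧ restr0 L < hexL ∧
      (restr0 L : Set Plane) = {x | ∃ p ∈ modD a3 b3 c, x = p.1 • h1 + p.2 • h2} := by
  obtain ⟨hc, ha, hb, rfl, hσ⟩ := h
  have hne : a3 ≠ 0 ∨ b3 ≠ 0 := by
    by_contra hcon
    push Not at hcon
    rw [hcon.1, hcon.2] at hσ
    exact hσ (sigmaInv_gen3 _ _ _)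
  refine ⟨hne, lt_of_le_of_ne ?_ ?_, ?_⟩
  · intro x hx
    obtain ⟨p, -, rfl⟩ := mem_restr0_gen3.1 hx
    exact mem_gen2.2 ⟨_, _, rfl⟩
  · intro he
    have hD : ∀ m n : ℤ, (m, n) ∈ modD a3 b3 c := by
      intro m n
      have : m • h1 + n • h2 ∈ hexL := mem_gen2.2 ⟨_, _, rfl⟩
      rw [← he] at this
      obtain ⟨p, hp, e⟩ := mem_restr0_gen3.1 this
      obtain ⟨rfl, rfl⟩ := zsmul_comb_inj cross_h1_h2 e
      exact hp
    exact modD_ne_top ha hb hne hD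
  · ext x
    exact mem_restr0_gen3

/-- Equality would put every pair of integers into `D`, making both heights zero and the lattice
`σ`-invariant. -/
theorem Case22.hexL_lt {L : AddSubgroup Space} {a b : Plane} {a3 b3 c : ℝ}
    (h : Case22 L a b a3 b3 c) : hexL < gen2 a b := by
  have hab := h.cross_ne_zero
  obtain ⟨hc, ha, hb, rfl, hσ, m1, m2, n1, n2, hd, hD, e1, e2⟩ := h
  have hne : a3 ≠ 0 ∨ b3 ≠ 0 := by
    by_contra hcon
    push Not at hcon
    rw [hcon.1, hcon.2] at hσ
    exact hσ (sigmaInv_gen3 _ _ _)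
  refine lt_of_le_of_ne ?_ ?_
  · rw [hexL, gen2_le]
    exact ⟨mem_gen2.2 ⟨m1, m2, e1.symm⟩, mem_gen2.2 ⟨n1, n2, e2.symm⟩⟩
  · intro he
    refine modD_ne_top ha hb hne fun m n => ?_
    have : m • a + n • b ∈ hexL := he ▸ mem_gen2.2 ⟨m, n, rfl⟩
    obtain ⟨i, j, hij⟩ := mem_gen2.1 this
    rw [← e1, ← e2] at hij
    have e : i • (m1 • a + m2 • b) + j • (n1 • a + n2 • b) =
        (i * m1 + j * n1) • a + (i * m2 + j * n2) • b := by
      rw [smul_add, smul_add, add_smul, add_smul, mul_smul, mul_smul, mul_smul, mul_smul]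
      abel
    rw [e] at hij
    obtain ⟨rfl, rfl⟩ := zsmul_comb_inj hab hij
    rw [hD]
    have : i • (m1, m2) + j • (n1, n2) ∈ AddSubgroup.closure {(m1, m2), (n1, n2)} :=
      AddSubgroup.mem_closure_pair.2 ⟨i, j, rfl⟩
    simpa using this

theorem Case22.restr0_eq {L : AddSubgroup Space} {a b : Plane} {a3 b3 c : ℝ}
    (h : Case22 L a b a3 b3 c) : restr0 L = hexL := by
  have hab := h.cross_ne_zero
  obtain ⟨hc, ha, hb, rfl, hσ, m1, m2, n1, n2, hd, hD, e1, e2⟩ := h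
  have e : ∀ i j : ℤ, i • h1 + j • h2 = (i * m1 + j * n1) • a + (i * m2 + j * n2) • b := by
    intro i j
    rw [← e1, ← e2]
    rw [smul_add, smul_add, add_smul, add_smul, mul_smul, mul_smul, mul_smul, mul_smul]
    abel
  ext x
  rw [mem_restr0_gen3, hexL, mem_gen2, hD]
  constructor
  · rintro ⟨p, hp, rfl⟩
    obtain ⟨i, j, rfl⟩ := AddSubgroup.mem_closure_pair.1 hp
    exact ⟨i, j, by rw [e]; simp⟩
  · rintro ⟨i, j, rfl⟩
    exact ⟨_, AddSubgroup.mem_closure_pair.2 ⟨i, j, rfl⟩, by rw [e]; simp⟩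

/-! ### Hexagonal lattices and rectangular lattices of ratio `√3` -/

theorem norm_sq_plane (x : Plane) : ‖x‖ ^ 2 = x 0 ^ 2 + x 1 ^ 2 := by
  rw [EuclideanSpace.norm_sq_eq]
  simp [Fin.sum_univ_two]

theorem inner_plane (x y : Plane) : inner ℝ x y = x 0 * y 0 + x 1 * y 1 := by
  simp [PiLp.inner_apply, Fin.sum_univ_two]
  ring

theorem norm_sq_comb (u v : Plane) (m n : ℤ) : ‖m • u + n • v‖ ^ 2 =
    m ^ 2 * ‖u‖ ^ 2 + 2 * m * n * inner ℝ u v + n ^ 2 * ‖v‖ ^ 2 := by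
  simp only [← Int.cast_smul_eq_zsmul ℝ, norm_sq_plane, inner_plane]
  simp
  ring

theorem inner_comb (u v : Plane) (m n m' n' : ℤ) :
    inner ℝ (m • u + n • v) (m' • u + n' • v) =
      m * m' * ‖u‖ ^ 2 + (m * n' + n * m') * inner ℝ u v + n * n' * ‖v‖ ^ 2 := by
  simp only [← Int.cast_smul_eq_zsmul ℝ, norm_sq_plane, inner_plane]
  simp
  ring

theorem cross_sq (u v : Plane) : cross u v ^ 2 = ‖u‖ ^ 2 * ‖v‖ ^ 2 - inner ℝ u v ^ 2 := by
  simp only [norm_sq_plane, inner_plane, cross]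
  ring

/-- A rectangular lattice with sides of ratio `√3`. -/
def IsRect (M : AddSubgroup Plane) : Prop :=
  ∃ u v : Plane, u ≠ 0 ∧ inner ℝ u v = 0 ∧ ‖v‖ ^ 2 = 3 * ‖u‖ ^ 2 ∧ M = gen2 u v

/-- An integral change of basis has determinant `±1`. Comparing Gram determinants, the squared
length of a hexagonal generator would be `2‖u‖²`, but the form `m² + 3n²` does not represent `2`. -/
theorem IsRect.not_isHexagonal {M : AddSubgroup Plane} (h : IsRect M) : ¬IsHexagonal M := by
  rintro ⟨a, b, ha, hb, hab, hM⟩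
  obtain ⟨u, v, hu, huv, hv, hM'⟩ := h
  have hN : 0 < ‖u‖ ^ 2 := by positivity
  have hcr : cross u v ≠ 0 := by
    intro h0
    have := cross_sq u v
    rw [h0, huv, hv] at this
    nlinarith
  have h1 := left_mem_gen2 a b
  have h2 := right_mem_gen2 a b
  have h3 := left_mem_gen2 u v
  have h4 := right_mem_gen2 u v
  rw [← hM, hM'] at h1 h2
  rw [← hM', hM] at h3 h4
  obtain ⟨m, n, rfl⟩ := mem_gen2.1 h1
  obtain ⟨m', n', rfl⟩ := mem_gen2.1 h2
  obtain ⟨i, j, e3⟩ := mem_gen2.1 h3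
  obtain ⟨i', j', e4⟩ := mem_gen2.1 h4
  have c1 := cross_comb u v m n m' n'
  have c2 := cross_comb (m • u + n • v) (m' • u + n' • v) i j i' j'
  rw [← e3, ← e4, c1, ← mul_assoc] at c2
  have hdet : (i * j' - j * i') * (m * n' - n * m') = (1 : ℤ) := by
    have := mul_right_cancel₀ hcr (c2.symm.trans (one_mul _).symm)
    exact_mod_cast this
  have hdet2 : (m * n' - n * m') ^ 2 = (1 : ℤ) := by
    have := Int.isUnit_iff.1 (IsUnit.of_mul_eq_one (i * j' - j * i') ((mul_comm _ _).trans hdet))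
    rcases this with h | h <;> rw [h] <;> norm_num
  have hb2 : ‖m' • u + n' • v‖ ^ 2 = ‖m • u + n • v‖ ^ 2 := by rw [hb]
  rw [norm_sq_comb, norm_sq_comb, huv, hv] at hb2
  rw [inner_comb, norm_sq_comb, huv, hv] at hab
  have k1 : m' ^ 2 + 3 * n' ^ 2 = m ^ 2 + 3 * n ^ 2 := by
    have : ((m' : ℝ) ^ 2 + 3 * n' ^ 2) * ‖u‖ ^ 2 = (m ^ 2 + 3 * n ^ 2) * ‖u‖ ^ 2 := by linarith
    exact_mod_cast mul_right_cancel₀ hN.ne' this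
  have k2 : 2 * (m * m' + 3 * n * n') = m ^ 2 + 3 * n ^ 2 := by
    have : (2 * ((m : ℝ) * m' + 3 * n * n')) * ‖u‖ ^ 2 = (m ^ 2 + 3 * n ^ 2) * ‖u‖ ^ 2 := by
      linarith
    exact_mod_cast mul_right_cancel₀ hN.ne' this
  -- Write `Q = m² + 3n²`. The Gram determinant is `Q² - (Q/2)²` from the hexagonal basis and `3`
  -- from the rectangular one.
  have k3 : (m ^ 2 + 3 * n ^ 2) ^ 2 = 4 := by
    have e : (m ^ 2 + 3 * n ^ 2) * (m' ^ 2 + 3 * n' ^ 2) - (m * m' + 3 * n * n') ^ 2 =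
        3 * (m * n' - n * m') ^ 2 := by ring
    rw [hdet2, k1] at e
    have : 3 * (m ^ 2 + 3 * n ^ 2) ^ 2 = 12 := by
      rw [← k2] at e ⊢
      linarith
    linarith
  have k4 : m ^ 2 + 3 * n ^ 2 = 2 := by nlinarith [sq_nonneg m, sq_nonneg n]
  have hn : n = 0 := by
    by_contra hn
    have : 1 ≤ n ^ 2 := Int.one_le_abs (pow_ne_zero 2 hn) |>.trans (by rw [abs_of_nonneg (sq_nonneg n)])
    nlinarith [sq_nonneg m]
  rw [hn] at k4
  have hm : m ≤ 1 := by nlinarith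
  have hm' : -1 ≤ m := by nlinarith
  interval_cases m <;> norm_num at k4

/-- A rectangular lattice of ratio `√3` has no symmetry of order three. -/
theorem IsRect.not_threefold {M : AddSubgroup Plane} (h : IsRect M) {ρ : Plane ≃ₗᵢ[ℝ] Plane}
    (h1 : ρ ≠ 1) (h3 : ρ ^ 3 = 1) : ¬∀ p ∈ M, ρ p ∈ M := by
  intro hρ
  obtain ⟨u, v, hu, huv, hv, rfl⟩ := h
  have hN : 0 < ‖u‖ ^ 2 := by positivity
  -- An isometry of odd order cannot reverse a nonzero vector.
  have hneg : ∀ w, w ≠ 0 → ρ w ≠ -w := by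
    intro w hw he
    have h4 : (ρ ^ 3) w = -w := by
      change ρ (ρ (ρ w)) = -w
      rw [he, map_neg, he, neg_neg, he]
    rw [h3] at h4
    have h5 : w = -w := h4
    have h6 := add_eq_zero_iff_eq_neg.2 h5
    rw [← two_smul ℝ] at h6
    exact hw ((smul_eq_zero.1 h6).resolve_left two_ne_zero)
  obtain ⟨m, n, e⟩ := mem_gen2.1 (hρ u (left_mem_gen2 u v))
  -- The image of `u` has the same length, and `m² + 3n² = 1` leaves only `±u`.
  have k1 : m ^ 2 + 3 * n ^ 2 = 1 := by
    have := norm_sq_comb u v m n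
    rw [← e, ρ.norm_map, huv, hv] at this
    have : ((m : ℝ) ^ 2 + 3 * n ^ 2) * ‖u‖ ^ 2 = 1 * ‖u‖ ^ 2 := by linarith
    exact_mod_cast mul_right_cancel₀ hN.ne' this
  have hn : n = 0 := by
    by_contra hn
    have : 1 ≤ n ^ 2 := Int.one_le_abs (pow_ne_zero 2 hn) |>.trans (by rw [abs_of_nonneg (sq_nonneg n)])
    nlinarith [sq_nonneg m]
  subst hn
  have hm : m = 1 ∨ m = -1 := sq_eq_one_iff.1 (by linarith)
  rcases hm with rfl | rfl
  swap
  · exact hneg u hu (by rw [e]; simp)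
  have eu : ρ u = u := by rw [e]; simp
  obtain ⟨m, n, e'⟩ := mem_gen2.1 (hρ v (right_mem_gen2 u v))
  -- As `u` is fixed, the image of `v` is still orthogonal to `u`, hence equal to `±v`. With both
  -- vectors fixed, `ρ` is the identity.
  have k2 : m = 0 := by
    have h4 := inner_comb u v 1 0 m n
    have h5 := ρ.inner_map_map u v
    rw [eu, e', huv] at h5
    simp only [one_smul, zero_smul, add_zero] at h4
    rw [h5, huv] at h4
    push_cast at h4
    have : (m : ℝ) * ‖u‖ ^ 2 = 0 := by linarith
    exact_mod_cast (mul_eq_zero.1 this).resolve_right hN.ne'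
  subst k2
  have k3 : n ^ 2 = 1 := by
    have := norm_sq_comb u v 0 n
    rw [← e', ρ.norm_map, huv, hv] at this
    have : ((n : ℝ) ^ 2) * ‖u‖ ^ 2 = 1 * ‖u‖ ^ 2 := by push_cast at this; linarith
    exact_mod_cast mul_right_cancel₀ hN.ne' this
  have hv0 : v ≠ 0 := by
    rintro rfl
    rw [norm_zero] at hv
    nlinarith
  rcases sq_eq_one_iff.1 k3 with rfl | rfl
  swap
  · exact hneg v hv0 (by rw [e']; simp)
  have ev : ρ v = v := by rw [e']; simp
  refine h1 ?_
  have hli : LinearIndependent ℝ ![u, v] := by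
    rw [linearIndependent_pair_iff]
    intro h0
    have := cross_sq u v
    rw [h0, huv, hv] at this
    nlinarith
  let b := basisOfLinearIndependentOfCardEqFinrank hli (by simp)
  have : ρ.toLinearEquiv.toLinearMap = LinearMap.id := by
    refine b.ext fun i => ?_
    rw [coe_basisOfLinearIndependentOfCardEqFinrank]
    fin_cases i
    exacts [eu, ev]
  ext1 x
  exact LinearMap.congr_fun this x

theorem norm_sq_hh (m n : ℤ) : ‖hh m n‖ ^ 2 = (m ^ 2 + m * n + n ^ 2) / 4 := by
  rw [norm_sq_plane]
  simp [hh]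
  linear_combination (n : ℝ) ^ 2 / 16 * sqrt3_sq

theorem inner_hh (m n m' n' : ℤ) : inner ℝ (hh m n) (hh m' n') =
    (2 * m * m' + m * n' + n * m' + 2 * n * n') / 8 := by
  rw [inner_plane]
  simp [hh]
  linear_combination (n : ℝ) * n' / 16 * sqrt3_sq

/-- The generators are orthogonal with lengths of ratio `√3`. -/
def RectD (u : ℤ × ℤ × ℤ × ℤ) : Prop :=
  u.1 ^ 2 + u.1 * u.2.1 + u.2.1 ^ 2 ≠ 0 ∧
  2 * u.1 * u.2.2.1 + u.1 * u.2.2.2 + u.2.1 * u.2.2.1 + 2 * u.2.1 * u.2.2.2 = 0 ∧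
  u.2.2.1 ^ 2 + u.2.2.1 * u.2.2.2 + u.2.2.2 ^ 2 = 3 * (u.1 ^ 2 + u.1 * u.2.1 + u.2.1 ^ 2)

theorem RectD.isRect {u : ℤ × ℤ × ℤ × ℤ} (h : RectD u) : IsRect (lat u) := by
  obtain ⟨a, b, a', b'⟩ := u
  obtain ⟨h0, h1, h2⟩ := h
  simp only at h0 h1 h2
  refine ⟨hh a b, hh a' b', ?_, ?_, ?_, rfl⟩
  · intro h
    have := norm_sq_hh a b
    rw [h, norm_zero] at this
    have h3 : ((a ^ 2 + a * b + b ^ 2 : ℤ) : ℝ) = 0 := by push_cast; linarith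
    exact h0 (by exact_mod_cast h3)
  · rw [inner_hh]
    have : ((2 * a * a' + a * b' + b * a' + 2 * b * b' : ℤ) : ℝ) = 0 := by rw [h1]; simp
    push_cast at this
    rw [this, zero_div]
  · rw [norm_sq_hh, norm_sq_hh]
    have : ((a' ^ 2 + a' * b' + b' ^ 2 : ℤ) : ℝ) = (3 * (a ^ 2 + a * b + b ^ 2) : ℤ) := by
      rw [h2]
    push_cast at this
    rw [this]
    ring

/-- The alternatives match the widths that are guaranteed to exist: `A` and the generic set are
never empty, but `B \ A` or `C \ A` can be, and therefore `B` and `C` are needed together. -/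
theorem codes_rect : ∀ k ∈ codes,
    (k.P = (2, 0, 0, 2) ∧ k.s = 0 ∧ (k.v = none ∨ k.v = some (0, 0))) ∨
      RectD k.A ∨ RectD k.O ∨ (RectD k.B ∧ RectD k.C) := by
  refine forall_mem_codes ?_
  simp only [codes, List.Forall, Code.P, RectD]
  norm_num

/-- Apart from the columns of constant type, some width gives a rectangular lattice. -/
theorem Code.exists_isRect {Γ : Subgroup Euc} (hΓ : IsCryst Γ) {k : Code} (hk : k.Valid)
    (ht : k.Table) {c y1 : ℝ} (h : k.col.Has Γ c y1)
    (hr : RectD k.A ∨ RectD k.O ∨ (RectD k.B ∧ RectD k.C)) :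
    ∃ y0, 0 < y0 ∧ IsRect (periods Γ y0) := by
  have hT := Code.periodTable hΓ hk ht h
  obtain ⟨hc, hy1, -⟩ := h
  have hfrac : ∀ {m n : ℤ} (l : ℤ), (m : ℝ) / n * c = l * c → n ≠ 0 → m = l * n := by
    intro m n l h hn
    have h' := mul_right_cancel₀ hc.ne' h
    have hn' : (n : ℝ) ≠ 0 := by exact_mod_cast hn
    rw [div_eq_iff hn'] at h'
    exact_mod_cast h'
  rcases hr with hr | hr | ⟨hB, hC⟩
  · refine ⟨c, hc, ?_⟩
    rw [(hT c hc).1 ⟨hc, 1, by simp⟩]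
    exact hr.isRect
  · have key : ∀ y0, 0 < y0 → y0 ∉ widths 0 c → y0 ∉ widths y1 c → y0 ∉ widths (y1 + c / 2) c →
        ∃ y0, 0 < y0 ∧ IsRect (periods Γ y0) := by
      intro y0 h0 hA hB hC
      refine ⟨y0, h0, ?_⟩
      rw [(hT y0 h0).2.2.2 (by rintro ((h | h) | h); exacts [hA h, hB h, hC h])]
      exact hr.isRect
    -- Of the widths `c/5` and `2c/5` at least one is generic: neither is in `A`, and both cannot be
    -- in `B ∪ C`, because their difference is no multiple of `c/2`.
    have k1 : (1 : ℤ) / (5 : ℤ) * c ∉ widths 0 c := by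
      rintro ⟨-, n, h⟩
      rw [zero_add] at h
      have := hfrac n h (by norm_num)
      omega
    have k2 : (2 : ℤ) / (5 : ℤ) * c ∉ widths 0 c := by
      rintro ⟨-, n, h⟩
      rw [zero_add] at h
      have := hfrac n h (by norm_num)
      omega
    have hhalf : ∀ y0, y0 ∈ widths y1 c ∨ y0 ∈ widths (y1 + c / 2) c →
        ∃ n : ℤ, y0 = y1 + n / 2 * c := by
      rintro y0 (⟨-, n, h⟩ | ⟨-, n, h⟩)
      · exact ⟨2 * n, by rw [h]; push_cast; ring⟩
      · exact ⟨2 * n + 1, by rw [h]; push_cast; ring⟩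
    by_cases h1 : (1 : ℤ) / (5 : ℤ) * c ∈ widths y1 c ∨ (1 : ℤ) / (5 : ℤ) * c ∈ widths (y1 + c / 2) c
    · by_cases h2 : (2 : ℤ) / (5 : ℤ) * c ∈ widths y1 c ∨
          (2 : ℤ) / (5 : ℤ) * c ∈ widths (y1 + c / 2) c
      · obtain ⟨n, hn⟩ := hhalf _ h1
        obtain ⟨m, hm⟩ := hhalf _ h2
        exfalso
        have : (2 : ℤ) / (5 : ℤ) * c = (m - n : ℤ) * c := by
          push_cast at *
          linarith
        have := hfrac _ this (by norm_num)
        omega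
      · push Not at h2
        exact key _ (by positivity) k2 h2.1 h2.2
    · push Not at h1
      exact key _ (by positivity) k1 h1.1 h1.2
  -- For `y1 = 0` the set `B \ A` is empty and `c/2` lies in `C \ A`; otherwise `y1` itself lies in
  -- `B \ A`.
  · rcases hy1.1.eq_or_lt with h0 | h0
    · refine ⟨c / 2, by positivity, ?_⟩
      rw [(hT (c / 2) (by positivity)).2.2.1 ⟨⟨by positivity, 0, by rw [← h0]; simp⟩, ?_⟩]
      · exact hC.isRect
      · rintro ⟨-, n, h⟩
        rw [zero_add] at h
        have := hfrac (m := 1) (n := 2) n (by rw [← h]; push_cast; ring) (by norm_num)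
        omega
    · refine ⟨y1, h0, ?_⟩
      rw [(hT y1 h0).2.1 ⟨⟨h0, 0, by simp⟩, ?_⟩]
      · exact hB.isRect
      · rintro ⟨-, n, h⟩
        rw [zero_add] at h
        exact h0.ne' (eq_zero_of_mem_Ico hy1 h)

theorem IsRect.of_conjPlus {Γ : Subgroup Euc} (hΓ : IsCryst Γ) {α : Plane ≃ₗᵢ[ℝ] Plane} {y0 : ℝ}
    (hy0 : 0 < y0) (h : IsRect (periods (conjPlus α Γ) y0)) : IsRect (periods Γ y0) := by
  obtain ⟨u, v, hu, huv, hv, hM⟩ := h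
  refine ⟨α.symm u, α.symm v, ?_, ?_, ?_, ?_⟩
  · simpa using hu
  · rw [α.symm.inner_map_map, huv]
  · rw [α.symm.norm_map, α.symm.norm_map, hv]
  · ext p
    rw [← mem_periods_conjPlus hΓ α hy0, hM, mem_gen2, mem_gen2]
    refine exists_congr fun m => exists_congr fun n => ?_
    rw [← map_zsmul, ← map_zsmul, ← map_add, LinearIsometryEquiv.eq_symm_apply]

/-! ### Columns of constant type -/

/-- The lattice is the product of the standard hexagonal lattice and `cℤ`. -/
theorem mem_hexagonal_prism {c : ℝ} {p : Plane} {z : ℝ} :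
    pt p z ∈ gen3 (pt h1 0) (pt h2 0) (pt 0 c) ↔ p ∈ hexL ∧ ∃ n : ℤ, z = n * c := by
  rw [mem_gen3_vertical, hexL, mem_gen2]
  constructor
  · rintro ⟨m, n, l, rfl, rfl⟩
    exact ⟨⟨m, n, rfl⟩, l, by simp⟩
  · rintro ⟨⟨m, n, rfl⟩, l, rfl⟩
    exact ⟨m, n, l, rfl, by simp⟩

theorem trans_eq_prism_of_conjPlus {Γ : Subgroup Euc} {α : Plane ≃ₗᵢ[ℝ] Plane} (hα : HolHex α)
    {c : ℝ} (h : trans (conjPlus α Γ) = gen3 (pt h1 0) (pt h2 0) (pt 0 c)) :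
    trans Γ = gen3 (pt h1 0) (pt h2 0) (pt 0 c) := by
  ext z
  rw [← pt_eta z, ← mem_trans_conjPlus (α := α), h, mem_hexagonal_prism, mem_hexagonal_prism, hα]

/-- These two columns are unchanged by the holohedry: the prism over the hexagonal lattice is
preserved, and so is the glide vector `0`. The conjugation can be dropped. -/
theorem Code.constant_of_conjPlus {Γ : Subgroup Euc} {α : Plane ≃ₗᵢ[ℝ] Plane} (hα : HolHex α)
    {k : Code} {c y1 : ℝ} (h : k.col.Has (conjPlus α Γ) c y1)
    (hP : k.P = (2, 0, 0, 2)) (hs : k.s = 0) (hv : k.v = none ∨ k.v = some (0, 0)) :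
    trans Γ = gen3 (pt h1 0) (pt h2 0) (pt 0 c) ∧ 0 < c ∧
      (col31.Has Γ c y1 ∨ col41a.Has Γ c y1) := by
  obtain ⟨hc, hy1, hL, hg⟩ := Code.col_has_iff.1 h
  have hL' : trans Γ = gen3 (pt h1 0) (pt h2 0) (pt 0 c) := by
    refine trans_eq_prism_of_conjPlus hα ?_
    rw [hL, k.lattice_def, hs]
    simp only [P, Prod.mk.injEq] at hP
    rw [hP.1, hP.2.1, hP.2.2.1, hP.2.2.2, h1_eq, h2_eq]
    simp
  have hlat : trans Γ = gen3 (pt h1 (0 * c)) (pt h2 0) (pt 0 c) := by rw [hL', zero_mul]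
  refine ⟨hL', hc, ?_⟩
  rcases hv with hv | hv <;> rw [hv] at hg
  · refine Or.inl ⟨hc, hy1, hlat, ?_⟩
    have he : transSigma (conjPlus α Γ) = ∅ := by simpa using hg
    change transSigma Γ = ∅
    rw [Set.eq_empty_iff_forall_notMem] at he ⊢
    intro w hw
    rw [← pt_eta w, ← mem_transSigma_conjPlus (α := α)] at hw
    exact he _ hw
  · refine Or.inr ⟨hc, hy1, hlat, ?_⟩
    change pt 0 y1 ∈ transSigma Γ
    rw [← mem_transSigma_conjPlus (α := α), map_zero]
    simpa [hh_zero] using hg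

/-- Conjugating the shift by `p` with the symmetry gives the shift by `ρ p`. -/
theorem isProjSymm_periods {Γ : Subgroup Euc} {y0 : ℝ} {v : Plane} {ρ : Plane ≃ₗᵢ[ℝ] Plane}
    (h : IsProjSymm Γ y0 v ρ) : ∀ p ∈ periods Γ y0, ρ p ∈ periods Γ y0 := by
  intro p hp f hf x
  obtain ⟨w, rfl⟩ : ∃ w, x = v + ρ w := ⟨ρ.symm (x - v), by simp⟩
  rw [h f hf, add_assoc, ← map_add, h f hf, hp f hf]

/-! ### Rotations and reflections of the plane -/

/-- The rotation with cosine `c` and sine `s`. -/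
def rot (c s : ℝ) (h : c ^ 2 + s ^ 2 = 1) : Plane ≃ₗᵢ[ℝ] Plane where
  toFun x := !₂[c * x 0 - s * x 1, s * x 0 + c * x 1]
  invFun x := !₂[c * x 0 + s * x 1, -s * x 0 + c * x 1]
  map_add' x y := by apply plane_ext <;> simp <;> ring
  map_smul' r x := by apply plane_ext <;> simp <;> ring
  left_inv x := by
    apply plane_ext <;> simp
    · linear_combination x 0 * h
    · linear_combination x 1 * h
  right_inv x := by
    apply plane_ext <;> simp
    · linear_combination x 0 * h
    · linear_combination x 1 * h
  norm_map' x := by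
    refine (sq_eq_sq₀ (norm_nonneg _) (norm_nonneg _)).1 ?_
    rw [norm_sq_plane, norm_sq_plane]
    simp
    linear_combination (x 0 ^ 2 + x 1 ^ 2) * h

/-- The reflection `x ↦ (c x₀ + s x₁, s x₀ - c x₁)`. -/
def mirror (c s : ℝ) (h : c ^ 2 + s ^ 2 = 1) : Plane ≃ₗᵢ[ℝ] Plane where
  toFun x := !₂[c * x 0 + s * x 1, s * x 0 - c * x 1]
  invFun x := !₂[c * x 0 + s * x 1, s * x 0 - c * x 1]
  map_add' x y := by apply plane_ext <;> simp <;> ring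
  map_smul' r x := by apply plane_ext <;> simp <;> ring
  left_inv x := by
    apply plane_ext <;> simp
    · linear_combination x 0 * h
    · linear_combination x 1 * h
  right_inv x := by
    apply plane_ext <;> simp
    · linear_combination x 0 * h
    · linear_combination x 1 * h
  norm_map' x := by
    refine (sq_eq_sq₀ (norm_nonneg _) (norm_nonneg _)).1 ?_
    rw [norm_sq_plane, norm_sq_plane]
    simp
    linear_combination (x 0 ^ 2 + x 1 ^ 2) * h

theorem rot_apply (c s : ℝ) (h : c ^ 2 + s ^ 2 = 1) (x : Plane) :
    rot c s h x = !₂[c * x 0 - s * x 1, s * x 0 + c * x 1] := rfl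

theorem mirror_apply (c s : ℝ) (h : c ^ 2 + s ^ 2 = 1) (x : Plane) :
    mirror c s h x = !₂[c * x 0 + s * x 1, s * x 0 - c * x 1] := rfl

/-- The rotation of order three. -/
noncomputable def rot3 : Plane ≃ₗᵢ[ℝ] Plane :=
  rot (-(1 / 2)) (√3 / 2) (by linear_combination (1 / 4 : ℝ) * sqrt3_sq)

theorem rot3_apply (x : Plane) :
    rot3 x = !₂[-(1 / 2) * x 0 - √3 / 2 * x 1, √3 / 2 * x 0 + -(1 / 2) * x 1] := rfl

theorem rot3_cube (x : Plane) : rot3 (rot3 (rot3 x)) = x := by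
  simp only [rot3_apply]
  apply plane_ext <;> simp
  · linear_combination (3 / 8 * x 0 + √3 / 8 * x 1) * sqrt3_sq
  · linear_combination (3 / 8 * x 1 - √3 / 8 * x 0) * sqrt3_sq

theorem plus_rot3_cube : plus rot3 ^ 3 = 1 := by
  ext1 z
  change plus rot3 (plus rot3 (plus rot3 z)) = z
  rw [← pt_eta z, plus_pt, plus_pt, plus_pt, rot3_cube]

/-! ### Rhombohedral and cubic lattices -/

/-- The short vector `(1/2, √3/6)` and its images under the rotation of order three. -/
noncomputable def g0 : Plane := !₂[1 / 2, √3 / 6]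
/-- The image of `g0` under the rotation of order three. -/
noncomputable def g1 : Plane := !₂[-(1 / 2), √3 / 6]
/-- The second image of `g0` under the rotation of order three. -/
noncomputable def g2 : Plane := !₂[0, -(√3 / 3)]

theorem rot3_g0 : rot3 g0 = g1 := by
  rw [rot3_apply]
  apply plane_ext <;> simp [g0, g1]
  · linear_combination (-1 / 12 : ℝ) * sqrt3_sq
  · ring

theorem rot3_g1 : rot3 g1 = g2 := by
  rw [rot3_apply]
  apply plane_ext <;> simp [g1, g2]
  · linear_combination (-1 / 12 : ℝ) * sqrt3_sq
  · ring

theorem g_sum : g0 + g1 + g2 = 0 := by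
  apply plane_ext <;> simp [g0, g1, g2]
  ring

theorem h1_eq_g : h1 = g0 - g1 := by
  apply plane_ext <;> simp [g0, g1, h1]
  norm_num

theorem h2_eq_g : h2 = g0 - g2 := by
  apply plane_ext <;> simp [g0, g2, h2]
  ring

theorem rot3_h1 : rot3 h1 = h2 - h1 := by
  rw [h1_eq_g, map_sub, rot3_g0, rot3_g1, h2_eq_g]
  abel

theorem rot3_h2 : rot3 h2 = -h1 := by
  have h3 : rot3 g2 = g0 := by rw [← rot3_g1, ← rot3_g0, rot3_cube]
  rw [h2_eq_g, map_sub, rot3_g0, h3, h1_eq_g]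
  abel

theorem rhombA_eq (c : ℝ) : rhombA c = gen3 (pt h1 (c / 3)) (pt (-h2) (c / 3)) (pt 0 c) := by
  have : !₂[-(1 / 2 : ℝ), -(√3 / 2)] = -h2 := by apply plane_ext <;> simp [h2]
  rw [rhombA, this]
  rfl

theorem rhombB_eq (c : ℝ) : rhombB c = gen3 (pt h1 0) (pt g0 (-(c / 3))) (pt 0 c) := rfl

/-- As `g0 + g1 + g2 = 0`, the three orbit vectors add up to a vertical one, while the difference of
the first two is `(h1, 0)`. -/
theorem rhombB_eq_orbit (c : ℝ) :
    rhombB c = gen3 (pt g0 (-(c / 3))) (pt g1 (-(c / 3))) (pt g2 (-(c / 3))) := by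
  rw [rhombB_eq]
  have e1 : pt h1 0 = pt g0 (-(c / 3)) - pt g1 (-(c / 3)) := by
    rw [pt_sub, ← h1_eq_g, sub_self]
  have e2 : pt 0 c = -(pt g0 (-(c / 3)) + pt g1 (-(c / 3)) + pt g2 (-(c / 3))) := by
    rw [pt_add, pt_add, g_sum, pt_neg, neg_zero]
    congr 1
    ring
  apply le_antisymm <;> rw [gen3_le]
  · obtain ⟨m0, m1, m2⟩ := gen3_le.1 (le_refl
      (gen3 (pt g0 (-(c / 3))) (pt g1 (-(c / 3))) (pt g2 (-(c / 3)))))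
    rw [e1, e2]
    exact ⟨sub_mem m0 m1, m0, neg_mem (add_mem (add_mem m0 m1) m2)⟩
  · obtain ⟨m0, m1, m2⟩ := gen3_le.1 (le_refl (gen3 (pt h1 0) (pt g0 (-(c / 3))) (pt 0 c)))
    have m3 := sub_mem m1 m0
    have m4 := neg_mem (add_mem (add_mem m1 m3) m2)
    refine ⟨m1, ?_, ?_⟩
    · convert m3 using 1
      rw [e1]
      abel
    · convert m4 using 1
      rw [e2, e1]
      abel

theorem isRhombohedral_rhombB {c : ℝ} (hc : c ≠ 0) : IsRhombohedral (rhombB c) := by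
  refine ⟨plus rot3, pt g0 (-(c / 3)), plus_rot3_cube, ?_, ?_⟩ <;>
    rw [plus_pt, plus_pt, rot3_g0, rot3_g1]
  · refine linearIndependent_triple ?_ fun s t r h h' => ?_
    · simp [cross, g0, g1]
      have := sqrt3_pos
      intro h
      linarith
    · have h0 := congrArg (fun x : Plane => x 0) h
      have h1 := congrArg (fun x : Plane => x 1) h
      simp [g0, g1, g2] at h0 h1
      have e1 : (s + t - 2 * r) * √3 = 0 := by linarith
      have e2 : (s + t + r) * c = 0 := by linarith
      have := (mul_eq_zero.1 e1).resolve_right sqrt3_pos.ne'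
      have := (mul_eq_zero.1 e2).resolve_right hc
      linarith
  · exact rhombB_eq_orbit c

/-- The rotation takes `h1` to `h2 - h1` and then to `-h2`. These vectors add up to zero, so the sum
of the three lifted vectors is `(0, c)`. -/
theorem isRhombohedral_rhombA {c : ℝ} (hc : c ≠ 0) : IsRhombohedral (rhombA c) := by
  have e : rot3 (h2 - h1) = -h2 := by
    rw [map_sub, rot3_h1, rot3_h2]
    abel
  refine ⟨plus rot3, pt h1 (c / 3), plus_rot3_cube, ?_, ?_⟩ <;>
    rw [plus_pt, plus_pt, rot3_h1, e]
  · refine linearIndependent_triple ?_ fun s t r h h' => ?_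
    · simp [cross, h1, h2]
    · have h0 := congrArg (fun x : Plane => x 0) h
      have h1 := congrArg (fun x : Plane => x 1) h
      simp [h2, ProjPer.h1] at h0 h1
      have e1 : (t - r) * √3 = 0 := by linarith
      have e2 : (s + t + r) * c = 0 := by linarith
      have := (mul_eq_zero.1 e1).resolve_right sqrt3_pos.ne'
      have := (mul_eq_zero.1 e2).resolve_right hc
      linarith
  · rw [rhombA_eq]
    have e1 : pt 0 c = pt h1 (c / 3) + pt (h2 - h1) (c / 3) + pt (-h2) (c / 3) := by
      rw [pt_add, pt_add, pt_inj]
      exact ⟨by abel, by ring⟩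
    apply le_antisymm <;> rw [gen3_le]
    · obtain ⟨m0, m1, m2⟩ := gen3_le.1 (le_refl
        (gen3 (pt h1 (c / 3)) (pt (h2 - h1) (c / 3)) (pt (-h2) (c / 3))))
      rw [e1]
      exact ⟨m0, m2, add_mem (add_mem m0 m1) m2⟩
    · obtain ⟨m0, m1, m2⟩ := gen3_le.1 (le_refl (gen3 (pt h1 (c / 3)) (pt (-h2) (c / 3)) (pt 0 c)))
      refine ⟨m0, ?_, m1⟩
      convert sub_mem (sub_mem m2 m0) m1 using 1
      rw [e1]
      abel

theorem cross_h1_g0 : cross h1 g0 ≠ 0 := by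
  simp [cross, h1, g0]

theorem cross_h1_neg_h2 : cross h1 (-h2) ≠ 0 := by
  simp [cross, h1, h2]

/-- The vector minus its reflection would be vertical of height `±2c/3`, which is not a multiple of
`c`. -/
theorem not_sigmaInv_of_third {a b v : Plane} (hab : cross a b ≠ 0) {a3 b3 c z : ℝ} (hc : c ≠ 0)
    (h : pt v z ∈ gen3 (pt a a3) (pt b b3) (pt 0 c)) (hz : 3 * z = c ∨ 3 * z = -c) :
    ¬SigmaInv (gen3 (pt a a3) (pt b b3) (pt 0 c)) := by
  intro hσ
  have h2 := sub_mem h (hσ _ h)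
  rw [sigma_pt, pt_sub, sub_self, vertical_mem_gen3 hab] at h2
  obtain ⟨n, hn⟩ := h2
  have h3 : ((3 * n : ℤ) : ℝ) * c = (2 : ℤ) * c ∨ ((3 * n : ℤ) : ℝ) * c = (-2 : ℤ) * c := by
    refine hz.imp ?_ ?_ <;> intro hz <;> push_cast <;> linarith
  rcases h3 with h3 | h3
  · have := mul_right_cancel₀ hc h3
    norm_cast at this
    omega
  · have := mul_right_cancel₀ hc h3
    norm_cast at this
    omega

theorem projectsTo_of {a b : Plane} {a3 b3 c : ℝ} {P R : AddSubgroup Plane} (hab : cross a b ≠ 0)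
    (hσ : ¬SigmaInv (gen3 (pt a a3) (pt b b3) (pt 0 c)))
    (hP : gen2 a b = P) (hR : restr0 (gen3 (pt a a3) (pt b b3) (pt 0 c)) = R) :
    ProjectsTo (gen3 (pt a a3) (pt b b3) (pt 0 c)) c P R := by
  refine ⟨hσ, ?_, hR, fun Γ hΓ hL y0 hy0 => ?_⟩
  · rw [projL_gen3, hP]
  · rw [← hL] at hσ
    have := periods_of_not_sigmaInv hΓ (fun z => by rw [hL]; exact vertical_mem_gen3 hab) hσ hy0
    rwa [hL, projL_gen3, hP, hR] at this

theorem third_mem_iff {m c : ℝ} (hc : c ≠ 0) : (∃ k : ℤ, m * (c / 3) = k * c) ↔ ∃ k : ℤ, m = 3 * k := by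
  refine exists_congr fun k => ⟨fun h => ?_, fun h => ?_⟩
  · refine mul_right_cancel₀ hc ?_
    linarith
  · rw [h]
    ring

theorem projectsTo_rhombA {c : ℝ} (hc : c ≠ 0) : ProjectsTo (rhombA c) c hexL smallHex := by
  rw [rhombA_eq]
  refine projectsTo_of cross_h1_neg_h2 ?_ ?_ ?_
  · exact not_sigmaInv_of_third cross_h1_neg_h2 hc (gen3_le.1 le_rfl).1 (Or.inl (by ring))
  · ext x
    rw [hexL, mem_gen2, mem_gen2]
    refine exists_congr fun m => ⟨?_, ?_⟩ <;>
    · rintro ⟨n, rfl⟩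
      exact ⟨-n, by simp⟩
  · have e1 : !₂[(3 / 2 : ℝ), √3 / 2] = h1 + h2 := by
      apply plane_ext <;> simp [h1, h2]
      norm_num
    have e2 : !₂[(3 / 2 : ℝ), -(√3 / 2)] = h1 + h1 - h2 := by
      apply plane_ext <;> simp [h1, h2]
      norm_num
    ext x
    rw [mem_restr0_gen3, smallHex, e1, e2, mem_gen2]
    have hD : ∀ m n : ℤ, (m, n) ∈ modD (c / 3) (c / 3) c ↔ ∃ k : ℤ, m + n = 3 * k := by
      intro m n
      have : (m, n) ∈ modD (c / 3) (c / 3) c ↔ ∃ k : ℤ, ((m : ℝ) + n) * (c / 3) = k * c := by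
        simp only [add_mul]
        rfl
      rw [this, third_mem_iff hc]
      refine exists_congr fun k => ?_
      norm_cast
    constructor
    · rintro ⟨⟨m, n⟩, hp, rfl⟩
      obtain ⟨k, hk⟩ := (hD m n).1 hp
      obtain rfl : n = 3 * k - m := by omega
      -- Solves `m h1 - n h2 = i (h1 + h2) + j (2 h1 - h2)`: here `m + n = 3j` and `i = m - 2j`.
      refine ⟨m - 2 * k, k, ?_⟩
      simp only
      module
    · rintro ⟨i, j, rfl⟩
      refine ⟨(i + 2 * j, j - i), (hD _ _).2 ⟨j, by ring⟩, ?_⟩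
      simp only
      module

theorem mem_modD_third {c d : ℝ} (hc : c ≠ 0) (hd : d = c / 3 ∨ d = -(c / 3)) {m n : ℤ} :
    (m, n) ∈ modD 0 d c ↔ ∃ k : ℤ, n = 3 * k := by
  have h1 : (m, n) ∈ modD 0 d c ↔ ∃ k : ℤ, (m : ℝ) * 0 + n * d = k * c := Iff.rfl
  rw [h1]
  simp only [mul_zero, zero_add]
  rcases hd with rfl | rfl
  · rw [third_mem_iff hc]
    refine exists_congr fun k => ?_
    norm_cast
  · have : (∃ k : ℤ, (n : ℝ) * -(c / 3) = k * c) ↔ ∃ k : ℤ, (-n : ℝ) * (c / 3) = k * c := by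
      refine exists_congr fun k => ?_
      rw [mul_neg, neg_mul]
    rw [this, third_mem_iff hc]
    constructor <;> rintro ⟨k, hk⟩
    · exact ⟨-k, by have : -n = 3 * k := by exact_mod_cast hk
                    omega⟩
    · exact ⟨-k, by rw [hk]; push_cast; ring⟩

theorem modD_third {c d : ℝ} (hc : c ≠ 0) (hd : d = c / 3 ∨ d = -(c / 3)) :
    modD 0 d c = AddSubgroup.closure {(0, 3), (1, 3)} := by
  ext ⟨m, n⟩
  rw [mem_modD_third hc hd, AddSubgroup.mem_closure_pair]
  constructor
  · rintro ⟨k, rfl⟩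
    exact ⟨k - m, m, by simp; ring⟩
  · rintro ⟨i, j, h⟩
    simp at h
    exact ⟨i + j, by linarith [h.2]⟩

theorem modD_one_one_three : modD 1 1 3 = AddSubgroup.closure {(2, 1), (1, 2)} := by
  ext ⟨m, n⟩
  rw [AddSubgroup.mem_closure_pair]
  have h1 : (m, n) ∈ modD 1 1 3 ↔ ∃ k : ℤ, (m : ℝ) * 1 + n * 1 = k * 3 := Iff.rfl
  rw [h1]
  constructor
  · rintro ⟨k, hk⟩
    have : m + n = k * 3 := by
      rw [mul_one, mul_one] at hk
      exact_mod_cast hk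
    exact ⟨m - k, n - k, by simp; omega⟩
  · rintro ⟨i, j, h⟩
    simp at h
    refine ⟨i + j, ?_⟩
    rw [← h.1, ← h.2]
    push_cast
    ring

theorem projectsTo_rhombB {c : ℝ} (hc : c ≠ 0) : ProjectsTo (rhombB c) c bigHex hexL := by
  rw [rhombB_eq]
  refine projectsTo_of cross_h1_g0 ?_ ?_ ?_
  · exact not_sigmaInv_of_third cross_h1_g0 hc (gen3_le.1 le_rfl).2.1 (Or.inr (by ring))
  · have e : !₂[(1 / 2 : ℝ), -(√3 / 6)] = -g1 := by
      apply plane_ext <;> simp [g1]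
    have e' : bigHex = gen2 g0 (-g1) := by
      rw [bigHex, e]
      rfl
    rw [e', h1_eq_g]
    apply le_antisymm <;> rw [gen2_le]
    · have m0 := left_mem_gen2 g0 (-g1)
      have m1 := right_mem_gen2 g0 (-g1)
      exact ⟨by rw [sub_eq_add_neg]; exact add_mem m0 m1, m0⟩
    · have m0 := left_mem_gen2 (g0 - g1) g0
      have m1 := right_mem_gen2 (g0 - g1) g0
      exact ⟨m1, by convert sub_mem m0 m1 using 1; abel⟩
  -- The relation `3 g0 = h1 + h2` matches the requirement that the coefficient of `g0` be divisible
  -- by three at height `0`.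
  · have e : h2 = -h1 + (g0 + g0 + g0) := by
      rw [h2_eq_g, h1_eq_g]
      have := g_sum
      have e2 : g2 = -(g0 + g1) := by rw [eq_neg_iff_add_eq_zero, add_comm, this]
      rw [e2]
      abel
    ext x
    rw [mem_restr0_gen3, hexL, mem_gen2]
    constructor
    · rintro ⟨⟨m, n⟩, hp, rfl⟩
      obtain ⟨k, rfl⟩ := (mem_modD_third hc (Or.inr rfl)).1 hp
      refine ⟨m + k, k, ?_⟩
      rw [e]
      simp only
      module
    · rintro ⟨i, j, rfl⟩
      refine ⟨(i - j, 3 * j), (mem_modD_third hc (Or.inr rfl)).2 ⟨j, rfl⟩, ?_⟩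
      rw [e]
      simp only
      module

theorem rhombohedralL_eq : rhombohedralL = rhombA 3 := by
  rw [rhombohedralL, rhombA]
  norm_num

theorem sqrt6_sq : √6 * √6 = 6 := Real.mul_self_sqrt (by norm_num)
theorem sqrt6_pos : (0 : ℝ) < √6 := Real.sqrt_pos.2 (by norm_num)

theorem primitiveL_eq : primitiveL = rhombB (√6 / 2) := by
  rw [primitiveL, rhombB, show √6 / 2 / 3 = √6 / 6 by ring]

theorem bodyL_eq : bodyL = rhombB (√6 / 4) := by
  rw [bodyL, rhombB, show √6 / 4 / 3 = √6 / 12 by ring]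

theorem gen3_neg_right (a b c : Space) : gen3 a b (-c) = gen3 a b c := by
  apply le_antisymm <;> rw [gen3_le]
  · have h := gen3_le.1 (le_refl (gen3 a b c))
    exact ⟨h.1, h.2.1, neg_mem h.2.2⟩
  · have h := gen3_le.1 (le_refl (gen3 a b (-c)))
    exact ⟨h.1, h.2.1, by simpa using neg_mem h.2.2⟩

/-- In this lattice the second generator rises instead of falling, which amounts to a negative
parameter `c`. -/
theorem faceL_eq : faceL = rhombB (-√6) := by
  rw [faceL, rhombB, ← gen3_neg_right _ _ (pt 0 √6), pt_neg, neg_zero,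
    show -(-√6 / 3) = √6 / 3 by ring]

theorem inner_pt (x x' : Plane) (y y' : ℝ) :
    inner ℝ (pt x y) (pt x' y') = inner ℝ x x' + y * y' := by
  rw [WithLp.prod_inner_apply]
  simp [pt, mul_comm]

/-- The orthonormal basis formed by an orbit of a vector under the rotation of order three. -/
theorem exists_orthonormalBasis {r κ : ℝ} (hr : r ^ 2 = 2) (hκ : κ ^ 2 = 1 / 6) :
    ∃ e : OrthonormalBasis (Fin 3) ℝ Space,
      e 0 = pt (r • g0) (r * κ) ∧ e 1 = pt (r • g1) (r * κ) ∧ e 2 = pt (r • g2) (r * κ) := by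
  have h00 : inner ℝ g0 g0 = (1 / 3 : ℝ) := by
    rw [inner_plane]; simp [g0]; linear_combination (1 / 36 : ℝ) * sqrt3_sq
  have h11 : inner ℝ g1 g1 = (1 / 3 : ℝ) := by
    rw [inner_plane]; simp [g1]; linear_combination (1 / 36 : ℝ) * sqrt3_sq
  have h22 : inner ℝ g2 g2 = (1 / 3 : ℝ) := by
    rw [inner_plane]; simp [g2]; linear_combination (1 / 9 : ℝ) * sqrt3_sq
  have h01 : inner ℝ g0 g1 = (-1 / 6 : ℝ) := by
    rw [inner_plane]; simp [g0, g1]; linear_combination (1 / 36 : ℝ) * sqrt3_sq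
  have h02 : inner ℝ g0 g2 = (-1 / 6 : ℝ) := by
    rw [inner_plane]; simp [g0, g2]; linear_combination (-1 / 18 : ℝ) * sqrt3_sq
  have h12 : inner ℝ g1 g2 = (-1 / 6 : ℝ) := by
    rw [inner_plane]; simp [g1, g2]; linear_combination (-1 / 18 : ℝ) * sqrt3_sq
  have h10 := (real_inner_comm g0 g1).trans h01
  have h20 := (real_inner_comm g0 g2).trans h02
  have h21 := (real_inner_comm g1 g2).trans h12
  have ho : Orthonormal ℝ ![pt (r • g0) (r * κ), pt (r • g1) (r * κ), pt (r • g2) (r * κ)] := by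
    -- The planar products are `1/3` on and `-1/6` off the diagonal; scaling by `r² = 2` and adding
    -- `(r κ)² = 1/3` gives `1` and `0`.
    have key : ∀ (i j : Plane) (s : ℝ), inner ℝ i j = s →
        inner ℝ (pt (r • i) (r * κ)) (pt (r • j) (r * κ)) = 2 * s + 1 / 3 := by
      intro i j s h
      rw [inner_pt, real_inner_smul_left, real_inner_smul_right, h]
      linear_combination (s + κ ^ 2) * hr + 2 * hκ
    rw [orthonormal_iff_ite]
    intro i j
    fin_cases i <;> fin_cases j
    · exact (key _ _ _ h00).trans (by norm_num)
    · exact (key _ _ _ h01).trans (by norm_num)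
    · exact (key _ _ _ h02).trans (by norm_num)
    · exact (key _ _ _ h10).trans (by norm_num)
    · exact (key _ _ _ h11).trans (by norm_num)
    · exact (key _ _ _ h12).trans (by norm_num)
    · exact (key _ _ _ h20).trans (by norm_num)
    · exact (key _ _ _ h21).trans (by norm_num)
    · exact (key _ _ _ h22).trans (by norm_num)
  let b := basisOfOrthonormalOfCardEqFinrank ho (by simp [finrank_space])
  have hb : ⇑b = ![pt (r • g0) (r * κ), pt (r • g1) (r * κ), pt (r • g2) (r * κ)] :=
    coe_basisOfOrthonormalOfCardEqFinrank _ _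
  refine ⟨b.toOrthonormalBasis (by rwa [hb]), ?_, ?_, ?_⟩ <;>
    rw [Module.Basis.coe_toOrthonormalBasis, hb] <;> rfl

theorem sqrt2_sq : (√2 : ℝ) ^ 2 = 2 := Real.sq_sqrt (by norm_num)

theorem isPrimitiveCubic_primitiveL : IsPrimitiveCubic primitiveL := by
  obtain ⟨e, e0, e1, e2⟩ := exists_orthonormalBasis (r := √2) (κ := -(√6 / 6)) sqrt2_sq
    (by linear_combination (1 / 36 : ℝ) * sqrt6_sq)
  -- The side undoes the factor `√2` that normalises the orbit vectors.
  refine ⟨e, √2 / 2, by positivity, ?_⟩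
  have hs : √2 / 2 * √2 = 1 := by linear_combination (1 / 2 : ℝ) * sqrt2_sq
  rw [primitiveL_eq, rhombB_eq_orbit, e0, e1, e2]
  simp only [pt_smul, smul_smul, ← mul_assoc, hs, one_smul, one_mul]
  rw [show √6 / 2 / 3 = √6 / 6 by ring]

/-- If `i + j + k = 0`, then `-i + j + k = -2i`, whereas the equal heights combine to a single copy.
-/
theorem bodyCentred_vec {i j k : Plane} (h : i + j + k = 0) :
    (√2 / 2 / 2) • (-pt (-√2 • i) (-√2 * (√6 / 6)) + pt (-√2 • j) (-√2 * (√6 / 6)) +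
      pt (-√2 • k) (-√2 * (√6 / 6))) = pt i (-(√6 / 4 / 3)) := by
  obtain rfl : k = -(i + j) := by rw [eq_neg_iff_add_eq_zero, add_comm, h]
  rw [pt_neg, pt_add, pt_add, pt_smul, pt_inj]
  constructor
  · apply plane_ext <;> simp
    · linear_combination i 0 / 2 * sqrt2_sq
    · linear_combination i 1 / 2 * sqrt2_sq
  · linear_combination -√6 / 24 * sqrt2_sq

theorem isBodyCentredCubic_bodyL : IsBodyCentredCubic bodyL := by
  obtain ⟨e, e0, e1, e2⟩ := exists_orthonormalBasis (r := -√2) (κ := √6 / 6)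
    (by rw [neg_sq, sqrt2_sq]) (by linear_combination (1 / 36 : ℝ) * sqrt6_sq)
  refine ⟨e, √2 / 2, by positivity, ?_⟩
  rw [bodyL_eq, rhombB_eq_orbit, ← bodyCentred_vec (k := g2) g_sum,
    ← bodyCentred_vec (i := g1) (j := g0) (k := g2) (by rw [← g_sum]; abel),
    ← bodyCentred_vec (i := g2) (j := g0) (k := g1) (by rw [← g_sum]; abel), e0, e1, e2]
  congr 2
  · abel
  · abel

/-- If `i + j + k = 0`, then `j + k = -i`, whereas the two equal heights add. -/
theorem faceCentred_vec {i j k : Plane} (h : i + j + k = 0) :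
    (√2 / 2) • (pt (-√2 • j) (-√2 * -(√6 / 6)) + pt (-√2 • k) (-√2 * -(√6 / 6))) =
      pt i (-(-√6 / 3)) := by
  obtain rfl : k = -(i + j) := by rw [eq_neg_iff_add_eq_zero, add_comm, h]
  rw [pt_add, pt_smul, pt_inj]
  constructor
  · apply plane_ext <;> simp
    · linear_combination i 0 / 2 * sqrt2_sq
    · linear_combination i 1 / 2 * sqrt2_sq
  · linear_combination √6 / 6 * sqrt2_sq

theorem isFaceCentredCubic_faceL : IsFaceCentredCubic faceL := by
  obtain ⟨e, e0, e1, e2⟩ := exists_orthonormalBasis (r := -√2) (κ := -(√6 / 6))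
    (by rw [neg_sq, sqrt2_sq]) (by linear_combination (1 / 36 : ℝ) * sqrt6_sq)
  refine ⟨e, √2, by positivity, ?_⟩
  rw [faceL_eq, rhombB_eq_orbit, ← faceCentred_vec (j := g1) (k := g2) g_sum,
    ← faceCentred_vec (i := g1) (j := g0) (k := g2) (by rw [← g_sum]; abel),
    ← faceCentred_vec (i := g2) (j := g0) (k := g1) (by rw [← g_sum]; abel), e0, e1, e2]

theorem isHexagonal_bigHex : IsHexagonal bigHex := by
  refine ⟨_, _, ?_, ?_, ?_, rfl⟩
  · intro h
    have := congrArg (fun x : Plane => x 0) h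
    norm_num at this
  · refine (sq_eq_sq₀ (norm_nonneg _) (norm_nonneg _)).1 ?_
    simp [norm_sq_plane]
  · rw [norm_sq_plane, inner_plane]
    simp
    linear_combination (-1 / 24 : ℝ) * sqrt3_sq

theorem isHexagonal_hexL : IsHexagonal hexL := by
  refine ⟨_, _, ?_, ?_, ?_, rfl⟩
  · intro h
    have := congrArg (fun x : Plane => x 0) h
    simp [h1] at this
  · refine (sq_eq_sq₀ (norm_nonneg _) (norm_nonneg _)).1 ?_
    rw [norm_sq_plane, norm_sq_plane]
    simp [h1, h2]
    linear_combination (1 / 4 : ℝ) * sqrt3_sq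
  · rw [norm_sq_plane, inner_plane]
    simp [h1, h2]

theorem isHexagonal_smallHex : IsHexagonal smallHex := by
  refine ⟨_, _, ?_, ?_, ?_, rfl⟩
  · intro h
    have := congrArg (fun x : Plane => x 0) h
    norm_num at this
  · refine (sq_eq_sq₀ (norm_nonneg _) (norm_nonneg _)).1 ?_
    simp [norm_sq_plane]
  · rw [norm_sq_plane, inner_plane]
    simp
    linear_combination (-3 / 8 : ℝ) * sqrt3_sq

section

/-! ### Isometries of the standard hexagonal lattice -/

theorem mem_hexL {p : Plane} : p ∈ hexL ↔ ∃ m n : ℤ, p = hh (2 * m) (2 * n) := by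
  rw [hexL_eq, mem_lat']
  simp [mul_comm]

theorem hh_mem_hexL {m n : ℤ} : hh m n ∈ hexL ↔ 2 ∣ m ∧ 2 ∣ n := by
  rw [mem_hexL]
  simp only [hh_inj]
  constructor
  · rintro ⟨x, y, rfl, rfl⟩
    exact ⟨⟨x, rfl⟩, ⟨y, rfl⟩⟩
  · rintro ⟨⟨x, rfl⟩, ⟨y, rfl⟩⟩
    exact ⟨x, y, rfl, rfl⟩

theorem half_sq_add : (1 / 2 : ℝ) ^ 2 + (√3 / 2) ^ 2 = 1 := by linear_combination sqrt3_sq / 4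

/-- The reflection that interchanges `h₁` and `h₂`. -/
noncomputable def swapHex : Plane ≃ₗᵢ[ℝ] Plane := mirror (1 / 2) (√3 / 2) half_sq_add

/-- The rotation by `π/3`. -/
noncomputable def rot6 : Plane ≃ₗᵢ[ℝ] Plane := rot (1 / 2) (√3 / 2) half_sq_add

theorem swapHex_hh (m n : ℤ) : swapHex (hh m n) = hh n m := by
  rw [swapHex, mirror_apply]
  apply plane_ext <;> simp [hh]
  · linear_combination (n / 8 : ℝ) * sqrt3_sq
  · ring

theorem rot6_hh (m n : ℤ) : rot6 (hh m n) = hh (-n) (m + n) := by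
  rw [rot6, rot_apply]
  apply plane_ext <;> simp [hh]
  · linear_combination (-n / 8 : ℝ) * sqrt3_sq
  · ring

theorem holHex_of {α : Plane ≃ₗᵢ[ℝ] Plane} (h : ∀ p ∈ hexL, α p ∈ hexL)
    (h' : ∀ p ∈ hexL, α.symm p ∈ hexL) : HolHex α :=
  fun x => ⟨fun hx => by simpa using h' _ hx, h x⟩

theorem holHex_refl : HolHex (LinearIsometryEquiv.refl ℝ Plane) := fun _ => Iff.rfl

theorem HolHex.trans {α β : Plane ≃ₗᵢ[ℝ] Plane} (hα : HolHex α) (hβ : HolHex β) :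
    HolHex (α.trans β) := fun x => (hβ (α x)).trans (hα x)

theorem holHex_swapHex : HolHex swapHex := by
  refine holHex_of ?_ ?_ <;> intro p hp <;> obtain ⟨m, n, rfl⟩ := mem_hexL.1 hp
  · rw [swapHex_hh, hh_mem_hexL]; omega
  · rw [show swapHex.symm (hh (2 * m) (2 * n)) = hh (2 * n) (2 * m) by
      rw [LinearIsometryEquiv.symm_apply_eq, swapHex_hh], hh_mem_hexL]
    omega

theorem holHex_rot6 : HolHex rot6 := by
  refine holHex_of ?_ ?_ <;> intro p hp <;> obtain ⟨m, n, rfl⟩ := mem_hexL.1 hp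
  · rw [rot6_hh, hh_mem_hexL]; omega
  · rw [show rot6.symm (hh (2 * m) (2 * n)) = hh (2 * m + 2 * n) (-(2 * m)) by
      rw [LinearIsometryEquiv.symm_apply_eq, rot6_hh]; congr 1 <;> ring, hh_mem_hexL]
    omega

/-- A subgroup of index two in the hexagonal lattice. -/
def IndexTwo (S : AddSubgroup Plane) : Prop :=
  (∀ p ∈ S, p ∈ hexL) ∧ ∃ w ∈ hexL, w ∉ S ∧ ∀ p ∈ hexL, p ∈ S ∨ p - w ∈ S

/-- The quotient has order two, so the two nontrivial classes cancel. -/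
theorem IndexTwo.add_mem_of_not_mem {S : AddSubgroup Plane} (h : IndexTwo S) {p q : Plane} (hp : p ∈ hexL)
    (hq : q ∈ hexL) (hp' : p ∉ S) (hq' : q ∉ S) : p + q ∈ S := by
  obtain ⟨-, w, hw, hwS, h⟩ := h
  have key : ∀ p ∈ hexL, p ∉ S → p + w ∈ S := by
    intro p hp hp'
    have h1 := (h p hp).resolve_left hp'
    rcases h (p + w) (AddSubgroup.add_mem _ hp hw) with h2 | h2
    · exact h2
    · rw [add_sub_cancel_right] at h2
      exact absurd h2 hp'
  have := add_mem ((h p hp).resolve_left hp') (key q hq hq')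
  rwa [show p - w + (q + w) = p + q by abel] at this

/-- A subgroup of index two contains all doubles, and exactly one of `h1`, `h2`, `h1 + h2`. The
reflection and the rotation by `π/3` permute these three classes, so every such subgroup can be
moved to the one containing `h2`. -/
theorem IndexTwo.exists_holHex {S : AddSubgroup Plane} (h : IndexTwo S) :
    ∃ α, HolHex α ∧ ∀ x, α x ∈ lat (4, 0, 0, 2) ↔ x ∈ S := by
  have h1 : h1 ∈ hexL := left_mem_gen2 _ _
  have h2 : h2 ∈ hexL := right_mem_gen2 _ _
  rw [h1_eq] at h1
  rw [h2_eq] at h2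
  have hu : Indep (4, 0, 0, 2) := by simp [Indep]
  have hle : ∀ x, x ∈ lat (4, 0, 0, 2) → x ∈ hexL := by
    intro x hx
    obtain ⟨m, n, rfl, h⟩ := (mem_lat hu).1 hx
    rw [hh_mem_hexL]
    simp only [InLat] at h
    omega
  -- it suffices to compare on the lattice
  have key : ∀ α, HolHex α → (∀ m n : ℤ, α (hh (2 * m) (2 * n)) ∈ lat (4, 0, 0, 2) ↔
      hh (2 * m) (2 * n) ∈ S) → ∃ α, HolHex α ∧ ∀ x, α x ∈ lat (4, 0, 0, 2) ↔ x ∈ S := by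
    refine fun α hα hS => ⟨α, hα, fun x => ?_⟩
    by_cases hx : x ∈ hexL
    · obtain ⟨m, n, rfl⟩ := mem_hexL.1 hx
      exact hS m n
    · exact ⟨fun hx' => absurd ((hα x).1 (hle _ hx')) hx, fun hx' => absurd (h.1 x hx') hx⟩
  have htwo : ∀ p ∈ hexL, (2 : ℤ) • p ∈ S := by
    intro p hp
    rw [two_zsmul]
    by_cases hpS : p ∈ S
    · exact add_mem hpS hpS
    · exact h.add_mem_of_not_mem hp hp hpS hpS
  -- Membership depends only on the parities of the coefficients.
  have hred : ∀ m n m' n' : ℤ, hh (2 * (2 * m + m')) (2 * (2 * n + n')) ∈ S ↔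
      hh (2 * m') (2 * n') ∈ S := by
    intro m n m' n'
    have h3 : (2 : ℤ) • (hh (2 * m) (2 * n)) ∈ S := htwo _ (by rw [hh_mem_hexL]; omega)
    rw [← add_mem_cancel_left (y := hh (2 * m') (2 * n')) h3, hh_zsmul, hh_add]
    ring_nf
  have hpar : ∀ m : ℤ, ∃ k, m = 2 * k + 0 ∨ m = 2 * k + 1 := fun m => ⟨m / 2, by omega⟩
  have h00 : hh (2 * 0) (2 * 0) ∈ S := by
    rw [mul_zero, hh_zero]; exact zero_mem _
  have hsum : hh 2 0 + hh 0 2 = hh 2 2 := by rw [hh_add]; rfl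
  by_cases h1S : hh 2 0 ∈ S
  · have h2S : hh 0 2 ∉ S := by
      intro h2S
      obtain ⟨-, w, hw, hwS, -⟩ := h
      obtain ⟨m, n, rfl⟩ := mem_hexL.1 hw
      apply hwS
      have := add_mem (zsmul_mem h1S m) (zsmul_mem h2S n)
      rw [hh_zsmul, hh_zsmul, hh_add] at this
      convert this using 2 <;> ring
    have h3S : hh 2 2 ∉ S := by rwa [← hsum, add_mem_cancel_left h1S]
    refine key swapHex holHex_swapHex fun m n => ?_
    rw [swapHex_hh, hh_mem_lat hu]
    obtain ⟨k, rfl | rfl⟩ := hpar m <;> obtain ⟨l, rfl | rfl⟩ := hpar n <;> rw [hred] <;>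
      norm_num [InLat, h00, h1S, h2S, h3S, hh_zero, zero_mem] <;> omega
  · by_cases h2S : hh 0 2 ∈ S
    · have h3S : hh 2 2 ∉ S := by rwa [← hsum, add_mem_cancel_right h2S]
      refine key _ holHex_refl fun m n => ?_
      rw [LinearIsometryEquiv.coe_refl, id, hh_mem_lat hu]
      obtain ⟨k, rfl | rfl⟩ := hpar m <;> obtain ⟨l, rfl | rfl⟩ := hpar n <;> rw [hred] <;>
        norm_num [InLat, h00, h1S, h2S, h3S, hh_zero, zero_mem] <;> omega
    · have h3S : hh 2 2 ∈ S := by rw [← hsum]; exact h.add_mem_of_not_mem h1 h2 h1S h2S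
      -- The composite takes coefficients `(m, n)` to `(m + n, -n)`, so it makes the first
      -- coefficient of `h1 + h2` even.
      refine key _ (holHex_rot6.trans holHex_swapHex) fun m n => ?_
      rw [LinearIsometryEquiv.trans_apply, rot6_hh, swapHex_hh, hh_mem_lat hu]
      obtain ⟨k, rfl | rfl⟩ := hpar m <;> obtain ⟨l, rfl | rfl⟩ := hpar n <;> rw [hred] <;>
        norm_num [InLat, h00, h1S, h2S, h3S, hh_zero, zero_mem] <;> omega

/-! ### Lattices that are invariant under the reflection -/

/-- The lattice is invariant under `σ` and `c` is its vertical period. -/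
structure Layered (Γ : Subgroup Euc) (c : ℝ) : Prop where
  pos : 0 < c
  vert : ∀ z, pt 0 z ∈ trans Γ ↔ ∃ n : ℤ, z = n * c
  inv : SigmaInv (trans Γ)

namespace Layered

variable {Γ : Subgroup Euc} {c : ℝ}

theorem conjPlus (h : Layered Γ c) (α : Plane ≃ₗᵢ[ℝ] Plane) :
    Layered (ProjPer.conjPlus α Γ) c where
  pos := h.pos
  vert z := by rw [← h.vert, ← mem_trans_conjPlus (Γ := Γ) (α := α), map_zero]
  inv z hz := by
    obtain ⟨p, hp⟩ := α.surjective z.fst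
    rw [← pt_eta z, ← hp] at hz ⊢
    rw [sigma_pt, mem_trans_conjPlus]
    rw [mem_trans_conjPlus] at hz
    simpa only [sigma_pt] using h.inv _ hz

/-- A vector minus its reflection is vertical of twice the height, so `2z` is a multiple of `c`. -/
theorem height_cases (h : Layered Γ c) {p : Plane} {z : ℝ} (hz : pt p z ∈ trans Γ) :
    ∃ j : ℤ, z = j * c ∨ z = j * c + c / 2 := by
  have h2 := sub_mem hz (h.inv _ hz)
  rw [sigma_pt, pt_sub, sub_self, h.vert] at h2
  obtain ⟨n, hn⟩ := h2
  refine ⟨n / 2, ?_⟩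
  rcases Int.even_or_odd' n with ⟨k, rfl | rfl⟩
  · left
    rw [Int.mul_ediv_cancel_left _ two_ne_zero]
    push_cast at hn
    linarith
  · right
    rw [show (2 * k + 1) / 2 = k by omega]
    push_cast at hn
    linarith

theorem add_vert_mem (h : Layered Γ c) {p : Plane} {z : ℝ} (j : ℤ) :
    pt p (j * c + z) ∈ trans Γ ↔ pt p z ∈ trans Γ := by
  rw [← add_mem_cancel_left ((h.vert _).2 ⟨j, rfl⟩) (y := pt p z), pt_add, zero_add]

/-- A vector plus its reflection is horizontal; half-height vectors therefore project to halves of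
horizontal lattice vectors. -/
theorem two_zsmul_mem (h : Layered Γ c) {p : Plane} {z : ℝ} (hz : pt p z ∈ trans Γ) :
    pt ((2 : ℤ) • p) 0 ∈ trans Γ := by
  have := add_mem hz (h.inv _ hz)
  rwa [sigma_pt, pt_add, ← two_zsmul, add_neg_cancel] at this

theorem mem_of_half {p q : Plane} (hp : pt p (c / 2) ∈ trans Γ) :
    pt (p + q) (c / 2) ∈ trans Γ ↔ pt q 0 ∈ trans Γ := by
  rw [← add_mem_cancel_left hp (y := pt q 0), pt_add, add_zero]

/-- The difference would be `(0, c/2)`, which is shorter than the vertical period. -/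
theorem half_not_mem (h : Layered Γ c) {p : Plane} (hp : pt p (c / 2) ∈ trans Γ) :
    pt p 0 ∉ trans Γ := by
  intro h0
  have := sub_mem hp h0
  rw [pt_sub, sub_self, sub_zero, h.vert] at this
  obtain ⟨n, hn⟩ := this
  have hc := h.pos
  have h2 : (1 : ℝ) = 2 * n := mul_right_cancel₀ hc.ne' (by linarith)
  have : (1 : ℤ) = 2 * n := by exact_mod_cast h2
  omega

theorem exists_mem_iff (h : Layered Γ c) {p : Plane} :
    (∃ z, pt p z ∈ trans Γ) ↔ pt p 0 ∈ trans Γ ∨ pt p (c / 2) ∈ trans Γ := by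
  constructor
  · rintro ⟨z, hz⟩
    obtain ⟨j, rfl | rfl⟩ := h.height_cases hz
    · left
      rwa [← add_zero (j * c), h.add_vert_mem] at hz
    · right
      rwa [h.add_vert_mem] at hz
  · rintro (h | h)
    exacts [⟨_, h⟩, ⟨_, h⟩]

/-- A lattice invariant under `σ` is that of a code if this is so at the heights `0` and `c/2`. -/
theorem trans_eq (h : Layered Γ c) {k : Code} (hk : k.Valid)
    (h0 : ∀ x, pt x 0 ∈ trans Γ ↔ x ∈ lat k.R)
    (h1 : (k.s = 0 ∧ ∀ x, pt x (c / 2) ∉ trans Γ) ∨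
      (k.s = 1 ∧ pt (hh k.a1 k.a2) (c / 2) ∈ trans Γ)) : trans Γ = k.col.lattice c := by
  have hint : ∀ (p : Plane) (j : ℤ), pt p (j * c) ∈ trans Γ ↔ pt p (j * c) ∈ k.col.lattice c := by
    intro p j
    rw [hk.mem_lattice_int h.pos, ← h0, ← add_zero (j * c), h.add_vert_mem]
  have hhalf : ∀ (p : Plane) (j : ℤ), pt p (j * c + c / 2) ∈ trans Γ ↔
      pt p (j * c + c / 2) ∈ k.col.lattice c := by
    intro p j
    rw [hk.mem_lattice_half h.pos, ← h0, h.add_vert_mem]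
    rcases h1 with ⟨hs, h1⟩ | ⟨hs, h1⟩
    · simp [hs, h1]
    · rw [← mem_of_half h1, add_sub_cancel]
      simp [hs]
  ext z
  rw [← pt_eta z]
  constructor
  · intro hz
    obtain ⟨j, hj | hj⟩ := h.height_cases hz <;> rw [hj] at hz ⊢
    exacts [(hint _ j).1 hz, (hhalf _ j).1 hz]
  · intro hz
    obtain ⟨j, hj | hj⟩ := hk.height_cases hz <;> rw [hj] at hz ⊢
    exacts [(hint _ j).2 hz, (hhalf _ j).2 hz]

end Layered

/-- Some conjugate of the group belongs to one of the columns. -/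
def InTable (Γ : Subgroup Euc) : Prop :=
  ∃ α : Plane ≃ₗᵢ[ℝ] Plane, HolHex α ∧
    ∃ k ∈ columns, ∃ c y1 : ℝ, k.Has (conjPlus α Γ) c y1

theorem InTable.of_conjPlus {Γ : Subgroup Euc} {α : Plane ≃ₗᵢ[ℝ] Plane} (hα : HolHex α)
    (h : InTable (conjPlus α Γ)) : InTable Γ := by
  obtain ⟨β, hβ, h⟩ := h
  rw [conjPlus_conjPlus] at h
  exact ⟨_, hα.trans hβ, h⟩

/-- Translating an element of `L_σ` by lattice vectors. -/
theorem transSigma_add_mem {Γ : Subgroup Euc} {p q : Plane} {y z : ℝ}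
    (h : pt p y ∈ transSigma Γ) (h' : pt q z ∈ trans Γ) : pt (p + q) (y + z) ∈ transSigma Γ := by
  rw [mem_transSigma_iff_sub h, pt_sub]
  simpa using h'

/-- The entry point from invariants to columns: horizontal vectors, one vector at height `c/2` and
one glide determine the lattice and `L_σ`. Changing the glide by a half-height lattice vector
changes `y1` by `c/2`, so columns related in this way share groups and need not all be used. -/
theorem Layered.inTable {Γ : Subgroup Euc} {c : ℝ} (h : Layered Γ c) {k : Code} (hk : k ∈ codes)
    (h0 : ∀ x, pt x 0 ∈ trans Γ ↔ x ∈ lat k.R)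
    (h1 : (k.s = 0 ∧ ∀ x, pt x (c / 2) ∉ trans Γ) ∨
      (k.s = 1 ∧ pt (hh k.a1 k.a2) (c / 2) ∈ trans Γ))
    (hv : (k.v = none ∧ transSigma Γ = ∅) ∨ ∃ v ∈ k.v, ∃ y, pt (hh v.1 v.2) y ∈ transSigma Γ) :
    InTable Γ := by
  have hc := h.pos
  have hval := codes_valid k hk
  have hcol : k.col ∈ columns := by rw [columns_eq]; exact List.mem_map_of_mem hk
  refine ⟨_, holHex_refl, k.col, hcol, c, ?_⟩
  rw [conjPlus_refl]
  simp only [Code.col_has_iff]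
  have hL := h.trans_eq hval h0 h1
  rcases hv with hv | ⟨v, hv, y, hy⟩
  -- Without glides `y1` carries no information, and any value in `[0, c)` would do.
  · exact ⟨0, hc, ⟨le_rfl, hc⟩, hL, Or.inl hv⟩
  -- The glide height is reduced to `[0, c)` by vertical lattice vectors.
  · refine ⟨c * Int.fract (y / c), hc, ⟨by have := Int.fract_nonneg (y / c); positivity, ?_⟩, hL,
      Or.inr ⟨v, hv, ?_⟩⟩
    · have := Int.fract_lt_one (y / c)
      nlinarith
    · have := transSigma_add_mem hy ((h.vert _).2 ⟨-⌊y / c⌋, rfl⟩)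
      rw [add_zero] at this
      rw [Int.fract, mul_sub, mul_div_cancel₀ _ hc.ne']
      convert this using 2
      push_cast
      ring

end

section

/-! ### Completeness for lattices that are invariant under the reflection -/

theorem eq_hh_of_two_zsmul {p : Plane} {m n : ℤ} (h : (2 : ℤ) • p = hh (2 * m) (2 * n)) :
    p = hh m n := by
  rw [← hh_zsmul] at h
  rw [← Int.cast_smul_eq_zsmul ℝ, ← Int.cast_smul_eq_zsmul ℝ] at h
  exact smul_right_injective Plane (by norm_num) h

theorem transSigma_hh {Γ : Subgroup Euc} {x y : ℤ} (x' y' : ℤ) {z : ℝ}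
    (h : pt (hh x y) z ∈ transSigma Γ) (h' : pt (hh (x' - x) (y' - y)) 0 ∈ trans Γ) :
    pt (hh x' y') z ∈ transSigma Γ := by
  have := transSigma_add_mem h h'
  rwa [hh_add, add_zero, add_sub_cancel, add_sub_cancel] at this

theorem trans_hh {Γ : Subgroup Euc} {x y : ℤ} (x' y' : ℤ) {z : ℝ}
    (h : pt (hh x y) z ∈ trans Γ) (h' : pt (hh (x' - x) (y' - y)) 0 ∈ trans Γ) :
    pt (hh x' y') z ∈ trans Γ := by
  have := add_mem h h'
  rwa [pt_add, hh_add, add_zero, add_sub_cancel, add_sub_cancel] at this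

theorem exists_parity (m : ℤ) : ∃ k, m = 2 * k ∨ m = 2 * k + 1 := ⟨m / 2, by omega⟩

namespace Layered

variable {Γ : Subgroup Euc} {c : ℝ}

/-- Elements of `L_σ` when the horizontal lattice vectors form the hexagonal lattice. -/
theorem exists_transSigma_hh (hR : ∀ x, pt x 0 ∈ trans Γ ↔ x ∈ hexL)
    (hne : (transSigma Γ).Nonempty) : ∃ y, pt (hh 0 0) y ∈ transSigma Γ ∨
      pt (hh 1 0) y ∈ transSigma Γ ∨ pt (hh 0 1) y ∈ transSigma Γ ∨
      pt (hh 1 1) y ∈ transSigma Γ := by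
  obtain ⟨w, hw⟩ := hne
  rw [← pt_eta w] at hw
  obtain ⟨m, n, e⟩ := mem_hexL.1 ((hR _).1 (two_smul_mem_of_transSigma hw))
  rw [eq_hh_of_two_zsmul e] at hw
  have key : ∀ x' y' : ℤ, 2 ∣ x' - m ∧ 2 ∣ y' - n → pt (hh x' y') w.snd ∈ transSigma Γ :=
    fun x' y' h => transSigma_hh x' y' hw ((hR _).2 (hh_mem_hexL.2 h))
  refine ⟨w.snd, ?_⟩
  obtain ⟨k, rfl | rfl⟩ := exists_parity m <;> obtain ⟨l, rfl | rfl⟩ := exists_parity n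
  · exact Or.inl (key 0 0 (by omega))
  · exact Or.inr (Or.inr (Or.inl (key 0 1 (by omega))))
  · exact Or.inr (Or.inl (key 1 0 (by omega)))
  · exact Or.inr (Or.inr (Or.inr (key 1 1 (by omega))))

/-- The half-height vector has been normalised to `h1/2`. What remains is whether there are glides,
and in which of the four classes of half the hexagonal lattice modulo the lattice they lie. -/
theorem inTable_of_restr0_aux (h : Layered Γ c) (hR : ∀ x, pt x 0 ∈ trans Γ ↔ x ∈ hexL)
    (h1 : pt (hh 1 0) (c / 2) ∈ trans Γ) : InTable Γ := by
  rw [hexL_eq] at hR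
  rcases Set.eq_empty_or_nonempty (transSigma Γ) with he | hne
  · exact h.inTable (k := codes[2]) (List.getElem_mem _) hR (Or.inr ⟨rfl, h1⟩)
      (Or.inl ⟨rfl, he⟩)
  · rw [← hexL_eq] at hR
    obtain ⟨y, hy⟩ := exists_transSigma_hh hR hne
    rw [hexL_eq] at hR
    rcases hy with hy | hy | hy | hy
    · exact h.inTable (k := codes[17]) (List.getElem_mem _) hR (Or.inr ⟨rfl, h1⟩)
        (Or.inr ⟨_, rfl, y, hy⟩)
    · exact h.inTable (k := codes[18]) (List.getElem_mem _) hR (Or.inr ⟨rfl, h1⟩)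
        (Or.inr ⟨_, rfl, y, hy⟩)
    · exact h.inTable (k := codes[19]) (List.getElem_mem _) hR (Or.inr ⟨rfl, h1⟩)
        (Or.inr ⟨_, rfl, y, hy⟩)
    · exact h.inTable (k := codes[20]) (List.getElem_mem _) hR (Or.inr ⟨rfl, h1⟩)
        (Or.inr ⟨_, rfl, y, hy⟩)

theorem restr0_conjPlus {α : Plane ≃ₗᵢ[ℝ] Plane} (hα : HolHex α)
    (hR : ∀ x, pt x 0 ∈ trans Γ ↔ x ∈ hexL) :
    ∀ x, pt x 0 ∈ trans (ProjPer.conjPlus α Γ) ↔ x ∈ hexL := by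
  intro x
  obtain ⟨x, rfl⟩ := α.surjective x
  rw [mem_trans_conjPlus, hα, hR]

/-- A half-height vector represents one of the three nonzero classes of half the hexagonal lattice
modulo the lattice; the holohedry moves each of them to `h1/2`. -/
theorem inTable_of_restr0 (h : Layered Γ c) (hR : ∀ x, pt x 0 ∈ trans Γ ↔ x ∈ hexL) :
    InTable Γ := by
  by_cases h1 : ∃ w, pt w (c / 2) ∈ trans Γ
  · obtain ⟨w, hw⟩ := h1
    obtain ⟨m, n, e⟩ := mem_hexL.1 ((hR _).1 (h.two_zsmul_mem hw))
    rw [eq_hh_of_two_zsmul e] at hw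
    have key : ∀ x' y' : ℤ, 2 ∣ x' - m ∧ 2 ∣ y' - n → pt (hh x' y') (c / 2) ∈ trans Γ :=
      fun x' y' h => trans_hh x' y' hw ((hR _).2 (hh_mem_hexL.2 h))
    have conj : ∀ {α : Plane ≃ₗᵢ[ℝ] Plane}, HolHex α → ∀ x y : ℤ, pt (hh x y) (c / 2) ∈ trans Γ →
        α (hh x y) = hh 1 0 → InTable Γ := by
      intro α hα x y hxy e
      refine InTable.of_conjPlus hα ((h.conjPlus α).inTable_of_restr0_aux
        (restr0_conjPlus hα hR) ?_)
      rw [← e, mem_trans_conjPlus]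
      exact hxy
    obtain ⟨k, rfl | rfl⟩ := exists_parity m <;> obtain ⟨l, rfl | rfl⟩ := exists_parity n
    · exact absurd ((hR _).2 (hh_mem_hexL.2 (by omega))) (h.half_not_mem hw)
    · exact conj holHex_swapHex 0 1 (key 0 1 (by omega)) (swapHex_hh _ _)
    · exact conj holHex_refl 1 0 (key 1 0 (by omega)) rfl
    · exact conj holHex_rot6 1 (-1) (key 1 (-1) (by omega)) (rot6_hh _ _)
  · push Not at h1
    rcases Set.eq_empty_or_nonempty (transSigma Γ) with he | hne
    · rw [hexL_eq] at hR
      exact h.inTable (k := codes[0]) (List.getElem_mem _) hR (Or.inl ⟨rfl, h1⟩)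
        (Or.inl ⟨rfl, he⟩)
    · obtain ⟨y, hy⟩ := exists_transSigma_hh hR hne
      rw [hexL_eq] at hR
      rcases hy with hy | hy | hy | hy
      · exact h.inTable (k := codes[3]) (List.getElem_mem _) hR (Or.inl ⟨rfl, h1⟩)
          (Or.inr ⟨_, rfl, y, hy⟩)
      · exact h.inTable (k := codes[4]) (List.getElem_mem _) hR (Or.inl ⟨rfl, h1⟩)
          (Or.inr ⟨_, rfl, y, hy⟩)
      · exact h.inTable (k := codes[5]) (List.getElem_mem _) hR (Or.inl ⟨rfl, h1⟩)
          (Or.inr ⟨_, rfl, y, hy⟩)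
      · exact h.inTable (k := codes[6]) (List.getElem_mem _) hR (Or.inl ⟨rfl, h1⟩)
          (Or.inr ⟨_, rfl, y, hy⟩)

theorem hh_mem_lat_four {m n : ℤ} : hh m n ∈ lat (4, 0, 0, 2) ↔ 4 ∣ m ∧ 2 ∣ n := by
  rw [hh_mem_lat (by simp [Indep])]
  simp only [InLat]
  omega

/-- Adding the second generator to the first changes the basis but not the lattice. -/
theorem mem_lat_four_sheared {x : Plane} : x ∈ lat (4, -2, 0, 2) ↔ x ∈ lat (4, 0, 0, 2) := by
  rw [mem_lat (by simp [Indep]), mem_lat (by simp [Indep])]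
  simp only [InLat]
  refine exists_congr fun a => exists_congr fun b => and_congr_right fun _ => ?_
  norm_num only
  omega

theorem hh_mem_lat_four' {m n : ℤ} : hh m n ∈ lat (2, 0, 0, 4) ↔ 2 ∣ m ∧ 4 ∣ n := by
  rw [hh_mem_lat (by simp [Indep])]
  simp only [InLat]
  omega

theorem mem_lat_swapHex {p : Plane} : swapHex p ∈ lat (2, 0, 0, 4) ↔ p ∈ lat (4, 0, 0, 2) := by
  constructor
  · intro h
    obtain ⟨x, y, e⟩ := exists_hh h
    have hp : p = hh y x := swapHex.injective (by rw [e, swapHex_hh])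
    rw [hp, swapHex_hh, hh_mem_lat_four'] at h
    rw [hp, hh_mem_lat_four]
    omega
  · intro h
    obtain ⟨x, y, rfl⟩ := exists_hh h
    rw [hh_mem_lat_four] at h
    rw [swapHex_hh, hh_mem_lat_four']
    omega

/-- The horizontal lattice vectors form a sublattice of index two, and the glide vector fills
the gap. -/
theorem inTable_of_glide (h : Layered Γ c) (hR : ∀ x, pt x 0 ∈ trans Γ ↔ x ∈ lat (4, 0, 0, 2))
    {y : ℝ} (hy : pt (hh 2 0) y ∈ transSigma Γ) : InTable Γ := by
  by_cases h1 : ∃ w, pt w (c / 2) ∈ trans Γ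
  · obtain ⟨w, hw⟩ := h1
    have h2 := (hR _).1 (h.two_zsmul_mem hw)
    obtain ⟨m, n, e⟩ : ∃ m n : ℤ, (2 : ℤ) • w = hh (2 * (2 * m)) (2 * n) := by
      obtain ⟨x, y, e⟩ := exists_hh h2
      rw [e, hh_mem_lat_four] at h2
      obtain ⟨⟨m, rfl⟩, n, rfl⟩ := h2
      exact ⟨m, n, by rw [e]; ring_nf⟩
    rw [eq_hh_of_two_zsmul e] at hw
    have key : ∀ x' y' : ℤ, 4 ∣ x' - 2 * m ∧ 2 ∣ y' - n → pt (hh x' y') (c / 2) ∈ trans Γ :=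
      fun x' y' h => trans_hh x' y' hw ((hR _).2 (hh_mem_lat_four.2 h))
    -- The half-height vector has four possible classes modulo the horizontal lattice. The zero
    -- class is excluded by `half_not_mem`; the others each match a column.
    obtain ⟨k, rfl | rfl⟩ := exists_parity m <;> obtain ⟨l, rfl | rfl⟩ := exists_parity n
    · exact absurd ((hR _).2 (hh_mem_lat_four.2 (by omega))) (h.half_not_mem hw)
    -- This column is written with `h1` and `h2` interchanged, hence the conjugation by the
    -- reflection.
    · refine InTable.of_conjPlus holHex_swapHex ((h.conjPlus swapHex).inTable (k := codes[15])
        (List.getElem_mem _) (fun x => ?_) (Or.inr ⟨rfl, ?_⟩) (Or.inr ⟨_, rfl, y, ?_⟩))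
      · obtain ⟨x, rfl⟩ := swapHex.surjective x
        rw [mem_trans_conjPlus, hR]
        exact mem_lat_swapHex.symm
      · have := key 0 1 (by omega)
        rwa [← mem_trans_conjPlus (α := swapHex), swapHex_hh] at this
      · rwa [← mem_transSigma_conjPlus (α := swapHex), swapHex_hh] at hy
    · exact h.inTable (k := codes[10]) (List.getElem_mem _) hR
        (Or.inr ⟨rfl, key 2 0 (by omega)⟩) (Or.inr ⟨_, rfl, y, hy⟩)
    · refine h.inTable (k := codes[14]) (List.getElem_mem _)
        (fun x => (hR x).trans mem_lat_four_sheared.symm)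
        (Or.inr ⟨rfl, key 2 (-1) (by omega)⟩) (Or.inr ⟨_, rfl, y, hy⟩)
  · push Not at h1
    exact h.inTable (k := codes[7]) (List.getElem_mem _) hR (Or.inl ⟨rfl, h1⟩)
      (Or.inr ⟨_, rfl, y, hy⟩)

/-- The lattice projects onto the hexagonal lattice, with horizontal vectors of index two. -/
theorem inTable_of_half (h : Layered Γ c) (hR : ∀ x, pt x 0 ∈ trans Γ ↔ x ∈ lat (4, 0, 0, 2))
    (h1 : pt (hh 2 0) (c / 2) ∈ trans Γ)
    (hσ : ∀ w ∈ transSigma Γ, w.fst ∈ hexL) : InTable Γ := by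
  rcases Set.eq_empty_or_nonempty (transSigma Γ) with he | ⟨w, hw⟩
  · exact h.inTable (k := codes[1]) (List.getElem_mem _) hR (Or.inr ⟨rfl, h1⟩)
      (Or.inl ⟨rfl, he⟩)
  · obtain ⟨m, n, e⟩ := mem_hexL.1 (hσ w hw)
    rw [← pt_eta w, e] at hw
    have key : ∀ x' y' : ℤ, 4 ∣ x' - 2 * m ∧ 2 ∣ y' - 2 * n → pt (hh x' y') w.snd ∈ transSigma Γ :=
      fun x' y' h => transSigma_hh x' y' hw ((hR _).2 (hh_mem_lat_four.2 h))
    -- Since `h2` is horizontal in the lattice, only the parity of the coefficient of `h1` matters.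
    obtain ⟨k, rfl | rfl⟩ := exists_parity m
    · exact h.inTable (k := codes[9]) (List.getElem_mem _) hR (Or.inr ⟨rfl, h1⟩)
        (Or.inr ⟨_, rfl, _, key 0 0 (by omega)⟩)
    · exact h.inTable (k := codes[10]) (List.getElem_mem _) hR (Or.inr ⟨rfl, h1⟩)
        (Or.inr ⟨_, rfl, _, key 2 0 (by omega)⟩)

/-- The lattice projects onto a sublattice of index two, with horizontal vectors of index four. -/
theorem inTable_of_proj (h : Layered Γ c)
    (hP : ∀ x, (∃ z, pt x z ∈ trans Γ) ↔ x ∈ lat (2, 0, 0, 4)) {w : Plane}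
    (hw : pt w (c / 2) ∈ trans Γ) {m n : ℤ} {y : ℝ}
    (hy : pt (hh (2 * m) (2 * n)) y ∈ transSigma Γ) (hmn : hh (2 * m) (2 * n) ∉ lat (2, 0, 0, 4)) :
    InTable Γ := by
  rw [hh_mem_lat_four'] at hmn
  have hglide : ∀ x' y' : ℤ, hh (x' - 2 * m) (y' - 2 * n) ∈ lat (2, 0, 0, 4) →
      ∃ z, pt (hh x' y') z ∈ transSigma Γ := by
    intro x' y' h'
    obtain ⟨z, hz⟩ := (hP _).2 h'
    refine ⟨y + z, ?_⟩
    have := transSigma_add_mem hy hz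
    rwa [hh_add, add_sub_cancel, add_sub_cancel] at this
  -- Glides exist over the whole coset, in particular over `h2` and `h1 + h2`. Their squares are
  -- horizontal translations, which put twice the hexagonal lattice into `ℛ₀(L)`.
  obtain ⟨z1, hz1⟩ := hglide 0 2 (by rw [hh_mem_lat_four']; omega)
  obtain ⟨z2, hz2⟩ := hglide 2 2 (by rw [hh_mem_lat_four']; omega)
  have e1 := two_smul_mem_of_transSigma hz1
  have e2 := two_smul_mem_of_transSigma hz2
  rw [hh_zsmul] at e1 e2
  have e3 := sub_mem e2 e1
  rw [pt_sub, hh_sub, sub_zero] at e3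
  norm_num at e1 e3
  have h40 : ∀ k l : ℤ, pt (hh (4 * k) (4 * l)) 0 ∈ trans Γ := by
    intro k l
    have := add_mem (zsmul_mem e3 k) (zsmul_mem e1 l)
    rw [pt_zsmul, pt_zsmul, pt_add, hh_zsmul, hh_zsmul, hh_add] at this
    convert this using 2
    · ring_nf
    · ring
  -- Modulo twice the hexagonal lattice the projection of the lattice has only the classes `0` and
  -- `h1`, and a half-height vector cannot be in the class `0`.
  have hh1 : pt (hh 2 0) (c / 2) ∈ trans Γ := by
    have hwP := (hP w).1 ⟨_, hw⟩
    obtain ⟨a, b, rfl⟩ := exists_hh hwP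
    rw [hh_mem_lat_four'] at hwP
    obtain ⟨⟨a, rfl⟩, b, rfl⟩ := hwP
    obtain ⟨k, rfl | rfl⟩ := exists_parity a
    · refine absurd ?_ (h.half_not_mem hw)
      convert h40 k b using 2
      ring_nf
    · refine trans_hh 2 0 hw ?_
      convert h40 (-k) (-b) using 3 <;> ring
  refine h.inTable (k := codes[11]) (List.getElem_mem _) (fun x => ?_) (Or.inr ⟨rfl, hh1⟩)
    (Or.inr ⟨_, rfl, z1, hz1⟩)
  have hu : Indep (4, 0, 0, 4) := by simp [Indep]
  change _ ↔ x ∈ lat (4, 0, 0, 4)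
  constructor
  · intro hx
    have hxP := (hP x).1 ⟨_, hx⟩
    obtain ⟨a, b, rfl⟩ := exists_hh hxP
    rw [hh_mem_lat_four'] at hxP
    obtain ⟨⟨a, rfl⟩, b, rfl⟩ := hxP
    rw [hh_mem_lat hu]
    simp only [InLat]
    obtain ⟨k, rfl | rfl⟩ := exists_parity a
    · omega
    · refine absurd ?_ (h.half_not_mem hh1)
      refine trans_hh 2 0 hx ?_
      convert h40 (-k) (-b) using 3 <;> ring
  · intro hx
    obtain ⟨a, b, rfl, hab⟩ := (mem_lat hu).1 hx
    simp only [InLat] at hab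
    convert h40 (a / 4) (b / 4) using 3 <;> omega

end Layered

end

/-! ### Bases of the projections of a lattice -/

/-- Rank of the image of a finitely generated subgroup. -/
theorem finrank_map_add {M : Type*} [AddCommGroup M] (S : Submodule ℤ Space)
    (f : Space →ₗ[ℤ] M) [Module.Finite ℤ S] :
    Module.finrank ℤ (S.map f) + Module.finrank ℤ (S ⊓ LinearMap.ker f : Submodule ℤ Space) =
      Module.finrank ℤ S := by
  have h := Submodule.finrank_quotient_add_finrank (LinearMap.ker (f.domRestrict S))
  rw [(f.domRestrict S).quotKerEquivRange.finrank_eq] at h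
  rw [LinearMap.range_domRestrict] at h
  rw [← h]
  congr 1
  have e := Submodule.finrank_map_subtype_eq S (LinearMap.ker (f.domRestrict S))
  rw [← e, LinearMap.ker_domRestrict, Submodule.map_comap_subtype]

theorem toIntSubmodule_gen3 (a b c : Space) :
    AddSubgroup.toIntSubmodule (gen3 a b c) = Submodule.span ℤ (Set.range ![a, b, c]) := by
  rw [gen3, AddSubgroup.toIntSubmodule_closure]
  congr 1
  ext z
  simp only [Set.mem_insert_iff, Set.mem_singleton_iff, Set.mem_range, Fin.exists_fin_succ,
    Matrix.cons_val_zero, Matrix.cons_val_succ, IsEmpty.exists_iff, or_false, eq_comm]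

theorem IsLattice.finrank {L : AddSubgroup Space} (hL : IsLattice L) :
    Module.Finite ℤ (AddSubgroup.toIntSubmodule L) ∧
      Module.finrank ℤ (AddSubgroup.toIntSubmodule L) = 3 := by
  obtain ⟨a, b, c, hli, rfl⟩ := hL
  rw [toIntSubmodule_gen3]
  have hli' : LinearIndependent ℤ ![a, b, c] := hli.restrict_scalars (R := ℤ) (by
    intro x y h
    simpa using h)
  exact ⟨Module.Finite.span_of_finite ℤ (Set.finite_range _),
    (finrank_span_eq_card hli').trans (by simp)⟩

/-- A finitely generated torsion-free abelian group is free, and its rank is the rank of the lattice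
minus that of the kernel. No discreteness of the image is required. -/
theorem exists_basis_map {M : Type*} [AddCommGroup M] [Module.IsTorsionFree ℤ M] 
    {L : AddSubgroup Space} (hL : IsLattice L) (f : Space →ₗ[ℤ] M) {r s : ℕ}
    (u : Fin s → Space) (hu : LinearIndependent ℤ u)
    (hker : ∀ z, z ∈ L ∧ f z = 0 ↔ z ∈ Submodule.span ℤ (Set.range u)) (hr : r + s = 3) :
    ∃ b : Fin r → M, (AddSubgroup.toIntSubmodule L).map f = Submodule.span ℤ (Set.range b) := by
  obtain ⟨hfin, h3⟩ := hL.finrank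
  have h := finrank_map_add (AddSubgroup.toIntSubmodule L) f
  have hk : (AddSubgroup.toIntSubmodule L ⊓ LinearMap.ker f : Submodule ℤ Space) =
      Submodule.span ℤ (Set.range u) := by
    ext z
    rw [← hker]
    rfl
  rw [h3, hk, finrank_span_eq_card hu, Fintype.card_fin] at h
  have : Module.Finite ℤ ((AddSubgroup.toIntSubmodule L).map f) := inferInstance
  have : Module.Free ℤ ((AddSubgroup.toIntSubmodule L).map f) := inferInstance
  let b := Module.finBasisOfFinrankEq ℤ ((AddSubgroup.toIntSubmodule L).map f) (n := r) (by omega)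
  refine ⟨fun i => b i, ?_⟩
  have hb := congrArg (Submodule.map (Submodule.subtype _)) b.span_eq
  rw [Submodule.map_top, Submodule.range_subtype, Submodule.map_span, ← Set.range_comp] at hb
  exact hb.symm

/-- Otherwise the real span of the lattice would lie in the horizontal plane. -/
theorem IsLattice.exists_snd_ne_zero {L : AddSubgroup Space} (hL : IsLattice L) :
    ∃ z ∈ L, z.snd ≠ 0 := by
  by_contra! h
  obtain ⟨a, b, c, hli, rfl⟩ := hL
  have hle := gen3_le.1 (le_refl (gen3 a b c))
  let f : Space →ₗ[ℝ] ℝ := WithLp.sndₗ 2 ℝ Plane ℝ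
  have hspan : Submodule.span ℝ (Set.range ![a, b, c]) = ⊤ :=
    hli.span_eq_top_of_card_eq_finrank (by simp [finrank_space])
  have hk : Submodule.span ℝ (Set.range ![a, b, c]) ≤ LinearMap.ker f := by
    rw [Submodule.span_le]
    rintro _ ⟨i, rfl⟩
    fin_cases i
    exacts [h _ hle.1, h _ hle.2.1, h _ hle.2.2]
  rw [hspan] at hk
  have : f (pt 0 1) = 0 := hk (Submodule.mem_top (x := pt 0 1))
  exact one_ne_zero this

/-- The horizontal vectors have rank two, so the heights form an infinite cyclic group; a lattice
vector over a generator of it completes the basis. -/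
theorem exists_generator {L : AddSubgroup Space} (hL : IsLattice L)
    (hR : ∀ x, pt x 0 ∈ L ↔ x ∈ hexL) :
    ∃ c0 c, c ≠ 0 ∧ L = gen3 (pt h1 0) (pt h2 0) (pt c0 c) := by
  let f : Space →ₗ[ℤ] ℝ := AddMonoidHom.toIntLinearMap ⟨⟨fun z => z.snd, rfl⟩, fun _ _ => rfl⟩
  have hf : ∀ z, f z = z.snd := fun _ => rfl
  have hu : LinearIndependent ℤ ![pt h1 0, pt h2 0] := by
    rw [LinearIndependent.pair_iff]
    intro s t h
    rw [pt_zsmul, pt_zsmul, pt_add, ← pt_zero, pt_inj] at h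
    have := zsmul_comb_inj cross_h1_h2 (m := s) (n := t) (m' := 0) (n' := 0) (by simpa using h.1)
    exact this
  have hrange : Set.range ![pt h1 0, pt h2 0] = {pt h1 0, pt h2 0} := by
    simp [Set.pair_comm]
  obtain ⟨b, hb⟩ := exists_basis_map hL f (r := 1) _ hu (fun z => by
    rw [hrange, Submodule.mem_span_pair, ← pt_eta z, hf]
    change _ ∧ z.snd = 0 ↔ _
    simp only [pt_zsmul, pt_add, pt_inj, mul_zero, add_zero]
    constructor
    · rintro ⟨h, h0⟩
      rw [h0, hR, hexL, mem_gen2] at h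
      obtain ⟨m, n, h⟩ := h
      exact ⟨m, n, h.symm, h0.symm⟩
    · rintro ⟨m, n, h, h0⟩
      refine ⟨?_, h0.symm⟩
      rw [← h0, hR, hexL, mem_gen2]
      exact ⟨m, n, h.symm⟩) rfl
  have hb' : ∀ y, (∃ z ∈ L, z.snd = y) ↔ ∃ n : ℤ, y = n * b 0 := by
    intro y
    have : y ∈ (AddSubgroup.toIntSubmodule L).map f ↔ y ∈ Submodule.span ℤ (Set.range b) := by
      rw [hb]
    rw [show Set.range b = {b 0} by ext; simp [Fin.exists_fin_one, eq_comm],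
      Submodule.mem_span_singleton] at this
    simp only [zsmul_eq_mul] at this
    simp only [eq_comm (a := y)]
    exact this
  obtain ⟨w, hw, hwb⟩ := (hb' (b 0)).2 ⟨1, by simp⟩
  have hL' : L = gen3 (pt h1 0) (pt h2 0) (pt w.fst (b 0)) := by
    apply le_antisymm
    · intro z hz
      obtain ⟨n, hn⟩ := (hb' z.snd).1 ⟨z, hz, rfl⟩
      have h := sub_mem hz (zsmul_mem hw n)
      rw [← pt_eta z, ← pt_eta w, pt_zsmul, pt_sub, hn, hwb, sub_self, hR, hexL,
        mem_gen2] at h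
      obtain ⟨k, l, h⟩ := h
      rw [← pt_eta z, pt_mem_gen3]
      exact ⟨k, l, n, by rw [← h, sub_add_cancel], by rw [hn]; simp⟩
    · rw [gen3_le]
      refine ⟨(hR _).2 (left_mem_gen2 _ _), (hR _).2 (right_mem_gen2 _ _), ?_⟩
      rwa [← hwb, pt_eta]
  refine ⟨w.fst, b 0, fun h0 => ?_, hL'⟩
  obtain ⟨z, hz, hz'⟩ := hL.exists_snd_ne_zero
  obtain ⟨n, hn⟩ := (hb' z.snd).1 ⟨z, hz, rfl⟩
  rw [h0, mul_zero] at hn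
  exact hz' hn

theorem isTorsionFree_int (V : Type*) [AddCommGroup V] [Module ℝ V] :
    Module.IsTorsionFree ℤ V :=
  Module.IsTorsionFree.trans ℝ

theorem exists_basis_projL {L : AddSubgroup Space} (hL : IsLattice L) {c : ℝ} (hc : 0 < c)
    (hv : ∀ z, pt 0 z ∈ L ↔ ∃ n : ℤ, z = n * c) : ∃ a b, projL L = gen2 a b := by
  have := isTorsionFree_int Space
  have := isTorsionFree_int Plane
  have hu : LinearIndependent ℤ ![pt 0 c] := by
    rw [linearIndependent_unique_iff]
    intro h
    exact hc.ne' ((pt_inj.1 (h.trans pt_zero.symm)).2)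
  obtain ⟨b, hb⟩ := exists_basis_map hL projHom.toIntLinearMap (r := 2) _ hu (fun z => by
    rw [show Set.range ![pt 0 c] = {pt 0 c} by simp, Submodule.mem_span_singleton, ← pt_eta z]
    change _ ∧ z.fst = 0 ↔ _
    simp only [pt_zsmul, pt_inj, smul_zero]
    constructor
    · rintro ⟨h, h0⟩
      rw [h0, hv] at h
      obtain ⟨n, h⟩ := h
      exact ⟨n, h0.symm, h.symm⟩
    · rintro ⟨n, h0, h⟩
      refine ⟨?_, h0.symm⟩
      rw [← h0, hv]
      exact ⟨n, h.symm⟩) rfl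
  refine ⟨b 0, b 1, ?_⟩
  have h2 : AddSubgroup.toIntSubmodule (projL L) = AddSubgroup.toIntSubmodule (gen2 (b 0) (b 1)) := by
    rw [gen2, AddSubgroup.toIntSubmodule_closure]
    refine Eq.trans ?_ (hb.trans ?_)
    · rfl
    · congr 1
      ext z
      simp [Fin.exists_fin_two, eq_comm]
  exact AddSubgroup.toIntSubmodule.injective h2

section

/-! ### Completeness -/

variable {Γ : Subgroup Euc} {c : ℝ}

theorem mem_periods_vertical (hΓ : IsCryst Γ) {y0 : ℝ} (hy0 : 0 < y0) (h : pt 0 y0 ∈ trans Γ)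
    {p : Plane} : p ∈ periods Γ y0 ↔
      (∃ z, pt p z ∈ trans Γ) ∨ ∃ z, pt p z ∈ transSigma Γ := by
  rw [mem_periods hΓ hy0, ← exists_or]
  constructor
  · rintro (h | h | h)
    exacts [⟨_, Or.inl h⟩, ⟨_, Or.inr h⟩, h.2]
  · exact fun h' => Or.inr (Or.inr ⟨h, h'⟩)

/-- A vector of nonzero height minus its reflection is a nonzero vertical lattice vector, so the
vertical period is positive. -/
theorem exists_layered (hΓ : IsCryst Γ) (hσ : SigmaInv (trans Γ)) : ∃ c, Layered Γ c := by
  obtain ⟨c, hc, hv⟩ := exists_vertical hΓ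
  obtain ⟨z, hz, hz0⟩ := IsLattice.exists_snd_ne_zero hΓ
  refine ⟨c, lt_of_le_of_ne hc ?_, hv, hσ⟩
  rintro rfl
  have h := sub_mem hz (hσ z hz)
  rw [← pt_eta z, sigma_pt, pt_sub, sub_self, hv] at h
  obtain ⟨n, hn⟩ := h
  exact hz0 (by linarith)

theorem IndexTwo.exists_odd {S : AddSubgroup Plane} {α : Plane ≃ₗᵢ[ℝ] Plane} (hα : HolHex α)
    (hS : ∀ x, α x ∈ lat (4, 0, 0, 2) ↔ x ∈ S) {v : Plane} (hv : v ∈ hexL) (hvS : v ∉ S) :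
    ∃ m n : ℤ, α v = hh (2 * (2 * m + 1)) (2 * n) := by
  obtain ⟨m, n, e⟩ := mem_hexL.1 ((hα v).2 hv)
  rw [← hS, e, Layered.hh_mem_lat_four] at hvS
  obtain ⟨k, rfl | rfl⟩ := exists_parity m
  · omega
  · exact ⟨k, n, e⟩

theorem restr0_conjPlus_of {S : AddSubgroup Plane} {u : ℤ × ℤ × ℤ × ℤ} {α : Plane ≃ₗᵢ[ℝ] Plane}
    (hS : ∀ x, α x ∈ lat u ↔ x ∈ S) (h : ∀ x, pt x 0 ∈ trans Γ ↔ x ∈ S) :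
    ∀ x, pt x 0 ∈ trans (conjPlus α Γ) ↔ x ∈ lat u := by
  intro x
  obtain ⟨x, rfl⟩ := α.surjective x
  rw [mem_trans_conjPlus, hS, h]

/-- After normalising the subgroup, the glide outside it can be moved by horizontal vectors onto
`h1`. -/
theorem Layered.inTable_of_indexTwo (h : Layered Γ c) (hS : IndexTwo (restr0 (trans Γ)))
    {v : Plane} {y : ℝ} (hv : v ∈ hexL) (hvS : v ∉ restr0 (trans Γ))
    (hy : pt v y ∈ transSigma Γ) : InTable Γ := by
  obtain ⟨α, hα, hαS⟩ := hS.exists_holHex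
  obtain ⟨m, n, e⟩ := IndexTwo.exists_odd hα hαS hv hvS
  have hR := restr0_conjPlus_of hαS (fun x => Iff.rfl)
  refine InTable.of_conjPlus hα ((h.conjPlus α).inTable_of_glide hR (y := y) ?_)
  rw [← mem_transSigma_conjPlus (α := α), e] at hy
  exact transSigma_hh 2 0 hy ((hR _).2 (Layered.hh_mem_lat_four.2 (by omega)))

/-- A lattice without vertical vectors. -/
theorem case1_of_restr0 (hΓ : IsCryst Γ) (hR : ∀ x, pt x 0 ∈ trans Γ ↔ x ∈ hexL)
    (hv : ∀ z, pt 0 z ∈ trans Γ → z = 0) : Case1 (trans Γ) := by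
  obtain ⟨c0, c, hc, hL⟩ := exists_generator hΓ hR
  refine ⟨c0, c, hc, fun n hn h => ?_, hL⟩
  have h1 : pt c0 c ∈ trans Γ := by
    rw [hL, gen3]
    exact AddSubgroup.subset_closure (by simp)
  have h2 := sub_mem (zsmul_mem h1 n) ((hR _).2 h)
  rw [pt_zsmul, pt_sub, sub_self, sub_zero] at h2
  rcases mul_eq_zero.1 (hv _ h2) with h3 | h3
  · exact hn (by exact_mod_cast h3)
  · exact hc h3

theorem exists_Ico_mem {L : AddSubgroup Space} {c : ℝ} (hc : 0 < c)
    (hv : ∀ z, pt 0 z ∈ L ↔ ∃ n : ℤ, z = n * c) {p : Plane} (hp : ∃ z, pt p z ∈ L) :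
    ∃ z ∈ Set.Ico 0 c, pt p z ∈ L := by
  obtain ⟨z, hz⟩ := hp
  refine ⟨c * Int.fract (z / c), ⟨by have := Int.fract_nonneg (z / c); positivity, ?_⟩, ?_⟩
  · have := Int.fract_lt_one (z / c)
    nlinarith
  · have := add_mem hz ((hv _).2 ⟨-⌊z / c⌋, rfl⟩)
    rw [pt_add, add_zero] at this
    rw [Int.fract, mul_sub, mul_div_cancel₀ _ hc.ne']
    convert this using 2
    push_cast
    ring

/-- A lattice is generated by lifts of generators of its projection and a vertical vector. -/
theorem eq_gen3_of_projL {L : AddSubgroup Space} {c : ℝ}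
    (hv : ∀ z, pt 0 z ∈ L ↔ ∃ n : ℤ, z = n * c) {a b : Plane} (hP : projL L = gen2 a b)
    {a3 b3 : ℝ} (ha : pt a a3 ∈ L) (hb : pt b b3 ∈ L) :
    L = gen3 (pt a a3) (pt b b3) (pt 0 c) := by
  apply le_antisymm
  · intro z hz
    have hz' : z.fst ∈ projL L := mem_projL.2 ⟨z.snd, by rwa [pt_eta]⟩
    rw [hP, mem_gen2] at hz'
    obtain ⟨m, n, e⟩ := hz'
    have h := sub_mem hz (add_mem (zsmul_mem ha m) (zsmul_mem hb n))
    rw [← pt_eta z, pt_zsmul, pt_zsmul, pt_add, pt_sub, e, sub_self, hv] at h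
    obtain ⟨l, hl⟩ := h
    rw [← pt_eta z, mem_gen3_vertical]
    exact ⟨m, n, l, e, by linarith⟩
  · rw [gen3_le]
    exact ⟨ha, hb, (hv c).2 ⟨1, by simp⟩⟩

theorem case21_of_projL {L : AddSubgroup Space} {c : ℝ} (hc : 0 < c)
    (hv : ∀ z, pt 0 z ∈ L ↔ ∃ n : ℤ, z = n * c) (hσ : ¬SigmaInv L) (hP : projL L = hexL) :
    ∃ a3 b3 c : ℝ, Case21 L a3 b3 c := by
  obtain ⟨a3, ha, ha'⟩ := exists_Ico_mem hc hv (mem_projL.1 (hP.ge (left_mem_gen2 h1 h2)))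
  obtain ⟨b3, hb, hb'⟩ := exists_Ico_mem hc hv (mem_projL.1 (hP.ge (right_mem_gen2 h1 h2)))
  exact ⟨a3, b3, c, hc, ha, hb, eq_gen3_of_projL hv hP ha' hb', hσ⟩

/-- Expanding `h1` and `h2` in a basis of `𝒫(L)` yields the generators of `D`, because `D` is the
coordinate form of `ℛ₀(L)`. -/
theorem case22_of_restr0 {L : AddSubgroup Space} (hL : IsLattice L) {c : ℝ} (hc : 0 < c)
    (hv : ∀ z, pt 0 z ∈ L ↔ ∃ n : ℤ, z = n * c) (hσ : ¬SigmaInv L)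
    (hR : ∀ x, pt x 0 ∈ L ↔ x ∈ hexL) :
    ∃ (a b : Plane) (a3 b3 c : ℝ), Case22 L a b a3 b3 c := by
  obtain ⟨a, b, hP⟩ := exists_basis_projL hL hc hv
  obtain ⟨a3, ha, ha'⟩ := exists_Ico_mem hc hv (mem_projL.1 (hP.ge (left_mem_gen2 a b)))
  obtain ⟨b3, hb, hb'⟩ := exists_Ico_mem hc hv (mem_projL.1 (hP.ge (right_mem_gen2 a b)))
  have hgen := eq_gen3_of_projL hv hP ha' hb'
  have hmem : ∀ x ∈ hexL, ∃ m n : ℤ, m • a + n • b = x := by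
    intro x hx
    have := mem_projL.2 ⟨0, (hR x).2 hx⟩
    rw [hP, mem_gen2] at this
    obtain ⟨m, n, h⟩ := this
    exact ⟨m, n, h.symm⟩
  obtain ⟨m1, m2, e1⟩ := hmem h1 (left_mem_gen2 h1 h2)
  obtain ⟨n1, n2, e2⟩ := hmem h2 (right_mem_gen2 h1 h2)
  have hcr := cross_h1_h2
  rw [← e1, ← e2, cross_comb] at hcr
  have hdet := left_ne_zero_of_mul hcr
  have hab := right_ne_zero_of_mul hcr
  have hD : ∀ i j : ℤ, (i, j) ∈ modD a3 b3 c ↔ i • a + j • b ∈ hexL := by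
    intro i j
    rw [← hR]
    conv_rhs => rw [hgen]
    change _ ↔ i • a + j • b ∈ restr0 (gen3 (pt a a3) (pt b b3) (pt 0 c))
    rw [mem_restr0_gen3]
    constructor
    · exact fun h => ⟨_, h, rfl⟩
    · rintro ⟨⟨i', j'⟩, h, e⟩
      obtain ⟨rfl, rfl⟩ := zsmul_comb_inj hab e
      exact h
  refine ⟨a, b, a3, b3, c, hc, ha, hb, hgen, hσ, m1, m2, n1, n2, by exact_mod_cast hdet, ?_,
    e1, e2⟩
  ext ⟨i, j⟩
  rw [hD, hexL, mem_gen2, AddSubgroup.mem_closure_pair]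
  refine exists_congr fun k => exists_congr fun l => ?_
  have e : k • h1 + l • h2 = (k * m1 + l * n1) • a + (k * m2 + l * n2) • b := by
    rw [← e1, ← e2]; module
  rw [e]
  constructor
  · intro h
    obtain ⟨rfl, rfl⟩ := zsmul_comb_inj hab h
    simp
  · intro h
    simp only [Prod.smul_mk, Prod.mk_add_mk, Prod.mk.injEq, smul_eq_mul] at h
    rw [h.1, h.2]

/-- The hexagonal lattice is here the union of `ℛ₀(L)` and the projections of glides at height `y0`,
which form one coset if there are any. Hence `ℛ₀(L)` is everything or has index two, and in the
latter case a glide supplies `σ`-invariance. -/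
theorem complete_of_not_mem (hΓ : IsCryst Γ) {y0 : ℝ} (hy0 : 0 < y0) (hper : periods Γ y0 = hexL)
    (hy : pt 0 y0 ∉ trans Γ) : Case1 (trans Γ) ∨
      (∃ (a b : Plane) (a3 b3 c : ℝ), Case22 (trans Γ) a b a3 b3 c) ∨ InTable Γ := by
  have hmem : ∀ p, p ∈ hexL ↔ pt p 0 ∈ trans Γ ∨ pt p y0 ∈ transSigma Γ := by
    intro p
    rw [← hper, mem_periods hΓ hy0]
    simp [hy]
  by_cases hR : ∀ p ∈ hexL, pt p 0 ∈ trans Γ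
  · replace hR : ∀ x, pt x 0 ∈ trans Γ ↔ x ∈ hexL :=
      fun x => ⟨fun h => (hmem x).2 (Or.inl h), hR x⟩
    obtain ⟨c, hc, hv⟩ := exists_vertical hΓ
    rcases hc.eq_or_lt with rfl | hc
    · refine Or.inl (case1_of_restr0 hΓ hR fun z hz => ?_)
      obtain ⟨n, hn⟩ := (hv z).1 hz
      rw [hn, mul_zero]
    · by_cases hσ : SigmaInv (trans Γ)
      · exact Or.inr (Or.inr (Layered.inTable_of_restr0 ⟨hc, hv, hσ⟩ hR))
      · exact Or.inr (Or.inl (case22_of_restr0 hΓ hc hv hσ hR))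
  · push Not at hR
    obtain ⟨w, hw, hw0⟩ := hR
    have hwσ := ((hmem w).1 hw).resolve_left hw0
    obtain ⟨c, h⟩ := exists_layered hΓ (sigmaInv_of_transSigma hwσ)
    refine Or.inr (Or.inr (h.inTable_of_indexTwo ⟨fun p hp => (hmem p).2 (Or.inl hp), w, hw, hw0,
      fun p hp => ?_⟩ hw hw0 hwσ))
    refine ((hmem p).1 hp).imp id fun hp => ?_
    rw [mem_transSigma_iff_sub hwσ, pt_sub, sub_self] at hp
    exact hp

/-- The same dichotomy for `𝒫(L)` and the projection of all of `L_σ`. For a `σ`-invariant lattice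
the half-height vectors then decide whether `ℛ₀(L)` equals `𝒫(L)` or has index two in it. -/
theorem complete_of_mem (hΓ : IsCryst Γ) {y0 : ℝ} (hy0 : 0 < y0) (hper : periods Γ y0 = hexL)
    (hy : pt 0 y0 ∈ trans Γ) : (∃ a3 b3 c : ℝ, Case21 (trans Γ) a3 b3 c) ∨ InTable Γ := by
  have hmem : ∀ p, p ∈ hexL ↔ (∃ z, pt p z ∈ trans Γ) ∨ ∃ z, pt p z ∈ transSigma Γ := by
    intro p
    rw [← hper, mem_periods_vertical hΓ hy0 hy]
  obtain ⟨c, hc, hv⟩ := exists_vertical hΓ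
  replace hc : 0 < c := by
    obtain ⟨n, hn⟩ := (hv y0).1 hy
    refine lt_of_le_of_ne hc ?_
    rintro rfl
    rw [mul_zero] at hn
    exact hy0.ne' hn
  by_cases hP : ∀ p ∈ hexL, ∃ z, pt p z ∈ trans Γ
  · by_cases hσ : SigmaInv (trans Γ)
    · right
      have h : Layered Γ c := ⟨hc, hv, hσ⟩
      by_cases h1 : ∃ w, pt w (c / 2) ∈ trans Γ
      · obtain ⟨w, hw⟩ := h1
        have hwH : w ∈ hexL := (hmem w).2 (Or.inl ⟨_, hw⟩)
        have hw0 : w ∉ restr0 (trans Γ) := h.half_not_mem hw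
        have hS : IndexTwo (restr0 (trans Γ)) := by
          refine ⟨fun p hp => (hmem p).2 (Or.inl ⟨_, hp⟩), w, hwH, hw0, fun p hp => ?_⟩
          refine (h.exists_mem_iff.1 (hP p hp)).imp id fun hp => ?_
          rwa [← add_sub_cancel w p, Layered.mem_of_half hw] at hp
        obtain ⟨α, hα, hαS⟩ := hS.exists_holHex
        obtain ⟨m, n, e⟩ := IndexTwo.exists_odd hα hαS hwH hw0
        have hR := restr0_conjPlus_of hαS (fun x => Iff.rfl)
        refine InTable.of_conjPlus hα ((h.conjPlus α).inTable_of_half hR ?_ fun v hv => ?_)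
        · rw [← mem_trans_conjPlus (α := α), e] at hw
          exact trans_hh 2 0 hw ((hR _).2 (Layered.hh_mem_lat_four.2 (by omega)))
        · obtain ⟨p, hp⟩ := α.surjective v.fst
          rw [← pt_eta v, ← hp, mem_transSigma_conjPlus] at hv
          rw [← hp, hα]
          exact (hmem p).2 (Or.inr ⟨_, hv⟩)
      · push Not at h1
        refine h.inTable_of_restr0 fun x => ⟨fun hx => (hmem x).2 (Or.inl ⟨_, hx⟩), fun hx => ?_⟩
        exact (h.exists_mem_iff.1 (hP x hx)).resolve_right (h1 x)
    · left
      refine case21_of_projL hc hv hσ ?_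
      ext p
      rw [mem_projL]
      exact ⟨fun hp => (hmem p).2 (Or.inl hp), hP p⟩
  · right
    push Not at hP
    obtain ⟨v, hvH, hvP⟩ := hP
    obtain ⟨y, hvy⟩ := ((hmem v).1 hvH).resolve_left (by simpa using hvP)
    have h : Layered Γ c := ⟨hc, hv, sigmaInv_of_transSigma hvy⟩
    have hvP' : v ∉ projL (trans Γ) := by simpa [mem_projL] using hvP
    have hS : IndexTwo (projL (trans Γ)) := by
      refine ⟨fun p hp => (hmem p).2 (Or.inl (mem_projL.1 hp)), v, hvH, hvP', fun p hp => ?_⟩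
      refine ((hmem p).1 hp).imp mem_projL.2 ?_
      rintro ⟨z, hz⟩
      rw [mem_transSigma_iff_sub hvy, pt_sub] at hz
      exact mem_projL.2 ⟨_, hz⟩
    by_cases h1 : ∃ w, pt w (c / 2) ∈ trans Γ
    · obtain ⟨w, hw⟩ := h1
      obtain ⟨α, hα, hαS⟩ := hS.exists_holHex
      obtain ⟨m, n, e⟩ := IndexTwo.exists_odd hα hαS hvH hvP'
      -- `inTable_of_proj` expects the index-two subgroup containing `h1`, so the normal form is
      -- reflected once more.
      have e' : (α.trans swapHex) v = hh (2 * n) (2 * (2 * m + 1)) := by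
        rw [LinearIsometryEquiv.trans_apply, e, swapHex_hh]
      rw [← mem_transSigma_conjPlus (α := α.trans swapHex), e'] at hvy
      rw [← mem_trans_conjPlus (α := α.trans swapHex)] at hw
      refine InTable.of_conjPlus (hα.trans holHex_swapHex)
        ((h.conjPlus _).inTable_of_proj (fun x => ?_) hw hvy ?_)
      · obtain ⟨x, rfl⟩ := (α.trans swapHex).surjective x
        simp only [mem_trans_conjPlus]
        rw [LinearIsometryEquiv.trans_apply, Layered.mem_lat_swapHex, hαS, mem_projL]
      · rw [Layered.hh_mem_lat_four']
        omega
    · push Not at h1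
      have hPR : projL (trans Γ) = restr0 (trans Γ) := by
        ext p
        rw [mem_projL, h.exists_mem_iff, or_iff_left (h1 p)]
        rfl
      rw [hPR] at hS hvP'
      exact h.inTable_of_indexTwo hS hvH hvP' hvy

theorem complete (hΓ : IsCryst Γ) {y0 : ℝ} (hy0 : 0 < y0) (hper : periods Γ y0 = hexL) :
    Case1 (trans Γ) ∨ (∃ a3 b3 c : ℝ, Case21 (trans Γ) a3 b3 c) ∨
      (∃ (a b : Plane) (a3 b3 c : ℝ), Case22 (trans Γ) a b a3 b3 c) ∨ InTable Γ := by
  by_cases hy : pt 0 y0 ∈ trans Γ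
  · rcases complete_of_mem hΓ hy0 hper hy with h | h
    exacts [Or.inr (Or.inl h), Or.inr (Or.inr (Or.inr h))]
  · rcases complete_of_not_mem hΓ hy0 hper hy with h | h | h
    exacts [Or.inl h, Or.inr (Or.inr (Or.inl h)), Or.inr (Or.inr (Or.inr h))]

end

section

/-- Lets the families of rhombohedral lattices be used with negative `c`. -/
theorem widths_zero_neg (c : ℝ) : widths 0 (-c) = widths 0 c := by
  ext y0
  refine and_congr_right fun _ => ⟨?_, ?_⟩ <;>
    exact fun ⟨n, hn⟩ => ⟨-n, by rw [hn]; push_cast; ring⟩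

theorem ProjectsTo.neg {L : AddSubgroup Space} {c : ℝ} {P R : AddSubgroup Plane}
    (h : ProjectsTo L c P R) : ProjectsTo L (-c) P R := by
  rw [ProjectsTo, widths_zero_neg]
  exact h

/-! ### All widths -/

variable {Γ : Subgroup Euc}

theorem Case21.vertical {L : AddSubgroup Space} {a3 b3 c : ℝ} (h : Case21 L a3 b3 c) :
    0 < c ∧ (∀ z : ℝ, pt 0 z ∈ L ↔ ∃ n : ℤ, z = n * c) ∧ ¬SigmaInv L := by
  obtain ⟨hc, -, -, rfl, hσ⟩ := h
  exact ⟨hc, fun z => vertical_mem_gen3 cross_h1_h2, hσ⟩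

theorem Case22.vertical {L : AddSubgroup Space} {a b : Plane} {a3 b3 c : ℝ}
    (h : Case22 L a b a3 b3 c) :
    0 < c ∧ (∀ z : ℝ, pt 0 z ∈ L ↔ ∃ n : ℤ, z = n * c) ∧ ¬SigmaInv L := by
  have hab := h.cross_ne_zero
  obtain ⟨hc, -, -, rfl, hσ, -⟩ := h
  exact ⟨hc, fun z => vertical_mem_gen3 hab, hσ⟩

theorem Case21.projL_eq {L : AddSubgroup Space} {a3 b3 c : ℝ} (h : Case21 L a3 b3 c) :
    projL L = hexL := by
  obtain ⟨-, -, -, rfl, -⟩ := h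
  exact projL_gen3 _ _ _ _ _

theorem Case22.projL_eq {L : AddSubgroup Space} {a b : Plane} {a3 b3 c : ℝ}
    (h : Case22 L a b a3 b3 c) : projL L = gen2 a b := by
  obtain ⟨-, -, -, rfl, -⟩ := h
  exact projL_gen3 _ _ _ _ _

theorem half_not_mem_widths {c : ℝ} (hc : 0 < c) : c / 2 ∉ widths 0 c := by
  rintro ⟨-, n, hn⟩
  have h2 : (1 : ℝ) = 2 * n := mul_right_cancel₀ hc.ne' (by linarith)
  have : (1 : ℤ) = 2 * n := by exact_mod_cast h2
  omega

theorem self_mem_widths {c : ℝ} (hc : 0 < c) : c ∈ widths 0 c := ⟨hc, 1, by simp⟩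

/-- If `σ L ⊄ L`, both the projection and the horizontal part of the lattice are attained. -/
theorem exists_periods_eq (hΓ : IsCryst Γ) {c : ℝ} (hc : 0 < c)
    (hv : ∀ z : ℝ, pt 0 z ∈ trans Γ ↔ ∃ n : ℤ, z = n * c) (hσ : ¬SigmaInv (trans Γ)) :
    (∃ y0, 0 < y0 ∧ periods Γ y0 = projL (trans Γ)) ∧
      ∃ y0, 0 < y0 ∧ pt 0 y0 ∉ trans Γ ∧ periods Γ y0 = restr0 (trans Γ) := by
  refine ⟨⟨c, hc, (periods_of_not_sigmaInv hΓ hv hσ hc).1 (self_mem_widths hc)⟩, c / 2,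
    by positivity, fun h => half_not_mem_widths hc ⟨by positivity, ?_⟩,
    (periods_of_not_sigmaInv hΓ hv hσ (by positivity)).2 (half_not_mem_widths hc)⟩
  simpa using (hv _).1 h

/-- The dichotomy behind the statements on all widths: either a constant column, or a width whose
periods are neither hexagonal nor three-fold symmetric. -/
theorem InTable.cases (hΓ : IsCryst Γ) (h : InTable Γ) :
    (∃ c y1, trans Γ = gen3 (pt h1 0) (pt h2 0) (pt 0 c) ∧ 0 < c ∧
      (col31.Has Γ c y1 ∨ col41a.Has Γ c y1)) ∨ ∃ y0, 0 < y0 ∧ IsRect (periods Γ y0) := by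
  obtain ⟨α, hα, k, hk, c, y1, h⟩ := h
  rw [columns_eq, List.mem_map] at hk
  obtain ⟨k, hk, rfl⟩ := hk
  rcases codes_rect k hk with ⟨hP, hs, hv⟩ | hr
  · exact Or.inl ⟨c, y1, Code.constant_of_conjPlus hα h hP hs hv⟩
  · obtain ⟨y0, hy0, hrect⟩ :=
      Code.exists_isRect (hΓ.conjPlus α) (codes_valid k hk) (codes_table k hk) h hr
    exact Or.inr ⟨y0, hy0, hrect.of_conjPlus hΓ hy0⟩

theorem periodTable_of_mem_columns (hΓ : IsCryst Γ) {k : Column} (hk : k ∈ columns) {c y1 : ℝ}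
    (h : k.Has Γ c y1) : PeriodTable Γ c y1 k.onA k.onB k.onC k.onO := by
  rw [columns_eq, List.mem_map] at hk
  obtain ⟨k, hk, rfl⟩ := hk
  exact Code.periodTable hΓ (codes_valid k hk) (codes_table k hk) h

theorem PeriodTable.periods_eq {c y1 : ℝ} {M : AddSubgroup Plane} (h : PeriodTable Γ c y1 M M M M)
    {y0 : ℝ} (hy0 : 0 < y0) : periods Γ y0 = M := by
  obtain ⟨hA, hB, hC, hO⟩ := h y0 hy0
  by_cases h1 : y0 ∈ widths 0 c
  · exact hA h1
  by_cases h2 : y0 ∈ widths y1 c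
  · exact hB ⟨h2, h1⟩
  by_cases h3 : y0 ∈ widths (y1 + c / 2) c
  · exact hC ⟨h3, h1⟩
  exact hO (by simp [h1, h2, h3])

theorem periods_eq_hexL_of_constant (hΓ : IsCryst Γ)
    (h : Case1 (trans Γ) ∨ (∃ c y1 : ℝ, col31.Has Γ c y1) ∨ ∃ c y1 : ℝ, col41a.Has Γ c y1)
    {y0 : ℝ} (hy0 : 0 < y0) : periods Γ y0 = hexL := by
  rcases h with h | ⟨c, y1, h⟩ | ⟨c, y1, h⟩
  · exact Case1.periods_eq hΓ h hy0
  · exact PeriodTable.periods_eq (periodTable_of_mem_columns hΓ (by simp [columns]) h) hy0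
  · exact PeriodTable.periods_eq (periodTable_of_mem_columns hΓ (by simp [columns]) h) hy0

/-- If `σ L ⊄ L`, both `𝒫(L)` and `ℛ₀(L)` occur as periods and one of them differs from the
hexagonal lattice; the other columns are excluded by a rectangular width. -/
theorem constant_iff (hΓ : IsCryst Γ) (hex : ∃ y0 : ℝ, 0 < y0 ∧ periods Γ y0 = hexL) :
    (∀ y0 : ℝ, 0 < y0 → periods Γ y0 = hexL) ↔
      Case1 (trans Γ) ∨ (∃ c y1 : ℝ, col31.Has Γ c y1) ∨ ∃ c y1 : ℝ, col41a.Has Γ c y1 := by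
  refine ⟨fun hall => ?_, fun h y0 hy0 => periods_eq_hexL_of_constant hΓ h hy0⟩
  obtain ⟨y0, hy0, hper⟩ := hex
  rcases complete hΓ hy0 hper with h | ⟨a3, b3, c, h⟩ | ⟨a, b, a3, b3, c, h⟩ | h
  · exact Or.inl h
  · obtain ⟨hc, hv, hσ⟩ := h.vertical
    obtain ⟨-, y, hy, -, e⟩ := exists_periods_eq hΓ hc hv hσ
    exact absurd (e.symm.trans (hall y hy)) h.properties.2.1.ne
  · obtain ⟨hc, hv, hσ⟩ := h.vertical
    obtain ⟨⟨y, hy, e⟩, -⟩ := exists_periods_eq hΓ hc hv hσ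
    rw [h.projL_eq] at e
    exact absurd (e.symm.trans (hall y hy)) h.hexL_lt.ne'
  · rcases h.cases hΓ with ⟨c, y1, -, -, h | h⟩ | ⟨y, hy, h⟩
    · exact Or.inr (Or.inl ⟨c, y1, h⟩)
    · exact Or.inr (Or.inr ⟨c, y1, h⟩)
    · rw [hall y hy] at h
      exact absurd isHexagonal_hexL h.not_isHexagonal

theorem hexagonal_iff (hΓ : IsCryst Γ) (hex : ∃ y0 : ℝ, 0 < y0 ∧ periods Γ y0 = hexL) :
    (∀ y0 : ℝ, 0 < y0 → IsHexagonal (periods Γ y0)) ↔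
      Case1 (trans Γ) ∨ (∃ c y1 : ℝ, col31.Has Γ c y1) ∨ (∃ c y1 : ℝ, col41a.Has Γ c y1) ∨
        (((∃ a3 b3 c : ℝ, Case21 (trans Γ) a3 b3 c) ∨
            (∃ (a b : Plane) (a3 b3 c : ℝ), Case22 (trans Γ) a b a3 b3 c)) ∧
          IsHexagonal (projL (trans Γ)) ∧ IsHexagonal (restr0 (trans Γ))) := by
  constructor
  · intro hall
    have hhex : ∀ c : ℝ, 0 < c → (∀ z : ℝ, pt 0 z ∈ trans Γ ↔ ∃ n : ℤ, z = n * c) →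
        ¬SigmaInv (trans Γ) → IsHexagonal (projL (trans Γ)) ∧ IsHexagonal (restr0 (trans Γ)) := by
      intro c hc hv hσ
      obtain ⟨⟨y, hy, e⟩, y', hy', -, e'⟩ := exists_periods_eq hΓ hc hv hσ
      exact ⟨e ▸ hall y hy, e' ▸ hall y' hy'⟩
    obtain ⟨y0, hy0, hper⟩ := hex
    rcases complete hΓ hy0 hper with h | ⟨a3, b3, c, h⟩ | ⟨a, b, a3, b3, c, h⟩ | h
    · exact Or.inl h
    · obtain ⟨hc, hv, hσ⟩ := h.vertical
      exact Or.inr (Or.inr (Or.inr ⟨Or.inl ⟨a3, b3, c, h⟩, hhex c hc hv hσ⟩))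
    · obtain ⟨hc, hv, hσ⟩ := h.vertical
      exact Or.inr (Or.inr (Or.inr ⟨Or.inr ⟨a, b, a3, b3, c, h⟩, hhex c hc hv hσ⟩))
    · rcases h.cases hΓ with ⟨c, y1, -, -, h | h⟩ | ⟨y, hy, h⟩
      · exact Or.inr (Or.inl ⟨c, y1, h⟩)
      · exact Or.inr (Or.inr (Or.inl ⟨c, y1, h⟩))
      · exact absurd (hall y hy) h.not_isHexagonal
  · intro h y0 hy0
    have key : (Case1 (trans Γ) ∨ (∃ c y1 : ℝ, col31.Has Γ c y1) ∨
        ∃ c y1 : ℝ, col41a.Has Γ c y1) → IsHexagonal (periods Γ y0) := by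
      intro h
      rw [periods_eq_hexL_of_constant hΓ h hy0]
      exact isHexagonal_hexL
    rcases h with h | h | h | ⟨h, hP, hR⟩
    · exact key (Or.inl h)
    · exact key (Or.inr (Or.inl h))
    · exact key (Or.inr (Or.inr h))
    · have hσ : ∃ c : ℝ, 0 < c ∧ (∀ z : ℝ, pt 0 z ∈ trans Γ ↔ ∃ n : ℤ, z = n * c) ∧
          ¬SigmaInv (trans Γ) := by
        rcases h with ⟨a3, b3, c, h⟩ | ⟨a, b, a3, b3, c, h⟩
        exacts [⟨c, h.vertical⟩, ⟨c, h.vertical⟩]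
      obtain ⟨c, -, hv, hσ⟩ := hσ
      obtain ⟨hA, hO⟩ := periods_of_not_sigmaInv hΓ hv hσ hy0
      by_cases hy : y0 ∈ widths 0 c
      · rwa [hA hy]
      · rwa [hO hy]

end

section

/-! ### Rotations of order three -/

/-- The relation `1 + ρ + ρ² = 0` is the source of all later linear conditions. -/
theorem rot3_rot3 (x : Plane) : rot3 (rot3 x) = -x - rot3 x := by
  simp only [rot3_apply]
  apply plane_ext <;> simp
  · linear_combination (-x 0 / 4) * sqrt3_sq
  · linear_combination (-x 1 / 4) * sqrt3_sq

theorem exists_comb {a b : Plane} (h : cross a b ≠ 0) (x : Plane) :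
    ∃ s t : ℝ, x = s • a + t • b := by
  refine ⟨cross x b / cross a b, cross a x / cross a b, ?_⟩
  unfold cross at *
  apply plane_ext <;> simp <;>
    rw [div_mul_eq_mul_div, div_mul_eq_mul_div, ← add_div, eq_div_iff h] <;> ring

/-- An isometry of order three of the plane is the rotation by `±2π/3`. -/
theorem eq_rot3 {ρ : Plane ≃ₗᵢ[ℝ] Plane} (h1 : ρ ≠ 1) (h3 : ρ ^ 3 = 1) :
    (∀ x, ρ x = rot3 x) ∨ ∀ x, ρ x = rot3 (rot3 x) := by
  have hcube : ∀ x, ρ (ρ (ρ x)) = x := fun x => by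
    change (ρ ^ 3) x = x
    rw [h3]; rfl
  obtain ⟨x, hx⟩ : ∃ x, ρ x ≠ x := by
    by_contra! h
    exact h1 (LinearIsometryEquiv.ext h)
  -- The sum of `d`, `ρ d` and `ρ² d` telescopes to zero because `ρ³ = 1`, although `ρ` is not yet
  -- known to be a rotation.
  obtain ⟨d, hd⟩ : ∃ d, d = ρ x - x := ⟨_, rfl⟩
  have hd0 : d ≠ 0 := by rw [hd]; exact sub_ne_zero.2 hx
  have hρρ : ρ (ρ d) = -d - ρ d := by
    rw [hd, map_sub, map_sub, hcube]
    abel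
  have hN : 0 < ‖d‖ ^ 2 := by positivity
  have n1 : ‖ρ d‖ ^ 2 = ‖d‖ ^ 2 := by rw [ρ.norm_map]
  have n2 : ‖-d - ρ d‖ ^ 2 = ‖d‖ ^ 2 := by rw [← hρρ, ρ.norm_map, ρ.norm_map]
  rw [norm_sq_plane] at hN
  rw [norm_sq_plane, norm_sq_plane] at n1 n2
  simp only [PiLp.sub_apply, PiLp.neg_apply] at n2
  -- The vectors `d`, `ρ d` and `-d - ρ d` have equal length, which fixes the cosine at `-1/2`; the
  -- determinant is then `±√3/2` times `‖d‖²`.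
  have hin : d 0 * ρ d 0 + d 1 * ρ d 1 = -(d 0 ^ 2 + d 1 ^ 2) / 2 := by
    linear_combination n2 / 2 - n1 / 2
  have hcr : (cross d (ρ d) - √3 / 2 * (d 0 ^ 2 + d 1 ^ 2)) *
      (cross d (ρ d) + √3 / 2 * (d 0 ^ 2 + d 1 ^ 2)) = 0 := by
    unfold cross
    linear_combination (d 0 ^ 2 + d 1 ^ 2) * n1 - (d 0 * ρ d 0 + d 1 * ρ d 1 -
      (d 0 ^ 2 + d 1 ^ 2) / 2) * hin - (d 0 ^ 2 + d 1 ^ 2) ^ 2 / 4 * sqrt3_sq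
  have hcr0 : cross d (ρ d) ≠ 0 := by
    intro h
    rw [h] at hcr
    have := sqrt3_pos
    have : 0 < √3 / 2 * (d 0 ^ 2 + d 1 ^ 2) := by positivity
    nlinarith
  have hsol : ∀ e : ℝ, cross d (ρ d) = e * (d 0 ^ 2 + d 1 ^ 2) →
      ρ d 0 = -(1 / 2) * d 0 - e * d 1 ∧ ρ d 1 = e * d 0 + -(1 / 2) * d 1 := by
    intro e he
    unfold cross at he
    constructor <;> refine mul_left_cancel₀ hN.ne' ?_
    · linear_combination d 0 * hin - d 1 * he
    · linear_combination d 1 * hin + d 0 * he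
  -- two isometries that satisfy the same quadratic equation and agree at `d` are equal
  have key : ∀ τ : Plane →ₗ[ℝ] Plane, τ d = ρ d → τ (τ d) = -d - τ d → ∀ x, ρ x = τ x := by
    intro τ e1 e2 x
    obtain ⟨s, t, rfl⟩ := exists_comb hcr0 x
    rw [map_add, map_add, map_smul, map_smul, map_smul, map_smul, hρρ, ← e1, e2]
  have h33 := rot3_rot3 d
  rcases mul_eq_zero.1 hcr with h | h
  · left
    obtain ⟨e0, e1⟩ := hsol (√3 / 2) (by linarith)
    refine key rot3.toLinearEquiv.toLinearMap ?_ h33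
    change rot3 d = ρ d
    rw [rot3_apply]
    apply plane_ext
    exacts [e0.symm, e1.symm]
  · right
    obtain ⟨e0, e1⟩ := hsol (-(√3 / 2)) (by linarith)
    refine key (rot3.toLinearEquiv.toLinearMap ∘ₗ rot3.toLinearEquiv.toLinearMap) ?_ ?_
    · change rot3 (rot3 d) = ρ d
      rw [h33, rot3_apply]
      apply plane_ext <;> simp [e0, e1] <;> ring
    · change rot3 (rot3 (rot3 (rot3 d))) = -d - rot3 (rot3 d)
      rw [rot3_cube, h33]
      abel

variable {Γ : Subgroup Euc}

/-- A three-fold symmetry of the projected functions is a symmetry of the lattice. -/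
theorem rot3_mem_trans (hΓ : IsCryst Γ) (hσ : ¬SigmaInv (trans Γ)) {y0 : ℝ} (hy0 : 0 < y0)
    (hy : pt 0 y0 ∉ trans Γ) {v : Plane} {ρ : Plane ≃ₗᵢ[ℝ] Plane} (h1 : ρ ≠ 1) (h3 : ρ ^ 3 = 1)
    (hs : IsProjSymm Γ y0 v ρ) {p : Plane} {z : ℝ} (hp : pt p z ∈ trans Γ) :
    pt (rot3 p) z ∈ trans Γ := by
  have hcube : ∀ x, ρ (ρ (ρ x)) = x := fun x => by
    change (ρ ^ 3) x = x
    rw [h3]; rfl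
  have hup : upEl v ρ 0 ∈ Γ := by
    rcases symm_cases hΓ hy0 hs with h | h | h
    · exact h
    · exfalso
      -- The cube of an element that reverses heights still reverses them but has trivial planar
      -- part, so `σ` would belong to the point group.
      have h2 := Γ.mul_mem h (Γ.mul_mem h h)
      have e : downEl v ρ y0 * (downEl v ρ y0 * downEl v ρ y0) =
          downEl (v + ρ v + ρ (ρ v)) 1 y0 := by
        apply euc_ext
        intro x y
        rw [mul_apply', mul_apply']
        simp only [downEl_apply, pt_inj, map_add, hcube]
        exact ⟨by simp only [LinearIsometryEquiv.coe_one, id]; abel, by ring⟩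
      rw [e, ← mem_transSigma_iff] at h2
      exact hσ (sigmaInv_of_transSigma h2)
    · exact absurd h.1 hy
  have hinv : ∀ {p z}, pt p z ∈ trans Γ → pt (ρ p) z ∈ trans Γ := by
    intro p z hp
    have h := linear_mem_trans hup hp
    have e := apply_eq_add (upEl v ρ 0) (pt p z)
    have e0 : upEl v ρ 0 0 = pt v 0 := by
      rw [← pt_zero, upEl_apply, map_zero, add_zero, add_zero]
    rw [upEl_apply, e0, ← sub_eq_iff_eq_add, pt_sub, add_sub_cancel_left, zero_add, sub_zero] at e
    rwa [← e] at h
  rcases eq_rot3 h1 h3 with h | h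
  · rw [← h]
    exact hinv hp
  · have := hinv (hinv hp)
    rwa [h, h, rot3_cube] at this

/-! ### Lattices with three-fold symmetry -/

/-- A vertical lattice vector would make a multiple of `c0` a hexagonal vector. A `σ`-invariant
lattice has nonzero vertical vectors, so invariance fails. -/
theorem not_sigmaInv_of_case1 (hΓ : IsCryst Γ) (h : Case1 (trans Γ)) :
    ¬SigmaInv (trans Γ) ∧ (∀ x, pt x 0 ∈ trans Γ → x ∈ hexL) ∧ ∀ z, pt 0 z ∈ trans Γ → z = 0 := by
  obtain ⟨c0, c, hc, hn, hL⟩ := h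
  have hv : ∀ z, pt 0 z ∈ trans Γ → z = 0 := by
    intro z hz
    rw [hL, pt_mem_gen3] at hz
    obtain ⟨m, n, l, h, e⟩ := hz
    rcases eq_or_ne l 0 with rfl | hl
    · simpa using e
    · refine absurd ?_ (hn l hl)
      rw [hexL, mem_gen2]
      refine ⟨-m, -n, ?_⟩
      rw [neg_smul, neg_smul, ← neg_add, ← sub_eq_zero, sub_neg_eq_add, add_comm, ← h]
  refine ⟨fun hσ => ?_, fun x hx => ?_, hv⟩
  · obtain ⟨c', h⟩ := exists_layered hΓ hσ
    exact h.pos.ne' (hv c' ((h.vert c').2 ⟨1, by simp⟩))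
  · rw [hL, pt_mem_gen3] at hx
    obtain ⟨m, n, l, rfl, e⟩ := hx
    have hl : l = 0 := by simpa [hc] using e
    rw [hl, zero_smul, add_zero, hexL, mem_gen2]
    exact ⟨m, n, rfl⟩

/-- Applying `2 - ρ - ρ² = 3` to `(c0, c)` cancels the height and puts `3 c0` into the hexagonal
lattice. -/
theorem not_case1_of_rot3 (hΓ : IsCryst Γ)
    (hrot : ∀ p z, pt p z ∈ trans Γ → pt (rot3 p) z ∈ trans Γ) : ¬Case1 (trans Γ) := by
  intro h
  obtain ⟨-, hR, -⟩ := not_sigmaInv_of_case1 hΓ h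
  obtain ⟨c0, c, hc, hn, hL⟩ := h
  have h0 : pt c0 c ∈ trans Γ := by
    rw [hL, gen3]
    exact AddSubgroup.subset_closure (by simp)
  have h1 := hrot _ _ h0
  have h2 := hrot _ _ h1
  have h3 := sub_mem (sub_mem (add_mem h0 h0) h1) h2
  rw [pt_add, pt_sub, pt_sub, rot3_rot3, show c + c - c - c = 0 by ring] at h3
  refine hn 3 (by norm_num) ?_
  have h4 := hR _ h3
  convert h4 using 1
  module

/-- The relations `ρ h2 + h1 = 0` and `ρ h1 - h2 + h1 = 0`, lifted to the lattice, give vertical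
vectors of heights `a3 + b3` and `2 a3 - b3`. Both heights are thus thirds of `c`, and only `(1, 2)`
and `(2, 1)` remain besides `(0, 0)`. -/
theorem case21_threefold {L : AddSubgroup Space} {a3 b3 c : ℝ} (h : Case21 L a3 b3 c)
    (hrot : ∀ p z, pt p z ∈ L → pt (rot3 p) z ∈ L) : L = rhombA c ∨ L = rhombA (-c) := by
  obtain ⟨hc, hv, -⟩ := h.vertical
  have hne := h.properties.1
  obtain ⟨-, ha, hb, hL, -⟩ := h
  have m1 : pt h1 a3 ∈ L := by rw [hL, gen3]; exact AddSubgroup.subset_closure (by simp)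
  have m2 : pt h2 b3 ∈ L := by rw [hL, gen3]; exact AddSubgroup.subset_closure (by simp)
  have e1 := add_mem (hrot _ _ m2) m1
  have e2 := add_mem (sub_mem (hrot _ _ m1) m2) m1
  rw [rot3_h2, pt_add, neg_add_cancel, hv] at e1
  rw [rot3_h1, pt_sub, pt_add, show h2 - h1 - h2 + h1 = 0 by abel, hv] at e2
  obtain ⟨k, hk⟩ := e1
  obtain ⟨l, hl⟩ := e2
  have ek : 3 * a3 = (k + l : ℤ) * c := by push_cast; linarith
  have el : 3 * b3 = (2 * k - l : ℤ) * c := by push_cast; linarith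
  have bound : ∀ {a : ℝ} {j : ℤ}, a ∈ Set.Ico 0 c → 3 * a = j * c → 0 ≤ j ∧ j < 3 := by
    intro a j ha e
    have h1 : (0 : ℝ) ≤ j := by
      by_contra! h
      nlinarith [ha.1]
    have h2 : (j : ℝ) < 3 := by
      by_contra! h
      nlinarith [ha.2]
    exact ⟨by exact_mod_cast h1, by exact_mod_cast h2⟩
  have b1 := bound ha ek
  have b2 := bound hb el
  have hcases : (k + l = 0 ∧ 2 * k - l = 0) ∨ (k + l = 1 ∧ 2 * k - l = 2) ∨
      (k + l = 2 ∧ 2 * k - l = 1) := by omega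
  rcases hcases with ⟨h3, h4⟩ | ⟨h3, h4⟩ | ⟨h3, h4⟩ <;> rw [h3] at ek <;> rw [h4] at el <;>
    push_cast at ek el
  · exfalso
    rcases hne with h | h
    · exact h (by linarith)
    · exact h (by linarith)
  · left
    rw [hL, rhombA_eq]
    apply le_antisymm <;> rw [gen3_le] <;> simp only [mem_gen3_vertical]
    · exact ⟨⟨1, 0, 0, by module, by push_cast; linarith⟩,
        ⟨0, -1, 1, by module, by push_cast; linarith⟩, 0, 0, 1, by module, by push_cast; linarith⟩
    · exact ⟨⟨1, 0, 0, by module, by push_cast; linarith⟩,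
        ⟨0, -1, 1, by module, by push_cast; linarith⟩, 0, 0, 1, by module, by push_cast; linarith⟩
  · right
    rw [hL, rhombA_eq]
    apply le_antisymm <;> rw [gen3_le] <;> simp only [mem_gen3_vertical]
    · exact ⟨⟨1, 0, -1, by module, by push_cast; linarith⟩,
        ⟨0, -1, 0, by module, by push_cast; linarith⟩, 0, 0, -1, by module, by push_cast; linarith⟩
    · exact ⟨⟨1, 0, -1, by module, by push_cast; linarith⟩,
        ⟨0, -1, 0, by module, by push_cast; linarith⟩, 0, 0, -1, by module, by push_cast; linarith⟩

theorem three_zsmul_g0 : (3 : ℤ) • g0 = h1 + h2 := by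
  rw [h1_eq_g, h2_eq_g, ← sub_eq_zero]
  have : (3 : ℤ) • g0 - (g0 - g1 + (g0 - g2)) = g0 + g1 + g2 := by module
  rw [this, g_sum]

theorem g0_not_mem_hexL : g0 ∉ hexL := by
  rw [hexL, mem_gen2]
  rintro ⟨m, n, e⟩
  have h := three_zsmul_g0
  rw [e] at h
  have := zsmul_comb_inj cross_h1_h2 (m := 3 * m) (n := 3 * n) (m' := 1) (n' := 1) (by
    rw [one_smul, one_smul, ← h]; module)
  omega

/-- A vector that is moved by the rotation by a vector of the hexagonal lattice. -/
theorem exists_of_rot3_sub_mem {p : Plane} (h : rot3 p - p ∈ hexL) :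
    ∃ q ∈ hexL, p = q ∨ p = q + g0 ∨ p = q - g0 := by
  rw [hexL, mem_gen2] at h
  obtain ⟨m, n, e⟩ := h
  have hg2 : g2 = -g0 - g1 := by
    rw [← sub_eq_zero, ← g_sum]; abel
  have hh2 : h2 = (2 : ℤ) • g0 + g1 := by rw [h2_eq_g, hg2]; module
  have hrot : rot3 (rot3 p - p) = m • (h2 - h1) + n • -h1 := by
    rw [e, map_add, map_zsmul, map_zsmul, rot3_h1, rot3_h2]
  -- Since `(ρ + 2)(ρ - 1) = -3`, the vector `ρ p - p` determines `3p`.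
  have h3 : (3 : ℤ) • p = (3 : ℤ) • (-(m + n) • g0 + -n • g1) := by
    have : (3 : ℤ) • p = -((2 : ℤ) • (rot3 p - p) + rot3 (rot3 p - p)) := by
      rw [map_sub, rot3_rot3]; module
    rw [this, hrot, e, hh2, h1_eq_g]
    module
  have hp : p = -(m + n) • g0 + -n • g1 := by
    rw [← Int.cast_smul_eq_zsmul ℝ, ← Int.cast_smul_eq_zsmul ℝ (3 : ℤ)] at h3
    exact smul_right_injective Plane (by norm_num) h3
  have hg1 : g1 = g0 - h1 := by rw [h1_eq_g]; abel
  have m1 : h1 ∈ hexL := left_mem_gen2 _ _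
  have m3 : (3 : ℤ) • g0 ∈ hexL := by
    rw [three_zsmul_g0]
    exact add_mem m1 (right_mem_gen2 _ _)
  have hp' : p = n • h1 + -(m + 2 * n) • g0 := by
    rw [hp, hg1]; module
  obtain ⟨k, hk | hk | hk⟩ : ∃ k, -(m + 2 * n) = 3 * k ∨ -(m + 2 * n) = 3 * k + 1 ∨
    -(m + 2 * n) = 3 * k - 1 := ⟨(-(m + 2 * n) + 1) / 3, by omega⟩
  all_goals
    refine ⟨n • h1 + k • (3 : ℤ) • g0, add_mem (zsmul_mem m1 n) (zsmul_mem m3 k), ?_⟩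
    rw [hk] at hp'
  · exact Or.inl (by rw [hp']; module)
  · exact Or.inr (Or.inl (by rw [hp']; module))
  · exact Or.inr (Or.inr (by rw [hp']; module))

/-- For a lattice vector over `p`, the vector `ρ p - p` has height `0`, so `𝒫(L)` lies in the
hexagonal lattice and its two translates by `±g0`. As it is strictly larger, some vector lies over
`g0`; its height is a third of a multiple of `c`, and not a multiple of `c`, since `g0` is not a
hexagonal vector. -/
theorem rhombB_threefold {L : AddSubgroup Space} {c : ℝ} (hc : 0 < c)
    (hv : ∀ z : ℝ, pt 0 z ∈ L ↔ ∃ n : ℤ, z = n * c) (hR : restr0 L = hexL) (hlt : hexL < projL L)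
    (hrot : ∀ p z, pt p z ∈ L → pt (rot3 p) z ∈ L) : L = rhombB c ∨ L = rhombB (-c) := by
  have hR' : ∀ x, x ∈ hexL ↔ pt x 0 ∈ L := fun x => by rw [← hR]; rfl
  have hdec : ∀ {p z}, pt p z ∈ L → ∃ q ∈ hexL, p = q ∨ p = q + g0 ∨ p = q - g0 := by
    intro p z hp
    have := sub_mem (hrot _ _ hp) hp
    rw [pt_sub, sub_self, ← hR'] at this
    exact exists_of_rot3_sub_mem this
  obtain ⟨y, hy⟩ : ∃ y, pt g0 y ∈ L := by
    obtain ⟨p, hp, hpH⟩ := SetLike.exists_of_lt hlt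
    obtain ⟨z, hz⟩ := mem_projL.1 hp
    obtain ⟨q, hq, rfl | rfl | rfl⟩ := hdec hz
    · exact absurd hq hpH
    · have := sub_mem hz ((hR' _).1 hq)
      rw [pt_sub, add_sub_cancel_left] at this
      exact ⟨_, this⟩
    · have := sub_mem ((hR' _).1 hq) hz
      rw [pt_sub, sub_sub_cancel] at this
      exact ⟨_, this⟩
  obtain ⟨n, hn⟩ : ∃ n : ℤ, 3 * y = n * c := by
    have m3 : h1 + h2 ∈ hexL := add_mem (left_mem_gen2 _ _) (right_mem_gen2 _ _)
    have := sub_mem (zsmul_mem hy 3) ((hR' _).1 m3)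
    rw [pt_zsmul, three_zsmul_g0, pt_sub, sub_self, sub_zero, hv] at this
    simpa using this
  have hshift : ∀ k : ℤ, pt g0 (y + k * c) ∈ L := by
    intro k
    have := add_mem hy ((hv _).2 ⟨k, rfl⟩)
    rwa [pt_add, add_zero] at this
  have key : ∀ d : ℝ, (d = c ∨ d = -c) → pt g0 (-(d / 3)) ∈ L → L = rhombB d := by
    intro d hd hg
    have hd0 : d ≠ 0 := by rcases hd with rfl | rfl <;> simp [hc.ne']
    have hvert : ∀ z : ℝ, pt 0 z ∈ L ↔ ∃ n : ℤ, z = n * d := by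
      intro z
      rw [hv]
      rcases hd with rfl | rfl
      · rfl
      · constructor
        · rintro ⟨n, rfl⟩
          exact ⟨-n, by push_cast; ring⟩
        · rintro ⟨n, rfl⟩
          exact ⟨-n, by push_cast; ring⟩
    refine eq_gen3_of_projL hvert ?_ ((hR' _).1 (left_mem_gen2 h1 h2)) hg
    have m1 : h1 ∈ projL L := mem_projL.2 ⟨0, (hR' _).1 (left_mem_gen2 h1 h2)⟩
    have m2 : g0 ∈ projL L := mem_projL.2 ⟨_, hg⟩
    apply le_antisymm
    · intro p hp
      obtain ⟨z, hz⟩ := mem_projL.1 hp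
      have hg0 : g0 ∈ gen2 h1 g0 := right_mem_gen2 _ _
      have hle : hexL ≤ gen2 h1 g0 := by
        rw [hexL, gen2_le]
        refine ⟨left_mem_gen2 _ _, ?_⟩
        have := sub_mem (zsmul_mem hg0 3) (left_mem_gen2 h1 g0)
        rwa [three_zsmul_g0, add_sub_cancel_left] at this
      obtain ⟨q, hq, rfl | rfl | rfl⟩ := hdec hz
      exacts [hle hq, add_mem (hle hq) hg0, sub_mem (hle hq) hg0]
    · rw [gen2_le]
      exact ⟨m1, m2⟩
  obtain ⟨k, hk | hk | hk⟩ : ∃ k, n = 3 * k ∨ n = 3 * k + 1 ∨ n = 3 * k - 1 :=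
    ⟨(n + 1) / 3, by omega⟩ <;> rw [hk] at hn <;> push_cast at hn
  · refine absurd ((hR' _).2 ?_) g0_not_mem_hexL
    convert hshift (-k) using 2
    push_cast
    linarith
  · refine Or.inr (key (-c) (Or.inr rfl) ?_)
    convert hshift (-k) using 2
    push_cast
    linarith
  · refine Or.inl (key c (Or.inl rfl) ?_)
    convert hshift (-k) using 2
    push_cast
    linarith

/-- When `σ L ⊄ L` the rotation acts on the lattice itself, by using a width that is not a vertical
period. In the table, a rectangular width excludes everything except the hexagonal prism. -/
theorem threefold (hΓ : IsCryst Γ) (hex : ∃ y0 : ℝ, 0 < y0 ∧ periods Γ y0 = hexL)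
    (hsym : ∀ y0 : ℝ, 0 < y0 → ∃ (v : Plane) (ρ : Plane ≃ₗᵢ[ℝ] Plane),
      ρ ≠ 1 ∧ ρ ^ 3 = 1 ∧ IsProjSymm Γ y0 v ρ) :
    ∃ c : ℝ, c ≠ 0 ∧ (trans Γ = gen3 (pt h1 0) (pt h2 0) (pt 0 c) ∨
      trans Γ = rhombA c ∨ trans Γ = rhombB c) := by
  have hrot : ¬SigmaInv (trans Γ) → ∀ y0, 0 < y0 → pt 0 y0 ∉ trans Γ →
      ∀ p z, pt p z ∈ trans Γ → pt (rot3 p) z ∈ trans Γ := by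
    intro hσ y0 hy0 hy p z hp
    obtain ⟨v, ρ, h1, h3, hs⟩ := hsym y0 hy0
    exact rot3_mem_trans hΓ hσ hy0 hy h1 h3 hs hp
  obtain ⟨y0, hy0, hper⟩ := hex
  rcases complete hΓ hy0 hper with h | ⟨a3, b3, c, h⟩ | ⟨a, b, a3, b3, c, h⟩ | h
  · obtain ⟨hσ, -, hv⟩ := not_sigmaInv_of_case1 hΓ h
    exact absurd h (not_case1_of_rot3 hΓ (hrot hσ y0 hy0 fun h => hy0.ne' (hv _ h)))
  · obtain ⟨hc, hv, hσ⟩ := h.vertical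
    obtain ⟨-, y, hy, hy', -⟩ := exists_periods_eq hΓ hc hv hσ
    rcases case21_threefold h (hrot hσ y hy hy') with h | h
    · exact ⟨c, hc.ne', Or.inr (Or.inl h)⟩
    · exact ⟨-c, neg_ne_zero.2 hc.ne', Or.inr (Or.inl h)⟩
  · obtain ⟨hc, hv, hσ⟩ := h.vertical
    obtain ⟨-, y, hy, hy', -⟩ := exists_periods_eq hΓ hc hv hσ
    have hlt := h.hexL_lt
    rw [← h.projL_eq] at hlt
    rcases rhombB_threefold hc hv h.restr0_eq hlt (hrot hσ y hy hy') with h | h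
    · exact ⟨c, hc.ne', Or.inr (Or.inr h)⟩
    · exact ⟨-c, neg_ne_zero.2 hc.ne', Or.inr (Or.inr h)⟩
  · rcases h.cases hΓ with ⟨c, y1, hL, hc, -⟩ | ⟨y, hy, h⟩
    · exact ⟨c, hc.ne', Or.inl hL⟩
    · obtain ⟨v, ρ, h1, h3, hs⟩ := hsym y hy
      exact absurd (isProjSymm_periods hs) (h.not_threefold h1 h3)

end

end ProjPer

open ProjPer in
theorem mainTheorem3 :
    -- the list is complete
    (∀ Γ : Subgroup Euc, IsCryst Γ → ∀ y0 : ℝ, 0 < y0 → periods Γ y0 = hexL →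
      Case1 (trans Γ) ∨
      (∃ a3 b3 c : ℝ, Case21 (trans Γ) a3 b3 c) ∨
      (∃ (a b : Plane) (a3 b3 c : ℝ), Case22 (trans Γ) a b a3 b3 c) ∨
      (∃ α : Plane ≃ₗᵢ[ℝ] Plane, HolHex α ∧
        ∃ k ∈ columns, ∃ c y1 : ℝ, k.Has (conjPlus α Γ) c y1)) ∧
    -- every entry of the list occurs
    (∀ L : AddSubgroup Space,
      (Case1 L ∨ (∃ a3 b3 c : ℝ, Case21 L a3 b3 c) ∨
        (∃ (a b : Plane) (a3 b3 c : ℝ), Case22 L a b a3 b3 c)) →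
      ∃ Γ : Subgroup Euc, IsCryst Γ ∧ trans Γ = L) ∧
    (∀ k ∈ columns, ∀ c y1 : ℝ, 0 < c → y1 ∈ Set.Ico 0 c →
      ∃ Γ : Subgroup Euc, IsCryst Γ ∧ k.Has Γ c y1) ∧
    -- case 1: the standard hexagonal lattice for all widths
    (∀ Γ : Subgroup Euc, IsCryst Γ → Case1 (trans Γ) →
      ∀ y0 : ℝ, 0 < y0 → periods Γ y0 = hexL) ∧
    -- case 2 in general
    (∀ Γ : Subgroup Euc, IsCryst Γ → ∀ c : ℝ, 0 < c →
      (∀ z : ℝ, pt 0 z ∈ trans Γ ↔ ∃ n : ℤ, z = n * c) → ¬ SigmaInv (trans Γ) →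
      ∀ y0 : ℝ, 0 < y0 →
        (y0 ∈ widths 0 c → periods Γ y0 = projL (trans Γ)) ∧
        (y0 ∉ widths 0 c → periods Γ y0 = restr0 (trans Γ))) ∧
    -- case 2.1: a proper submodule of the standard hexagonal lattice for the other widths
    (∀ Γ : Subgroup Euc, IsCryst Γ → ∀ a3 b3 c : ℝ, Case21 (trans Γ) a3 b3 c →
      (a3 ≠ 0 ∨ b3 ≠ 0) ∧ restr0 (trans Γ) < hexL ∧
      (restr0 (trans Γ) : Set Plane) = {x | ∃ p ∈ modD a3 b3 c, x = p.1 • h1 + p.2 • h2} ∧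
      ∀ y0 : ℝ, 0 < y0 →
        (y0 ∈ widths 0 c → periods Γ y0 = hexL) ∧
        (y0 ∉ widths 0 c → periods Γ y0 = restr0 (trans Γ))) ∧
    -- case 2.2: a lattice strictly containing the standard hexagonal lattice for widths in `A`
    (∀ Γ : Subgroup Euc, IsCryst Γ → ∀ (a b : Plane) (a3 b3 c : ℝ),
      Case22 (trans Γ) a b a3 b3 c →
      hexL < gen2 a b ∧ LinearIndependent ℝ ![a, b] ∧
      ∀ y0 : ℝ, 0 < y0 →
        (y0 ∈ widths 0 c → periods Γ y0 = gen2 a b) ∧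
        (y0 ∉ widths 0 c → periods Γ y0 = hexL)) ∧
    -- cases 3, 4 and 5: the tables
    (∀ Γ : Subgroup Euc, IsCryst Γ → ∀ k ∈ columns, ∀ c y1 : ℝ, k.Has Γ c y1 →
      PeriodTable Γ c y1 k.onA k.onB k.onC k.onO) ∧
    -- the standard hexagonal lattice, or some hexagonal lattice, for all widths
    (∀ Γ : Subgroup Euc, IsCryst Γ → (∃ y0 : ℝ, 0 < y0 ∧ periods Γ y0 = hexL) →
      ((∀ y0 : ℝ, 0 < y0 → periods Γ y0 = hexL) ↔
        Case1 (trans Γ) ∨ (∃ c y1 : ℝ, col31.Has Γ c y1) ∨ (∃ c y1 : ℝ, col41a.Has Γ c y1)) ∧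
      ((∀ y0 : ℝ, 0 < y0 → IsHexagonal (periods Γ y0)) ↔
        Case1 (trans Γ) ∨ (∃ c y1 : ℝ, col31.Has Γ c y1) ∨ (∃ c y1 : ℝ, col41a.Has Γ c y1) ∨
        (((∃ a3 b3 c : ℝ, Case21 (trans Γ) a3 b3 c) ∨
            (∃ (a b : Plane) (a3 b3 c : ℝ), Case22 (trans Γ) a b a3 b3 c)) ∧
          IsHexagonal (projL (trans Γ)) ∧ IsHexagonal (restr0 (trans Γ))))) ∧
    -- the rhombohedral lattice and the three cubic lattices
    (IsHexagonal bigHex ∧ IsHexagonal hexL ∧ IsHexagonal smallHex) ∧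
    (IsRhombohedral rhombohedralL ∧ ProjectsTo rhombohedralL 3 hexL smallHex ∧
      modD 1 1 3 = AddSubgroup.closure {(2, 1), (1, 2)}) ∧
    (IsPrimitiveCubic primitiveL ∧ ProjectsTo primitiveL (√6 / 2) bigHex hexL ∧
      modD 0 (-(√6 / 6)) (√6 / 2) = AddSubgroup.closure {(0, 3), (1, 3)}) ∧
    (IsBodyCentredCubic bodyL ∧ ProjectsTo bodyL (√6 / 4) bigHex hexL ∧
      modD 0 (-(√6 / 12)) (√6 / 4) = AddSubgroup.closure {(0, 3), (1, 3)}) ∧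
    (IsFaceCentredCubic faceL ∧ ProjectsTo faceL √6 bigHex hexL ∧
      modD 0 (√6 / 3) √6 = AddSubgroup.closure {(0, 3), (1, 3)}) ∧
    -- a three-fold rotation for all widths forces a hexagonal or rhombohedral lattice
    (∀ c : ℝ, c ≠ 0 →
      (IsRhombohedral (rhombA c) ∧ ProjectsTo (rhombA c) c hexL smallHex) ∧
      (IsRhombohedral (rhombB c) ∧ ProjectsTo (rhombB c) c bigHex hexL)) ∧
    (∀ Γ : Subgroup Euc, IsCryst Γ → (∃ y0 : ℝ, 0 < y0 ∧ periods Γ y0 = hexL) →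
      (∀ y0 : ℝ, 0 < y0 → ∃ (v : Plane) (ρ : Plane ≃ₗᵢ[ℝ] Plane),
        ρ ≠ 1 ∧ ρ ^ 3 = 1 ∧ IsProjSymm Γ y0 v ρ) →
      ∃ c : ℝ, c ≠ 0 ∧ (trans Γ = gen3 (pt h1 0) (pt h2 0) (pt 0 c) ∨
        trans Γ = rhombA c ∨ trans Γ = rhombB c)) := by
  refine ⟨fun Γ hΓ y0 hy0 h => complete hΓ hy0 h, ?_, ?_,
    fun Γ hΓ h y0 hy0 => Case1.periods_eq hΓ h hy0,
    fun Γ hΓ c _ hv hσ y0 hy0 => periods_of_not_sigmaInv hΓ hv hσ hy0, ?_, ?_,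
    fun Γ hΓ k hk c y1 h => periodTable_of_mem_columns hΓ hk h,
    fun Γ hΓ hex => ⟨constant_iff hΓ hex, hexagonal_iff hΓ hex⟩,
    ⟨isHexagonal_bigHex, isHexagonal_hexL, isHexagonal_smallHex⟩, ?_, ?_, ?_, ?_,
    fun c hc => ⟨⟨isRhombohedral_rhombA hc, projectsTo_rhombA hc⟩,
      isRhombohedral_rhombB hc, projectsTo_rhombB hc⟩,
    fun Γ hΓ hex hsym => threefold hΓ hex hsym⟩
  · rintro L (h | ⟨a3, b3, c, h⟩ | ⟨a, b, a3, b3, c, h⟩)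
    exacts [exists_cryst_of_isLattice h.isLattice, exists_cryst_of_isLattice h.isLattice,
      exists_cryst_of_isLattice h.isLattice]
  · intro k hk c y1 hc hy1
    rw [columns_eq, List.mem_map] at hk
    obtain ⟨k, hk, rfl⟩ := hk
    exact (codes_valid k hk).exists_has hc hy1
  · intro Γ hΓ a3 b3 c h
    obtain ⟨hc, hv, hσ⟩ := h.vertical
    refine ⟨h.properties.1, h.properties.2.1, h.properties.2.2, fun y0 hy0 => ?_⟩
    rw [← h.projL_eq]
    exact periods_of_not_sigmaInv hΓ hv hσ hy0
  · intro Γ hΓ a b a3 b3 c h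
    obtain ⟨hc, hv, hσ⟩ := h.vertical
    refine ⟨h.hexL_lt, linearIndependent_pair_iff.2 h.cross_ne_zero, fun y0 hy0 => ?_⟩
    rw [← h.projL_eq, ← h.restr0_eq]
    exact periods_of_not_sigmaInv hΓ hv hσ hy0
  · refine ⟨?_, ?_, modD_one_one_three⟩ <;> rw [rhombohedralL_eq]
    exacts [isRhombohedral_rhombA (by norm_num), projectsTo_rhombA (by norm_num)]
  · have hs : √6 / 2 ≠ 0 := by have := sqrt6_pos; positivity
    refine ⟨isPrimitiveCubic_primitiveL, ?_, modD_third hs (Or.inr (by ring))⟩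
    rw [primitiveL_eq]
    exact projectsTo_rhombB hs
  · have hs : √6 / 4 ≠ 0 := by have := sqrt6_pos; positivity
    refine ⟨isBodyCentredCubic_bodyL, ?_, modD_third hs (Or.inr (by ring))⟩
    rw [bodyL_eq]
    exact projectsTo_rhombB hs
  · have hs : √6 ≠ 0 := sqrt6_pos.ne'
    refine ⟨isFaceCentredCubic_faceL, ?_, modD_third hs (Or.inl rfl)⟩
    rw [faceL_eq]
    -- The face-centred lattice has parameter `-√6`; the set of widths is the same for `√6`.
    have h := (projectsTo_rhombB (neg_ne_zero.2 hs)).neg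
    rwa [neg_neg] at h
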